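/- Let $P\subset\mathbb R^2$ be a polygonal element: a bounded, connected, open set whose boundary is a closed polygonal line without self-intersections, with $n\ge 3$ vertices $x_1,\dots,x_n$ and $n$ straight edges $E$ (consecutive edges may be aligned). Assume that $P$ satisfies, for some $\varrho>0$, the mesh regularity conditions that $P$ is star-shaped with respect to a disk of radius at least $\varrho\,h_P$ and that every edge has length at least $\varrho\,h_P$, where $h_P$ is the diameter of $P$. Let $k\ge 1$. Write $\mathbb P_\ell$ for the polynomials of total degree at most $\ell$, with $\mathbb P_{-1}=\{0\}$. For $v\in H^1(P)$ let $\Pi^{\nabla}_k v\in\mathbb P_k(P)$ be the elliptic projection, defined by $$\int_P\nabla(v-\Pi^\nabla_k v)\cdot\nabla q\,dx=0\quad\forall q\in\mathbb P_k(P),\qquad \int_{\partial P}(v-\Pi^\nabla_k v)\,ds=0 .$$ Consider the scalar virtual element space $$V_k(P)=\Big\{v\in H^1(P):\ v|_{\partial P}\in C^0(\partial P),\ v|_E\in\mathbb P_{k+1}(E)\ \text{for every edge }E,\ \Delta v\in\mathbb P_{k-2}(P)\Big\}$$ and, for a linear space $W$ with $\mathbb P_k=\mathbb P_{k-2}\oplus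 W$, the enhanced space $$V_k^{W}(P)=\Big\{v\in H^1(P):\ v|_{\partial P}\in C^0(\partial P),\ v|_E\in\mathbb P_{k+1}(E)\ \text{for every edge }E,\ \Delta v\in\mathbb P_{k}(P),\ \int_P(v-\Pi^\nabla_k v)\,w\,dx=0\ \ \forall w\in W\Big\},$$ where boundary values are meant in the sense of traces. (Each such $W$ is a space of polynomials whose nonzero elements have degree exactly $k$ or $k-1$; for instance, $W$ may be the span of the scaled monomials of degree $k-1$ and $k$.) Then the following degrees of freedom are unisolvent in $V_k(P)$ and, for every such $W$, in $V_k^{W}(P)$: (a) the values $v(x_i)$ at the vertices, $i=1,\dots,n$; (b) the edge moments $\frac1{|E|}\int_E v\,q\,ds$, $q\in\mathbb P_{k-1}(E)$, for every edge $E$; (c) the cell moments $\frac1{|P|}\int_P v\,q\,dx$, $q\in\mathbb P_{k-2}(P)$ (none if $k=1$). That is, the linear map which sends $v$ to its degrees of freedom, with values in $\mathbb R^n\times\prod_E\mathbb P_{k-1}(E)^*\times\mathbb P_{k-2}(P)^*$ (where $^*$ denotes the dual space), is well defined and bijective on each of these spaces. -/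

import Mathlib

open MeasureTheory Filter Topology Set
open scoped ContDiff

/-- The Euclidean plane. -/
abbrev Plane : Type := EuclideanSpace ℝ (Fin 2)

namespace VEM

noncomputable section

/-! ### Polynomials -/

/-- `P_ℓ`, the real polynomials in two variables of total degree at most `ℓ`.  The degree `ℓ` is an
integer and `P_ℓ = {0}` for `ℓ < 0`. -/
def polyDeg (l : ℤ) : Submodule ℝ (MvPolynomial (Fin 2) ℝ) :=
  MvPolynomial.restrictSupport ℝ {s | ((s.degree : ℕ) : ℤ) ≤ l}

/-- The function on the plane given by a polynomial in two variables. -/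
def polyFun (p : MvPolynomial (Fin 2) ℝ) (x : Plane) : ℝ :=
  MvPolynomial.eval (fun i => x i) p

/-- The partial derivative of a function on the plane in the `i`-th coordinate direction. -/
def partialDeriv (i : Fin 2) (φ : Plane → ℝ) (x : Plane) : ℝ :=
  fderiv ℝ φ x (EuclideanSpace.single i 1)

/-- `W` is a complement of `P_{k-2}` in `P_k`, that is, `P_k = P_{k-2} ⊕ W`.  Every nonzero element
of `W` then has degree `k` or `k - 1`.  Examples are the span of the scaled monomials of degree
`k - 1` and `k`, and the orthogonal complement of `P_{k-2}` in `P_k` for the `L²` inner product. -/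
def IsTopDegreeSpace (k : ℕ) (W : Submodule ℝ (MvPolynomial (Fin 2) ℝ)) : Prop :=
  polyDeg ((k : ℤ) - 2) ⊔ W = polyDeg (k : ℤ) ∧ polyDeg ((k : ℤ) - 2) ⊓ W = ⊥

/-! ### Polygonal elements -/

/-- A polygonal element with `n` vertices and `n` straight edges: a bounded connected open set
whose boundary is a closed polygonal line that does not intersect itself.  The vertices are
`polygon i`, and the `i`-th edge joins `polygon i` to its cyclic successor.  Consecutive edges may
be aligned (hanging nodes), and the element need not be convex. -/
structure PolygonalElement (n : ℕ) where
  /-- the vertices, in cyclic order -/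
  polygon : Polygon Plane n
  /-- the (open) region enclosed by the polygonal line -/
  carrier : Set Plane
  three_le : 3 ≤ n
  /-- every point of the polygonal line is reached once: two edges meet only at a common vertex -/
  simple : InjOn (fun s : Fin n × ℝ => polygon.edgePath ℝ s.1 s.2) (univ ×ˢ Ico (0 : ℝ) 1)
  isOpen : IsOpen carrier
  isBounded : Bornology.IsBounded carrier
  isConnected : IsConnected carrier
  frontier_eq : frontier carrier = polygon.boundary ℝ

namespace PolygonalElement

variable {n : ℕ} (K : PolygonalElement n)

/-- The length of the `i`-th edge. -/
def edgeLength (i : Fin n) : ℝ := dist (K.polygon i) (K.polygon (finRotate n i))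

/-- Mesh regularity of an element with constant `ρ`: the element is star-shaped with respect to a
disk of radius at least `ρ h`, and all edges have length at least `ρ h`, where `h` is the
diameter of the element. -/
def IsRegular (ρ : ℝ) : Prop :=
  (∃ (c : Plane) (r : ℝ), ρ * Metric.diam K.carrier ≤ r ∧ Metric.ball c r ⊆ K.carrier ∧
    ∀ y ∈ Metric.ball c r, StarConvex ℝ y K.carrier) ∧
  ∀ i, ρ * Metric.diam K.carrier ≤ K.edgeLength i

/-- Lebesgue measure on the element. -/
abbrev vol : Measure Plane := volume.restrict K.carrier

/-- The Hilbert space `L²` of the element (functions up to almost everywhere equality). -/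
abbrev L2 : Type := Lp ℝ 2 K.vol

/-- The integral over the `i`-th edge with respect to arc length of the function that is
`f t` at the point `edgePath i t`, `0 ≤ t ≤ 1`. -/
def edgeIntegral (i : Fin n) (f : ℝ → ℝ) : ℝ := K.edgeLength i * ∫ t in (0 : ℝ)..1, f t

/-! ### Sobolev functions, traces, Laplacians -/

/-- Smooth test functions with compact support in the element. -/
structure IsTest (φ : Plane → ℝ) : Prop where
  contDiff : ContDiff ℝ ∞ φ
  hasCompactSupport : HasCompactSupport φ
  tsupport_subset : tsupport φ ⊆ K.carrier

/-- `G` is the weak gradient of `v`.  Thus `v ∈ H¹` iff `v` has a weak gradient in `L²`. -/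
def HasWeakGradient (v : K.L2) (G : Fin 2 → K.L2) : Prop :=
  ∀ φ, K.IsTest φ → ∀ i,
    ∫ x, v x * partialDeriv i φ x ∂K.vol = - ∫ x, G i x * φ x ∂K.vol

/-- For `v ∈ H¹` with weak gradient `G`: the function `g` on the boundary is the trace of `v`, that
is, `v` is the limit in `H¹` of functions that are smooth up to the boundary, whose restrictions
to the boundary converge to `g` in `L²` of every edge. -/
def HasTrace (v : K.L2) (G : Fin 2 → K.L2) (g : Plane → ℝ) : Prop :=
  ∃ u : ℕ → Plane → ℝ, (∀ m, ContDiff ℝ ∞ (u m)) ∧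
    Tendsto (fun m => eLpNorm (fun x => u m x - v x) 2 K.vol) atTop (𝓝 0) ∧
    (∀ i, Tendsto (fun m => eLpNorm (fun x => partialDeriv i (u m) x - G i x) 2 K.vol)
      atTop (𝓝 0)) ∧
    ∀ i, Tendsto (fun m => eLpNorm
      (fun t => u m (K.polygon.edgePath ℝ i t) - g (K.polygon.edgePath ℝ i t)) 2
        (volume.restrict (Icc (0 : ℝ) 1))) atTop (𝓝 0)

/-- `v ∈ H¹`, its weak gradient is `G`, and its trace on the boundary is continuous and equal to
`g`. -/
structure IsH1 (v : K.L2) (G : Fin 2 → K.L2) (g : Plane → ℝ) : Prop where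
  hasWeakGradient : K.HasWeakGradient v G
  continuousOn : ContinuousOn g (frontier K.carrier)
  hasTrace : K.HasTrace v G g

/-- A function with weak gradient `G` has the weak Laplacian `f`. -/
def HasWeakLaplacian (G : Fin 2 → K.L2) (f : Plane → ℝ) : Prop :=
  ∀ φ, K.IsTest φ →
    ∑ i, ∫ x, G i x * partialDeriv i φ x ∂K.vol = - ∫ x, f x * φ x ∂K.vol

/-- The polynomial `q ∈ P_k` is the elliptic projection of the function with weak gradient `G` and
trace `g`: the gradient of the difference is orthogonal in `L²` to the gradients of all polynomials
in `P_k`, and the difference has mean value zero on the boundary. -/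
structure IsEllipticProjection (k : ℕ) (G : Fin 2 → K.L2) (g : Plane → ℝ)
    (q : MvPolynomial (Fin 2) ℝ) : Prop where
  mem : q ∈ polyDeg k
  grad : ∀ r ∈ polyDeg k,
    ∑ i, ∫ x, (G i x - polyFun (MvPolynomial.pderiv i q) x) *
      polyFun (MvPolynomial.pderiv i r) x ∂K.vol = 0
  bdry : ∑ i, K.edgeIntegral i
    (fun t => g (K.polygon.edgePath ℝ i t) - polyFun q (K.polygon.edgePath ℝ i t)) = 0

/-- On every edge the function `g` is a polynomial of degree at most `l`. -/
def IsPolyOnEdges (l : ℕ) (g : Plane → ℝ) : Prop :=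
  ∀ i, ∃ p ∈ Polynomial.degreeLE ℝ (l : WithBot ℕ),
    ∀ t ∈ Icc (0 : ℝ) 1, g (K.polygon.edgePath ℝ i t) = p.eval t

/-! ### Auxiliary facts: the conditions above are linear -/

section Linear

variable {K}

instance : IsFiniteMeasure K.vol :=
  ⟨by rw [Measure.restrict_apply_univ]; exact K.isBounded.measure_lt_top⟩

lemma memLp_of_continuous {f : Plane → ℝ} (hf : Continuous f) : MemLp f 2 K.vol := by
  obtain ⟨C, hC⟩ := (K.isBounded.isCompact_closure.exists_bound_of_continuousOn hf.continuousOn)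
  refine MemLp.of_bound hf.aestronglyMeasurable C ?_
  filter_upwards [ae_restrict_mem K.isOpen.measurableSet] with x hx
  exact hC x (subset_closure hx)

lemma continuous_polyFun (p : MvPolynomial (Fin 2) ℝ) : Continuous (polyFun p) := by
  unfold polyFun
  exact (MvPolynomial.continuous_eval p).comp (by fun_prop)

lemma continuous_partialDeriv {φ : Plane → ℝ} (h : ContDiff ℝ ∞ φ) (i : Fin 2) :
    Continuous (partialDeriv i φ) :=
  (h.continuous_fderiv (by simp)).clm_apply continuous_const

lemma integrable_mul_continuous (v : K.L2) {f : Plane → ℝ} (hf : Continuous f) :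
    Integrable (fun x => v x * f x) K.vol :=
  (Lp.memLp v).integrable_mul (memLp_of_continuous hf)

lemma integral_add_mul (v w : K.L2) {f : Plane → ℝ} (hf : Continuous f) :
    ∫ x, (v + w : K.L2) x * f x ∂K.vol = ∫ x, v x * f x ∂K.vol + ∫ x, w x * f x ∂K.vol := by
  rw [← integral_add (integrable_mul_continuous v hf) (integrable_mul_continuous w hf)]
  refine integral_congr_ae ?_
  filter_upwards [Lp.coeFn_add v w] with x hx
  rw [hx, Pi.add_apply, add_mul]

lemma integral_smul_mul (c : ℝ) (v : K.L2) (f : Plane → ℝ) :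
    ∫ x, (c • v : K.L2) x * f x ∂K.vol = c * ∫ x, v x * f x ∂K.vol := by
  rw [← integral_const_mul]
  refine integral_congr_ae ?_
  filter_upwards [Lp.coeFn_smul c v] with x hx
  rw [hx, Pi.smul_apply, smul_eq_mul, mul_assoc]

lemma integral_sub_mul (v : K.L2) {f h : Plane → ℝ} (hf : Continuous f) (hh : Continuous h) :
    ∫ x, (v x - h x) * f x ∂K.vol = ∫ x, v x * f x ∂K.vol - ∫ x, h x * f x ∂K.vol := by
  have ih : Integrable (fun x => h x * f x) K.vol :=
    (memLp_of_continuous hh).integrable_mul (memLp_of_continuous hf)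
  rw [← integral_sub (integrable_mul_continuous v hf) ih]
  simp only [sub_mul]

lemma integral_poly_add_mul (p q : MvPolynomial (Fin 2) ℝ) {f : Plane → ℝ} (hf : Continuous f) :
    ∫ x, polyFun (p + q) x * f x ∂K.vol =
      ∫ x, polyFun p x * f x ∂K.vol + ∫ x, polyFun q x * f x ∂K.vol := by
  have ip : ∀ p, Integrable (fun x => polyFun p x * f x) K.vol := fun p =>
    (memLp_of_continuous (continuous_polyFun p)).integrable_mul (memLp_of_continuous hf)
  rw [← integral_add (ip p) (ip q)]
  refine integral_congr_ae (ae_of_all _ fun x => ?_)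
  simp [polyFun, add_mul]

lemma integral_poly_smul_mul (c : ℝ) (p : MvPolynomial (Fin 2) ℝ) (f : Plane → ℝ) :
    ∫ x, polyFun (c • p) x * f x ∂K.vol = c * ∫ x, polyFun p x * f x ∂K.vol := by
  rw [← integral_const_mul]
  refine integral_congr_ae (ae_of_all _ fun x => ?_)
  simp [polyFun, mul_assoc]

lemma edgePath_mem_frontier (i : Fin n) {t : ℝ} (ht : t ∈ Icc (0 : ℝ) 1) :
    K.polygon.edgePath ℝ i t ∈ frontier K.carrier := by
  rw [K.frontier_eq]
  exact mem_iUnion.2 ⟨i, t, ht, rfl⟩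

lemma continuous_edgePath (i : Fin n) : Continuous (fun t : ℝ => K.polygon.edgePath ℝ i t) :=
  AffineMap.lineMap_continuous

lemma continuousOn_edge {g : Plane → ℝ} (hg : ContinuousOn g (frontier K.carrier)) (i : Fin n) :
    ContinuousOn (fun t => g (K.polygon.edgePath ℝ i t)) (Icc (0 : ℝ) 1) :=
  hg.comp (continuous_edgePath i).continuousOn fun _ ht => edgePath_mem_frontier i ht

lemma intervalIntegrable_edge {g : Plane → ℝ} (hg : ContinuousOn g (frontier K.carrier))
    (i : Fin n) :
    IntervalIntegrable (fun t => g (K.polygon.edgePath ℝ i t)) volume 0 1 := by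
  apply ContinuousOn.intervalIntegrable
  rw [uIcc_of_le zero_le_one]
  exact continuousOn_edge hg i

lemma tendsto_eLpNorm_add {α : Type*} [MeasurableSpace α] {μ : Measure α}
    {f f' h : ℕ → α → ℝ} (hf : ∀ m, AEStronglyMeasurable (f m) μ)
    (hf' : ∀ m, AEStronglyMeasurable (f' m) μ)
    (h0 : ∀ m, h m =ᵐ[μ] fun x => f m x + f' m x)
    (hl : Tendsto (fun m => eLpNorm (f m) 2 μ) atTop (𝓝 0))
    (hl' : Tendsto (fun m => eLpNorm (f' m) 2 μ) atTop (𝓝 0)) :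
    Tendsto (fun m => eLpNorm (h m) 2 μ) atTop (𝓝 0) := by
  refine tendsto_of_tendsto_of_tendsto_of_le_of_le tendsto_const_nhds
    (by simpa using hl.add hl') (fun _ => zero_le) fun m => ?_
  change eLpNorm (h m) 2 μ ≤ eLpNorm (f m) 2 μ + eLpNorm (f' m) 2 μ
  rw [eLpNorm_congr_ae (h0 m)]
  exact eLpNorm_add_le (hf m) (hf' m) (by norm_num)

lemma tendsto_eLpNorm_smul {α : Type*} [MeasurableSpace α] {μ : Measure α}
    {f h : ℕ → α → ℝ} (c : ℝ) (h0 : ∀ m, h m =ᵐ[μ] fun x => c * f m x)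
    (hl : Tendsto (fun m => eLpNorm (f m) 2 μ) atTop (𝓝 0)) :
    Tendsto (fun m => eLpNorm (h m) 2 μ) atTop (𝓝 0) := by
  have key : ∀ m, eLpNorm (h m) 2 μ = ‖c‖ₑ * eLpNorm (f m) 2 μ := fun m => by
    rw [eLpNorm_congr_ae (h0 m)]
    exact eLpNorm_const_smul c (f m) 2 μ
  simp only [key]
  simpa using ENNReal.Tendsto.const_mul hl (Or.inr enorm_ne_top)

lemma partialDeriv_add {φ ψ : Plane → ℝ} (hφ : ContDiff ℝ ∞ φ) (hψ : ContDiff ℝ ∞ ψ)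
    (i : Fin 2) (x : Plane) :
    partialDeriv i (fun y => φ y + ψ y) x = partialDeriv i φ x + partialDeriv i ψ x := by
  unfold partialDeriv
  rw [fderiv_fun_add (hφ.differentiable (by simp) x) (hψ.differentiable (by simp) x)]
  rfl

lemma partialDeriv_const_mul {φ : Plane → ℝ} (hφ : ContDiff ℝ ∞ φ) (c : ℝ)
    (i : Fin 2) (x : Plane) :
    partialDeriv i (fun y => c * φ y) x = c * partialDeriv i φ x := by
  unfold partialDeriv
  rw [fderiv_const_mul (hφ.differentiable (by simp) x)]
  rfl

lemma IsH1.add {v v' : K.L2} {G G' : Fin 2 → K.L2} {g g' : Plane → ℝ}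
    (h : K.IsH1 v G g) (h' : K.IsH1 v' G' g') : K.IsH1 (v + v') (G + G') (g + g') := by
  refine ⟨fun φ hφ i => ?_, h.continuousOn.add h'.continuousOn, ?_⟩
  · rw [Pi.add_apply, integral_add_mul _ _ (continuous_partialDeriv hφ.contDiff i),
      integral_add_mul _ _ hφ.contDiff.continuous, h.hasWeakGradient φ hφ i,
      h'.hasWeakGradient φ hφ i, neg_add]
  · obtain ⟨u, hu, h1, h2, h3⟩ := h.hasTrace
    obtain ⟨u', hu', h1', h2', h3'⟩ := h'.hasTrace
    refine ⟨fun m x => u m x + u' m x, fun m => (hu m).add (hu' m), ?_, fun i => ?_, fun i => ?_⟩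
    · refine tendsto_eLpNorm_add
        (fun m => (hu m).continuous.aestronglyMeasurable.sub (Lp.aestronglyMeasurable v))
        (fun m => (hu' m).continuous.aestronglyMeasurable.sub (Lp.aestronglyMeasurable v'))
        (fun m => ?_) h1 h1'
      filter_upwards [Lp.coeFn_add v v'] with x hx
      simp only [hx, Pi.add_apply, Pi.sub_apply]
      ring
    · refine tendsto_eLpNorm_add
        (fun m => (continuous_partialDeriv (hu m) i).aestronglyMeasurable.sub
          (Lp.aestronglyMeasurable (G i)))
        (fun m => (continuous_partialDeriv (hu' m) i).aestronglyMeasurable.sub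
          (Lp.aestronglyMeasurable (G' i)))
        (fun m => ?_) (h2 i) (h2' i)
      filter_upwards [Lp.coeFn_add (G i) (G' i)] with x hx
      simp only [Pi.add_apply, Pi.sub_apply, hx, partialDeriv_add (hu m) (hu' m)]
      ring
    · refine tendsto_eLpNorm_add
        (fun m => ((hu m).continuous.comp (continuous_edgePath i)).aestronglyMeasurable.sub
          ((continuousOn_edge h.continuousOn i).aestronglyMeasurable measurableSet_Icc))
        (fun m => ((hu' m).continuous.comp (continuous_edgePath i)).aestronglyMeasurable.sub
          ((continuousOn_edge h'.continuousOn i).aestronglyMeasurable measurableSet_Icc))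
        (fun m => ae_of_all _ fun t => ?_) (h3 i) (h3' i)
      simp only [Pi.add_apply, Pi.sub_apply, Function.comp_apply]
      ring

lemma IsH1.smul {v : K.L2} {G : Fin 2 → K.L2} {g : Plane → ℝ} (c : ℝ)
    (h : K.IsH1 v G g) : K.IsH1 (c • v) (c • G) (c • g) := by
  refine ⟨fun φ hφ i => ?_, h.continuousOn.const_smul c, ?_⟩
  · rw [Pi.smul_apply, integral_smul_mul, integral_smul_mul, h.hasWeakGradient φ hφ i, mul_neg]
  · obtain ⟨u, hu, h1, h2, h3⟩ := h.hasTrace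
    refine ⟨fun m x => c * u m x, fun m => contDiff_const.mul (hu m), ?_, fun i => ?_,
      fun i => ?_⟩
    · refine tendsto_eLpNorm_smul c (fun m => ?_) h1
      filter_upwards [Lp.coeFn_smul c v] with x hx
      simp only [hx, Pi.smul_apply, smul_eq_mul]
      ring
    · refine tendsto_eLpNorm_smul c (fun m => ?_) (h2 i)
      filter_upwards [Lp.coeFn_smul c (G i)] with x hx
      simp only [Pi.smul_apply, hx, partialDeriv_const_mul (hu m), smul_eq_mul]
      ring
    · refine tendsto_eLpNorm_smul c (fun m => ae_of_all _ fun t => ?_) (h3 i)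
      simp only [Pi.smul_apply, smul_eq_mul]
      ring

lemma partialDeriv_zero (i : Fin 2) (x : Plane) : partialDeriv i (fun _ => (0 : ℝ)) x = 0 := by
  simp [partialDeriv]

lemma integral_zero_mul (f : Plane → ℝ) : ∫ x, (0 : K.L2) x * f x ∂K.vol = 0 := by
  have h := integral_smul_mul (K := K) 0 0 f
  rwa [zero_smul, zero_mul] at h

lemma polyFun_zero (x : Plane) : polyFun 0 x = 0 := map_zero _

lemma isH1_zero : K.IsH1 0 0 0 := by
  refine ⟨fun φ _ i => ?_, continuousOn_const, fun _ _ => 0, fun _ => contDiff_const, ?_,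
    fun i => ?_, fun i => ?_⟩
  · simp only [Pi.zero_apply, integral_zero_mul, neg_zero]
  · have e : eLpNorm (fun x => 0 - (0 : K.L2) x) 2 K.vol = 0 := by
      rw [eLpNorm_congr_ae (g := 0), eLpNorm_zero]
      filter_upwards [Lp.coeFn_zero ℝ 2 K.vol] with x hx
      rw [hx]
      simp
    simp only [e]
    exact tendsto_const_nhds
  · have e : eLpNorm (fun x => partialDeriv i (fun _ => (0 : ℝ)) x - (0 : K.L2) x) 2 K.vol = 0 := by
      rw [eLpNorm_congr_ae (g := 0), eLpNorm_zero]
      filter_upwards [Lp.coeFn_zero ℝ 2 K.vol] with x hx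
      rw [hx, partialDeriv_zero]
      simp
    simp only [Pi.zero_apply, e]
    exact tendsto_const_nhds
  · simp

lemma HasWeakLaplacian.add {G G' : Fin 2 → K.L2} {p p' : MvPolynomial (Fin 2) ℝ}
    (h : K.HasWeakLaplacian G (polyFun p)) (h' : K.HasWeakLaplacian G' (polyFun p')) :
    K.HasWeakLaplacian (G + G') (polyFun (p + p')) := fun φ hφ => by
  rw [integral_poly_add_mul _ _ hφ.contDiff.continuous, neg_add, ← h φ hφ, ← h' φ hφ,
    ← Finset.sum_add_distrib]
  exact Finset.sum_congr rfl fun i _ =>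
    integral_add_mul _ _ (continuous_partialDeriv hφ.contDiff i)

lemma HasWeakLaplacian.smul {G : Fin 2 → K.L2} {p : MvPolynomial (Fin 2) ℝ} (c : ℝ)
    (h : K.HasWeakLaplacian G (polyFun p)) :
    K.HasWeakLaplacian (c • G) (polyFun (c • p)) := fun φ hφ => by
  rw [integral_poly_smul_mul, ← mul_neg, ← h φ hφ, Finset.mul_sum]
  exact Finset.sum_congr rfl fun i _ => integral_smul_mul _ _ _

lemma IsPolyOnEdges.add {l : ℕ} {g g' : Plane → ℝ} (h : K.IsPolyOnEdges l g)
    (h' : K.IsPolyOnEdges l g') : K.IsPolyOnEdges l (g + g') := fun i => by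
  obtain ⟨p, hp, e⟩ := h i
  obtain ⟨p', hp', e'⟩ := h' i
  exact ⟨p + p', add_mem hp hp', fun t ht => by simp [e t ht, e' t ht]⟩

lemma IsPolyOnEdges.smul {l : ℕ} {g : Plane → ℝ} (c : ℝ) (h : K.IsPolyOnEdges l g) :
    K.IsPolyOnEdges l (c • g) := fun i => by
  obtain ⟨p, hp, e⟩ := h i
  exact ⟨c • p, Submodule.smul_mem _ c hp, fun t ht => by simp [e t ht]⟩

lemma intervalIntegrable_poly_edge (q : MvPolynomial (Fin 2) ℝ) (i : Fin n) :
    IntervalIntegrable (fun t => polyFun q (K.polygon.edgePath ℝ i t)) volume 0 1 :=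
  ((continuous_polyFun q).comp (continuous_edgePath i)).intervalIntegrable 0 1

lemma IsEllipticProjection.add {k : ℕ} {G G' : Fin 2 → K.L2} {g g' : Plane → ℝ}
    {q q' : MvPolynomial (Fin 2) ℝ}
    (hg : ContinuousOn g (frontier K.carrier)) (hg' : ContinuousOn g' (frontier K.carrier))
    (h : K.IsEllipticProjection k G g q) (h' : K.IsEllipticProjection k G' g' q') :
    K.IsEllipticProjection k (G + G') (g + g') (q + q') := by
  refine ⟨add_mem h.mem h'.mem, fun r hr => ?_, ?_⟩
  · have e := h.grad r hr
    have e' := h'.grad r hr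
    simp only [integral_sub_mul _ (continuous_polyFun _) (continuous_polyFun _),
      Fin.sum_univ_two] at e e'
    simp only [integral_sub_mul _ (continuous_polyFun _) (continuous_polyFun _), Pi.add_apply,
      integral_add_mul _ _ (continuous_polyFun _), map_add,
      integral_poly_add_mul _ _ (continuous_polyFun _), Fin.sum_univ_two]
    linarith
  · have e := h.bdry
    have e' := h'.bdry
    refine Eq.trans ?_ ((congrArg₂ (· + ·) e e').trans (add_zero 0))
    rw [← Finset.sum_add_distrib]
    refine Finset.sum_congr rfl fun i _ => ?_
    unfold edgeIntegral
    rw [← mul_add, ← intervalIntegral.integral_add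
      ((intervalIntegrable_edge hg i).sub (intervalIntegrable_poly_edge (K := K) q i))
      ((intervalIntegrable_edge hg' i).sub (intervalIntegrable_poly_edge (K := K) q' i))]
    congr 1
    refine intervalIntegral.integral_congr fun t _ => ?_
    simp only [Pi.add_apply, polyFun, map_add]
    ring

lemma IsEllipticProjection.smul {k : ℕ} {G : Fin 2 → K.L2} {g : Plane → ℝ}
    {q : MvPolynomial (Fin 2) ℝ} (c : ℝ) (h : K.IsEllipticProjection k G g q) :
    K.IsEllipticProjection k (c • G) (c • g) (c • q) := by
  refine ⟨Submodule.smul_mem _ c h.mem, fun r hr => ?_, ?_⟩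
  · have e := h.grad r hr
    simp only [integral_sub_mul _ (continuous_polyFun _) (continuous_polyFun _),
      Fin.sum_univ_two] at e
    simp only [integral_sub_mul _ (continuous_polyFun _) (continuous_polyFun _), Pi.smul_apply,
      integral_smul_mul, Derivation.map_smul, integral_poly_smul_mul, Fin.sum_univ_two]
    linear_combination c * e
  · have e := h.bdry
    rw [← mul_zero c, ← e, Finset.mul_sum]
    refine Finset.sum_congr rfl fun i _ => ?_
    unfold edgeIntegral
    rw [mul_left_comm]
    congr 1
    rw [← intervalIntegral.integral_const_mul]
    refine intervalIntegral.integral_congr fun t _ => ?_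
    simp [polyFun, mul_sub]

end Linear

/-! ### The virtual element spaces -/

/-- `v ∈ H¹` with weak gradient `G` and continuous trace `g`, the trace is a polynomial of degree
at most `k + 1` on every edge, and the Laplacian of `v` is a polynomial of degree at most `l`. -/
structure IsVirtual (k : ℕ) (l : ℤ) (v : K.L2) (G : Fin 2 → K.L2) (g : Plane → ℝ) : Prop where
  isH1 : K.IsH1 v G g
  edges : K.IsPolyOnEdges (k + 1) g
  laplacian : ∃ p ∈ polyDeg l, K.HasWeakLaplacian G (polyFun p)

lemma IsVirtual.add {K : PolygonalElement n} {k : ℕ} {l : ℤ} {v v' : K.L2} {G G' : Fin 2 → K.L2} {g g' : Plane → ℝ}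
    (h : K.IsVirtual k l v G g) (h' : K.IsVirtual k l v' G' g') :
    K.IsVirtual k l (v + v') (G + G') (g + g') := by
  obtain ⟨p, hp, e⟩ := h.laplacian
  obtain ⟨p', hp', e'⟩ := h'.laplacian
  exact ⟨h.isH1.add h'.isH1, h.edges.add h'.edges, p + p', add_mem hp hp', e.add e'⟩

lemma IsVirtual.smul {K : PolygonalElement n} {k : ℕ} {l : ℤ} {v : K.L2} {G : Fin 2 → K.L2} {g : Plane → ℝ} (c : ℝ)
    (h : K.IsVirtual k l v G g) : K.IsVirtual k l (c • v) (c • G) (c • g) := by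
  obtain ⟨p, hp, e⟩ := h.laplacian
  exact ⟨h.isH1.smul c, h.edges.smul c, c • p, Submodule.smul_mem _ c hp, e.smul c⟩

lemma isVirtual_zero {K : PolygonalElement n} {k : ℕ} {l : ℤ} : K.IsVirtual k l 0 0 0 := by
  refine ⟨isH1_zero, fun i => ⟨0, zero_mem _, fun t _ => by simp⟩, 0, zero_mem _, fun φ _ => ?_⟩
  simp only [Pi.zero_apply, integral_zero_mul, polyFun_zero, zero_mul, integral_zero, neg_zero,
    Finset.sum_const_zero]

/-- The scalar virtual element space: all `v ∈ H¹` with a continuous trace that is in `P_{k+1}` on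
every edge, and with Laplacian in `P_{k-2}`. -/
def space (k : ℕ) : Submodule ℝ K.L2 where
  carrier := {v | ∃ G g, K.IsVirtual k ((k : ℤ) - 2) v G g}
  add_mem' := by
    rintro v v' ⟨G, g, h⟩ ⟨G', g', h'⟩
    exact ⟨_, _, h.add h'⟩
  zero_mem' := ⟨_, _, isVirtual_zero⟩
  smul_mem' := by
    rintro c v ⟨G, g, h⟩
    exact ⟨_, _, h.smul c⟩

/-- The enhanced scalar virtual element space: all `v ∈ H¹` with a continuous trace that is in
`P_{k+1}` on every edge, with Laplacian in `P_k`, and such that the difference of `v` and its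
elliptic projection `q` onto `P_k` is orthogonal in `L²` to `W`, where `W` stands for the
polynomials of degree exactly `k` or `k - 1`. -/
def enhancedSpace (k : ℕ) (W : Submodule ℝ (MvPolynomial (Fin 2) ℝ)) : Submodule ℝ K.L2 where
  carrier := {v | ∃ G g, K.IsVirtual k k v G g ∧ ∃ q, K.IsEllipticProjection k G g q ∧
    ∀ w ∈ W, ∫ x, (v x - polyFun q x) * polyFun w x ∂K.vol = 0}
  add_mem' := by
    rintro v v' ⟨G, g, h, q, hq, e⟩ ⟨G', g', h', q', hq', e'⟩
    refine ⟨_, _, h.add h', _, hq.add h.isH1.continuousOn h'.isH1.continuousOn hq',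
      fun w hw => ?_⟩
    have e1 := e w hw
    have e2 := e' w hw
    rw [integral_sub_mul _ (continuous_polyFun _) (continuous_polyFun _)] at e1 e2 ⊢
    rw [integral_add_mul _ _ (continuous_polyFun _),
      integral_poly_add_mul _ _ (continuous_polyFun _)]
    linarith
  zero_mem' := by
    refine ⟨0, 0, isVirtual_zero, 0, ⟨zero_mem _, fun r _ => ?_, ?_⟩, fun w _ => ?_⟩
    · simp only [Pi.zero_apply, map_zero, polyFun_zero, sub_zero, integral_zero_mul,
        Finset.sum_const_zero]
    · simp [edgeIntegral, polyFun]
    · simp only [polyFun_zero, sub_zero, integral_zero_mul]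
  smul_mem' := by
    rintro c v ⟨G, g, h, q, hq, e⟩
    refine ⟨_, _, h.smul c, _, hq.smul c, fun w hw => ?_⟩
    have e1 := e w hw
    rw [integral_sub_mul _ (continuous_polyFun _) (continuous_polyFun _)] at e1 ⊢
    rw [integral_smul_mul, integral_poly_smul_mul, ← mul_sub, e1, mul_zero]

/-! ### Degrees of freedom -/

/-- The space in which the degrees of freedom take their values: one number for every vertex, a
linear functional on `P_{k-1}` for every edge, and a linear functional on `P_{k-2}` for the cell.
Choosing bases of `P_{k-1}` and `P_{k-2}` turns it into the space of real vectors of length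
`n + n * k + k * (k - 1) / 2`. -/
abbrev DofValues (n k : ℕ) : Type :=
  (Fin n → ℝ) × (Fin n → Module.Dual ℝ (Polynomial.degreeLT ℝ k)) ×
    Module.Dual ℝ (polyDeg ((k : ℤ) - 2))

/-- `d` consists of the degrees of freedom of `v`: the values at the vertices of the continuous
trace of `v`, the moments of the trace on every edge against `P_{k-1}`, and the moments of `v` on
the cell against `P_{k-2}`. -/
def IsDofs (k : ℕ) (v : K.L2) (d : DofValues n k) : Prop :=
  ∃ G g, K.IsH1 v G g ∧
    (∀ i, d.1 i = g (K.polygon i)) ∧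
    (∀ i, ∀ q : Polynomial.degreeLT ℝ k, d.2.1 i q = (K.edgeLength i)⁻¹ *
      K.edgeIntegral i (fun t => g (K.polygon.edgePath ℝ i t) * (q : Polynomial ℝ).eval t)) ∧
    ∀ q : polyDeg ((k : ℤ) - 2), d.2.2 q = (volume.real K.carrier)⁻¹ *
      ∫ x, v x * polyFun (q : MvPolynomial (Fin 2) ℝ) x ∂K.vol

/-- The degrees of freedom are unisolvent in the space `V`: every `v ∈ V` has well-defined degrees
of freedom, they depend linearly on `v`, and every choice of values of the degrees of freedom is
attained by exactly one `v ∈ V`. -/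
def Unisolvent (k : ℕ) (V : Submodule ℝ K.L2) : Prop :=
  ∃ Φ : V ≃ₗ[ℝ] DofValues n k, ∀ (v : V) (d : DofValues n k), K.IsDofs k v d ↔ Φ v = d

end PolygonalElement

end

end VEM

namespace VEM

noncomputable section

/-! ### Polynomials in two variables -/

/-! Injectivity and surjectivity of the degrees of freedom are proved separately, without knowing
the dimension of the virtual element spaces. Both rest on the Dirichlet problem in `H10`, the
closure of the test functions in H¹, whose elements are kept as pairs (function, gradient).

Injectivity. On an edge the trace has degree at most k + 1. If it vanishes at both ends it equals
t(t - 1)b with deg b < k, and testing with b gives b = 0 (`eq_zero_of_edge_moments`). Vanishing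
degrees of freedom thus force zero trace, so that v lies in `H10` (`mem_H10_of_trace_zero`), and v
is orthogonal to P_{k-2}. If Δv = p is in P_{k-2}, then ‖∇v‖² = -∫ p v = 0, and the Poincaré
inequality yields v = 0 (`eq_zero_of_hasWeakLaplacian`). In the enhanced space p is only in P_k. But
∫ ∇v·∇r = -∫ v Δr = 0 for r in P_k, because Δr is in P_{k-2}; as the boundary mean also vanishes,
the elliptic projection of v is 0. Hence v is orthogonal to W as well, so to all of P_k, and the
same argument applies.

Surjectivity. A dimension count on each edge produces boundary polynomials, which are glued,
extended to a Lipschitz function on the plane and lifted to H¹ (`exists_lipschitz_of_polys`,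
`exists_isH1_of_lipschitz`). A correction in `H10` then makes the Laplacian an element of P_l with
arbitrary moments against P_l (`exists_dirichlet`): the pairing of q with the zero-trace solution of
Δw = p is negative definite on P_l. With l = k - 2 this settles `space`. For the enhanced space,
start from v₀ in `space` with elliptic projection q, keep its trace and its P_{k-2} moments, and
prescribe the moments of q against W; by the identity above the projection of the new function is
still q.

The degrees of freedom are well defined because the weak gradient and the continuous trace are
unique. Uniqueness of the trace and the step from zero trace to `H10` come from estimates near the
boundary. As the element is star-shaped about a ball with center c, no edge is aligned with c, and
the triangles with apex c parametrize the boundary layer by rays. Integration along rays gives the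
trace inequality `exists_edgeSq_le` and the bound ‖u‖²_layer ≤ C(σ‖u‖²_edge + σ²‖∇u‖²_layer) of
`exists_layer_le`, whose factor σ² absorbs the gradient, of order 1/σ, of a cutoff function. -/

lemma mem_polyDeg_iff {l : ℤ} {p : MvPolynomial (Fin 2) ℝ} :
    p ∈ polyDeg l ↔ ∀ s, p.coeff s ≠ 0 → ((s.degree : ℕ) : ℤ) ≤ l := by
  unfold polyDeg
  rw [MvPolynomial.mem_restrictSupport_iff]
  constructor
  · intro h s hs
    exact h (MvPolynomial.mem_support_iff.2 hs)
  · intro h s hs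
    exact h s (MvPolynomial.mem_support_iff.1 hs)

lemma polyDeg_mono {l l' : ℤ} (h : l ≤ l') : polyDeg l ≤ polyDeg l' := fun _ hp =>
  mem_polyDeg_iff.2 fun s hs => (mem_polyDeg_iff.1 hp s hs).trans h

lemma C_mem_polyDeg {l : ℤ} (hl : 0 ≤ l) (a : ℝ) : MvPolynomial.C a ∈ polyDeg l := by
  rw [mem_polyDeg_iff]
  intro s hs
  rw [MvPolynomial.coeff_C] at hs
  split_ifs at hs with h
  · simpa [← h] using hl
  · exact absurd rfl hs

instance finiteDimensional_polyDeg (l : ℤ) : FiniteDimensional ℝ (polyDeg l) := by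
  have hfin : Finite {s : Fin 2 →₀ ℕ | ((s.degree : ℕ) : ℤ) ≤ l} := by
    rw [Set.finite_coe_iff]
    refine (Set.finite_Iic (Finsupp.equivFunOnFinite.symm fun _ : Fin 2 => l.toNat)).subset ?_
    intro s hs i
    rw [Set.mem_ofPred_eq] at hs
    have := Finsupp.le_degree i s
    simp only [Finsupp.equivFunOnFinite_symm_apply_apply]
    omega
  exact Module.Finite.of_basis (MvPolynomial.basisRestrictSupport ℝ _)

lemma pderiv_mem_polyDeg {l : ℤ} {p : MvPolynomial (Fin 2) ℝ} (hp : p ∈ polyDeg l) (i : Fin 2) :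
    MvPolynomial.pderiv i p ∈ polyDeg (l - 1) := by
  rw [mem_polyDeg_iff] at hp ⊢
  intro s hs
  rw [MvPolynomial.coeff_pderiv] at hs
  have := hp _ (left_ne_zero_of_mul hs)
  rw [map_add, Finsupp.degree_single] at this
  push_cast at this
  omega

lemma eq_C_of_pderiv_eq_zero {p : MvPolynomial (Fin 2) ℝ}
    (hp : ∀ i, MvPolynomial.pderiv i p = 0) : p = MvPolynomial.C (p.coeff 0) := by
  ext s
  rw [MvPolynomial.coeff_C]
  split_ifs with h
  · rw [← h]
  · obtain ⟨i, hi⟩ : ∃ i, s i ≠ 0 := by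
      by_contra! hs
      exact h (Finsupp.ext fun i => (hs i).symm)
    have h1 := MvPolynomial.coeff_pderiv (i := i) p (s - Finsupp.single i 1)
    have h2 : s - Finsupp.single i 1 + Finsupp.single i 1 = s :=
      tsub_add_cancel_of_le (by simpa [Finsupp.single_le_iff] using Nat.one_le_iff_ne_zero.2 hi)
    rw [hp i, MvPolynomial.coeff_zero, h2] at h1
    exact (mul_eq_zero.1 h1.symm).resolve_right (by positivity)

/-- An open set contains a product of two intervals, and a polynomial that vanishes on a product of
infinite sets is zero. -/
lemma eq_zero_of_eqOn_open {p : MvPolynomial (Fin 2) ℝ} {U : Set Plane} (hU : IsOpen U)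
    (hne : U.Nonempty) (h : ∀ x ∈ U, polyFun p x = 0) : p = 0 := by
  obtain ⟨c, hc⟩ := hne
  have hV : IsOpen ((WithLp.toLp 2 : (Fin 2 → ℝ) → Plane) ⁻¹' U) :=
    hU.preimage (PiLp.continuous_toLp 2 _)
  obtain ⟨ε, hε, hb⟩ := Metric.isOpen_iff.1 hV (WithLp.ofLp c) (by simpa using hc)
  refine MvPolynomial.funext_set (fun i => Metric.ball (c i) ε) (fun i => ?_) fun x hx => ?_
  · rw [Real.ball_eq_Ioo]
    exact Set.Ioo_infinite (by linarith)
  · have hx' : x ∈ Metric.ball (WithLp.ofLp c) ε := by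
      rw [ball_pi _ hε]
      exact hx
    have := h _ (hb hx')
    simpa [polyFun] using this

lemma contDiff_polyFun (p : MvPolynomial (Fin 2) ℝ) : ContDiff ℝ ∞ (polyFun p) := by
  induction p using MvPolynomial.induction_on with
  | C a =>
    have : polyFun (MvPolynomial.C a) = fun _ => a := by
      funext x
      simp [polyFun]
    rw [this]
    exact contDiff_const
  | add p q hp hq =>
    have : polyFun (p + q) = fun x => polyFun p x + polyFun q x := by
      funext x
      simp [polyFun]
    rw [this]
    exact hp.add hq
  | mul_X p i hp =>
    have : polyFun (p * MvPolynomial.X i) = fun x => polyFun p x * x i := by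
      funext x
      simp [polyFun]
    rw [this]
    exact hp.mul (by fun_prop)

lemma partialDeriv_polyFun (i : Fin 2) (p : MvPolynomial (Fin 2) ℝ) (x : Plane) :
    partialDeriv i (polyFun p) x = polyFun (MvPolynomial.pderiv i p) x := by
  induction p using MvPolynomial.induction_on with
  | C a =>
    have : polyFun (MvPolynomial.C a) = fun _ => a := by
      funext x
      simp [polyFun]
    rw [this]
    simp [polyFun, partialDeriv]
  | add p q hp hq =>
    have : polyFun (p + q) = fun x => polyFun p x + polyFun q x := by
      funext x
      simp [polyFun]
    rw [this, PolygonalElement.partialDeriv_add (contDiff_polyFun p) (contDiff_polyFun q), hp, hq]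
    simp [polyFun]
  | mul_X p j hp =>
    have : polyFun (p * MvPolynomial.X j) = fun x => polyFun p x * EuclideanSpace.proj j x := by
      funext x
      simp [polyFun]
    have h1 : DifferentiableAt ℝ (polyFun p) x := (contDiff_polyFun p).differentiable (by simp) x
    unfold partialDeriv at hp ⊢
    rw [this, fderiv_fun_mul h1 (ContinuousLinearMap.differentiableAt _),
      ContinuousLinearMap.fderiv]
    simp only [add_apply, smul_apply, smul_eq_mul, hp, PiLp.proj_apply,
      PiLp.single_apply, polyFun, Derivation.leibniz, MvPolynomial.pderiv_X, map_add,
      map_mul, MvPolynomial.eval_X]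
    by_cases hij : j = i
    · simp [hij]
    · simp [hij]

/-- A linear choice of antiderivatives in the first variable: the field (A p, 0) then has divergence
p and depends linearly on p, which is what `exists_field` needs. -/
lemma exists_linearMap_pderiv_eq :
    ∃ A : MvPolynomial (Fin 2) ℝ →ₗ[ℝ] MvPolynomial (Fin 2) ℝ,
      ∀ p, MvPolynomial.pderiv 0 (A p) = p := by
  let D : MvPolynomial (Fin 2) ℝ →ₗ[ℝ] MvPolynomial (Fin 2) ℝ :=
    (MvPolynomial.pderiv (R := ℝ) (0 : Fin 2)).toLinearMap
  have hD : LinearMap.range D = ⊤ := by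
    rw [eq_top_iff]
    intro p _
    induction p using MvPolynomial.induction_on' with
    | monomial s a =>
      refine ⟨MvPolynomial.monomial (s + Finsupp.single 0 1) (a / (s 0 + 1)), ?_⟩
      change MvPolynomial.pderiv 0 _ = _
      rw [MvPolynomial.pderiv_monomial, add_tsub_cancel_right]
      congr 1
      have : (s 0 : ℝ) + 1 ≠ 0 := by positivity
      simp [this]
    | add p q hp hq => exact add_mem (hp trivial) (hq trivial)
  obtain ⟨A, hA⟩ := D.exists_rightInverse_of_surjective hD
  exact ⟨A, fun p => LinearMap.congr_fun hA p⟩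

lemma bijective_of_injective_dual {V : Type*} [AddCommGroup V] [Module ℝ V]
    [FiniteDimensional ℝ V] (T : V →ₗ[ℝ] Module.Dual ℝ V) (hT : Function.Injective T) :
    Function.Bijective T :=
  ⟨hT, (LinearMap.injective_iff_surjective_of_finrank_eq_finrank
    Subspace.dual_finrank_eq.symm).1 hT⟩

/-! ### Polynomials on an edge -/

lemma continuous_poly_mul (p q : Polynomial ℝ) :
    Continuous fun t : ℝ => p.eval t * q.eval t := by fun_prop

/-- The zeros at 0 and 1 split off the factor t(t - 1), which has constant sign on the edge. The
cofactor b has degree less than k, so it is an admissible test polynomial, and ∫ t(1 - t)b² = 0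
forces b = 0. -/
lemma eq_zero_of_edge_moments {k : ℕ} {p : Polynomial ℝ}
    (hp : p ∈ Polynomial.degreeLE ℝ ((k + 1 : ℕ) : WithBot ℕ)) (h0 : p.eval 0 = 0)
    (h1 : p.eval 1 = 0)
    (hm : ∀ q ∈ Polynomial.degreeLT ℝ k, ∫ t in (0 : ℝ)..1, p.eval t * q.eval t = 0) : p = 0 := by
  by_contra hne
  obtain ⟨a, rfl⟩ := Polynomial.dvd_iff_isRoot.2 h0
  obtain ⟨b, rfl⟩ : (Polynomial.X - Polynomial.C 1 : Polynomial ℝ) ∣ a := by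
    rw [Polynomial.dvd_iff_isRoot, Polynomial.IsRoot]
    simpa using h1
  have hb : b ≠ 0 := by rintro rfl; simp at hne
  have hb' : b ∈ Polynomial.degreeLT ℝ k := by
    rw [Polynomial.mem_degreeLE] at hp
    rw [Polynomial.degree_mul, Polynomial.degree_mul, Polynomial.degree_X_sub_C,
      Polynomial.degree_X_sub_C, Polynomial.degree_eq_natDegree hb] at hp
    rw [Polynomial.mem_degreeLT, Polynomial.degree_eq_natDegree hb]
    norm_cast at hp ⊢
    omega
  have hc : Continuous fun t : ℝ => t * (1 - t) * b.eval t ^ 2 :=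
    (continuous_id.mul (continuous_const.sub continuous_id)).mul (b.continuous.pow 2)
  have hI : ∫ t in (0 : ℝ)..1, t * (1 - t) * b.eval t ^ 2 = 0 := by
    have e := hm b hb'
    rw [← neg_eq_zero, ← intervalIntegral.integral_neg] at e
    refine Eq.trans ?_ e
    refine intervalIntegral.integral_congr fun t _ => ?_
    simp only [Polynomial.eval_mul, Polynomial.eval_sub, Polynomial.eval_X, Polynomial.eval_C]
    ring
  have hz : ∀ t ∈ Ioo (0 : ℝ) 1, b.eval t = 0 := by
    intro t ht
    by_contra hbt
    have hpos : 0 < ∫ t in (0 : ℝ)..1, t * (1 - t) * b.eval t ^ 2 := by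
      refine intervalIntegral.integral_pos (by norm_num) hc.continuousOn (fun x hx => ?_)
        ⟨t, ⟨ht.1.le, ht.2.le⟩, ?_⟩
      · have := sub_nonneg.2 hx.2
        have := hx.1.le
        positivity
      · have := sub_pos.2 ht.2
        have := ht.1
        positivity
    exact hpos.ne' hI
  exact hb (Polynomial.eq_zero_of_infinite_isRoot b ((Set.Ioo_infinite zero_lt_one).mono hz))

/-- The moments of a polynomial on the unit interval against polynomials of degree less than
`k`. -/
def edgeMoments (k : ℕ) : Polynomial ℝ →ₗ[ℝ] Module.Dual ℝ (Polynomial.degreeLT ℝ k) :=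
  LinearMap.mk₂ ℝ (fun p (q : Polynomial.degreeLT ℝ k) =>
      ∫ t in (0 : ℝ)..1, p.eval t * (q : Polynomial ℝ).eval t)
    (fun p p' q => by
      rw [← intervalIntegral.integral_add ((continuous_poly_mul _ _).intervalIntegrable _ _)
        ((continuous_poly_mul _ _).intervalIntegrable _ _)]
      simp only [Polynomial.eval_add, add_mul])
    (fun c p q => by
      rw [smul_eq_mul, ← intervalIntegral.integral_const_mul]
      simp only [Polynomial.eval_smul, smul_eq_mul, mul_assoc])
    (fun p q q' => by
      rw [← intervalIntegral.integral_add ((continuous_poly_mul _ _).intervalIntegrable _ _)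
        ((continuous_poly_mul _ _).intervalIntegrable _ _)]
      simp only [Submodule.coe_add, Polynomial.eval_add, mul_add])
    (fun c p q => by
      rw [smul_eq_mul, ← intervalIntegral.integral_const_mul]
      simp only [Submodule.coe_smul, Polynomial.eval_smul, smul_eq_mul, mul_left_comm])

/-- There are k + 2 coefficients for the two end values and k moments, so injectivity, which is
`eq_zero_of_edge_moments`, gives surjectivity. -/
lemma exists_poly_of_edge_moments (k : ℕ) (a b : ℝ)
    (m : Module.Dual ℝ (Polynomial.degreeLT ℝ k)) :
    ∃ p ∈ Polynomial.degreeLE ℝ ((k + 1 : ℕ) : WithBot ℕ), p.eval 0 = a ∧ p.eval 1 = b ∧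
      ∀ q : Polynomial.degreeLT ℝ k,
        ∫ t in (0 : ℝ)..1, p.eval t * (q : Polynomial ℝ).eval t = m q := by
  let T : Polynomial.degreeLT ℝ (k + 2) →ₗ[ℝ]
      ℝ × ℝ × Module.Dual ℝ (Polynomial.degreeLT ℝ k) :=
    ((Polynomial.leval 0).prod ((Polynomial.leval 1).prod (edgeMoments k))).comp
      (Submodule.subtype _)
  have hle : ∀ p : Polynomial.degreeLT ℝ (k + 2),
      (p : Polynomial ℝ) ∈ Polynomial.degreeLE ℝ ((k + 1 : ℕ) : WithBot ℕ) := by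
    intro p
    have := p.2
    rw [Polynomial.mem_degreeLT] at this
    rw [Polynomial.mem_degreeLE]
    refine Order.le_of_lt_succ (this.trans_le (le_of_eq ?_))
    rfl
  have hfin : ∀ j : ℕ, FiniteDimensional ℝ (Polynomial.degreeLT ℝ j) := fun j =>
    Module.Finite.equiv (Polynomial.degreeLTEquiv ℝ j).symm
  have hrank : ∀ j : ℕ, Module.finrank ℝ (Polynomial.degreeLT ℝ j) = j := fun j => by
    rw [(Polynomial.degreeLTEquiv ℝ j).finrank_eq, Module.finrank_fin_fun]
  have hinj : Function.Injective T := by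
    rw [← LinearMap.ker_eq_bot, LinearMap.ker_eq_bot']
    intro p hp
    refine Subtype.ext (eq_zero_of_edge_moments (hle p) (congrArg Prod.fst hp)
      (congrArg (fun z => z.2.1) hp) fun q hq => ?_)
    exact LinearMap.congr_fun (congrArg (fun z => z.2.2) hp) ⟨q, hq⟩
  have hsurj : Function.Surjective T := by
    refine (LinearMap.injective_iff_surjective_of_finrank_eq_finrank ?_).1 hinj
    rw [Module.finrank_prod, Module.finrank_prod, Subspace.dual_finrank_eq, hrank, hrank,
      Module.finrank_self]
    ring
  obtain ⟨p, hp⟩ := hsurj (a, b, m)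
  exact ⟨p, hle p, congrArg Prod.fst hp, congrArg (fun z => z.2.1) hp,
    fun q => LinearMap.congr_fun (congrArg (fun z => z.2.2) hp) q⟩

namespace PolygonalElement

variable {n : ℕ} {K : PolygonalElement n}

/-! ### Pairs of a function and its gradient -/

/-- The class in `L²` of a continuous function. -/
def toL2 (K : PolygonalElement n) {f : Plane → ℝ} (hf : Continuous f) : K.L2 :=
  (memLp_of_continuous hf).toLp f

lemma coeFn_toL2 {f : Plane → ℝ} (hf : Continuous f) : K.toL2 hf =ᵐ[K.vol] f :=
  MemLp.coeFn_toLp _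

lemma inner_L2 (v w : K.L2) : inner ℝ v w = ∫ x, v x * w x ∂K.vol := by
  rw [L2.inner_def]
  refine integral_congr_ae (ae_of_all _ fun x => ?_)
  simp [mul_comm]

lemma inner_toL2 (v : K.L2) {f : Plane → ℝ} (hf : Continuous f) :
    inner ℝ v (K.toL2 hf) = ∫ x, v x * f x ∂K.vol := by
  rw [inner_L2]
  refine integral_congr_ae ?_
  filter_upwards [coeFn_toL2 (K := K) hf] with x hx
  rw [hx]

lemma inner_toL2_toL2 {f h : Plane → ℝ} (hf : Continuous f) (hh : Continuous h) :
    inner ℝ (K.toL2 hf) (K.toL2 hh) = ∫ x, f x * h x ∂K.vol := by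
  rw [inner_toL2]
  refine integral_congr_ae ?_
  filter_upwards [coeFn_toL2 (K := K) hf] with x hx
  rw [hx]

lemma toL2_congr {f h : Plane → ℝ} (hf : Continuous f) (hh : Continuous h)
    (e : ∀ x ∈ K.carrier, f x = h x) : K.toL2 hf = K.toL2 hh := by
  refine MemLp.toLp_congr _ _ ?_
  filter_upwards [ae_restrict_mem K.isOpen.measurableSet] with x hx
  exact e x hx

lemma toL2_add {f h : Plane → ℝ} (hf : Continuous f) (hh : Continuous h) :
    K.toL2 (hf.add hh) = K.toL2 hf + K.toL2 hh := rfl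

lemma toL2_smul (c : ℝ) {f : Plane → ℝ} (hf : Continuous f) :
    K.toL2 (hf.const_smul c) = c • K.toL2 hf := rfl

lemma eLpNorm_toL2_sub {f : Plane → ℝ} (hf : Continuous f) (v : K.L2) :
    eLpNorm (⇑(K.toL2 hf) - ⇑v) 2 K.vol = eLpNorm (fun x => f x - v x) 2 K.vol := by
  refine eLpNorm_congr_ae ?_
  filter_upwards [coeFn_toL2 (K := K) hf] with x hx
  rw [Pi.sub_apply, hx]

lemma tendsto_toL2_iff {f : ℕ → Plane → ℝ} (hf : ∀ m, Continuous (f m)) (v : K.L2) :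
    Tendsto (fun m => K.toL2 (hf m)) atTop (𝓝 v) ↔
      Tendsto (fun m => eLpNorm (fun x => f m x - v x) 2 K.vol) atTop (𝓝 0) := by
  rw [Lp.tendsto_Lp_iff_tendsto_eLpNorm']
  simp only [eLpNorm_toL2_sub]

/-- Pairs of a function and a vector field, both in `L²`. -/
abbrev Pair (K : PolygonalElement n) : Type := K.L2 × PiLp 2 (fun _ : Fin 2 => K.L2)

/-- The pair of a smooth function and its gradient. -/
def smoothPair (K : PolygonalElement n) {u : Plane → ℝ} (hu : ContDiff ℝ ∞ u) : K.Pair :=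
  (K.toL2 hu.continuous, WithLp.toLp 2 fun i => K.toL2 (continuous_partialDeriv hu i))

lemma tendsto_smoothPair_iff {u : ℕ → Plane → ℝ} (hu : ∀ m, ContDiff ℝ ∞ (u m)) (v : K.L2)
    (G : Fin 2 → K.L2) :
    Tendsto (fun m => K.smoothPair (hu m)) atTop (𝓝 (v, WithLp.toLp 2 G)) ↔
      Tendsto (fun m => eLpNorm (fun x => u m x - v x) 2 K.vol) atTop (𝓝 0) ∧
      ∀ i, Tendsto (fun m => eLpNorm (fun x => partialDeriv i (u m) x - G i x) 2 K.vol)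
        atTop (𝓝 0) := by
  unfold smoothPair
  rw [Prod.tendsto_iff, ← tendsto_toL2_iff fun m => (hu m).continuous]
  refine and_congr Iff.rfl ?_
  simp only [← tendsto_toL2_iff fun m => continuous_partialDeriv (hu m) _]
  rw [← tendsto_pi_nhds]
  constructor
  · intro h
    exact ((PiLp.continuous_ofLp 2 _).tendsto _).comp h
  · intro h
    exact ((PiLp.continuous_toLp 2 _).tendsto _).comp h

lemma isTest_add {φ ψ : Plane → ℝ} (hφ : K.IsTest φ) (hψ : K.IsTest ψ) :
    K.IsTest (φ + ψ) :=
  ⟨hφ.contDiff.add hψ.contDiff, hφ.hasCompactSupport.add hψ.hasCompactSupport,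
    (tsupport_add φ ψ).trans (union_subset hφ.tsupport_subset hψ.tsupport_subset)⟩

lemma isTest_smul (c : ℝ) {φ : Plane → ℝ} (hφ : K.IsTest φ) : K.IsTest (c • φ) :=
  ⟨hφ.contDiff.const_smul c, hφ.hasCompactSupport.smul_left,
    (closure_mono (Function.support_const_smul_subset c φ)).trans hφ.tsupport_subset⟩

lemma isTest_zero : K.IsTest 0 :=
  ⟨contDiff_const, HasCompactSupport.zero, by simp⟩

lemma smoothPair_add {u w : Plane → ℝ} (hu : ContDiff ℝ ∞ u) (hw : ContDiff ℝ ∞ w) :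
    K.smoothPair (hu.add hw) = K.smoothPair hu + K.smoothPair hw := by
  refine Prod.ext rfl (PiLp.ext fun i => ?_)
  change K.toL2 (continuous_partialDeriv (hu.add hw) i) =
    K.toL2 ((continuous_partialDeriv hu i).add (continuous_partialDeriv hw i))
  exact toL2_congr _ _ fun x _ => partialDeriv_add hu hw i x

lemma smoothPair_smul (c : ℝ) {u : Plane → ℝ} (hu : ContDiff ℝ ∞ u) :
    K.smoothPair (hu.const_smul c) = c • K.smoothPair hu := by
  refine Prod.ext rfl (PiLp.ext fun i => ?_)
  change K.toL2 (continuous_partialDeriv (hu.const_smul c) i) =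
    K.toL2 ((continuous_partialDeriv hu i).const_smul c)
  exact toL2_congr _ _ fun x _ => partialDeriv_const_mul hu c i x

lemma smoothPair_zero : K.smoothPair (contDiff_const : ContDiff ℝ ∞ (0 : Plane → ℝ)) = 0 := by
  refine Prod.ext rfl (PiLp.ext fun i => ?_)
  change K.toL2 (continuous_partialDeriv contDiff_const i) =
    K.toL2 (continuous_const : Continuous fun _ : Plane => (0 : ℝ))
  exact toL2_congr _ _ fun x _ => partialDeriv_zero i x

/-- The pairs of a test function and its gradient. -/
def testPairs (K : PolygonalElement n) : Submodule ℝ K.Pair where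
  carrier := {z | ∃ (φ : Plane → ℝ) (h : K.IsTest φ), z = K.smoothPair h.contDiff}
  add_mem' := by
    rintro _ _ ⟨φ, hφ, rfl⟩ ⟨ψ, hψ, rfl⟩
    exact ⟨_, isTest_add hφ hψ, (smoothPair_add hφ.contDiff hψ.contDiff).symm⟩
  zero_mem' := ⟨_, isTest_zero, smoothPair_zero.symm⟩
  smul_mem' := by
    rintro c _ ⟨φ, hφ, rfl⟩
    exact ⟨_, isTest_smul c hφ, (smoothPair_smul c hφ.contDiff).symm⟩

/-- The closure in `H¹` of the test functions, as a space of pairs of a function and its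
gradient. -/
def H10 (K : PolygonalElement n) : Submodule ℝ K.Pair := K.testPairs.topologicalClosure

lemma IsTest.smoothPair_mem_H10 {φ : Plane → ℝ} (h : K.IsTest φ) :
    K.smoothPair h.contDiff ∈ K.H10 :=
  Submodule.le_topologicalClosure _ ⟨φ, h, rfl⟩

/-- Identities and inequalities on `H10` are obtained from this: they are checked on test functions
and extended by continuity. -/
lemma H10_induction {p : K.Pair → Prop} (hc : IsClosed {z | p z})
    (h : ∀ φ, ∀ hφ : K.IsTest φ, p (K.smoothPair hφ.contDiff)) {z : K.Pair} (hz : z ∈ K.H10) :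
    p z := by
  have : (K.H10 : Set K.Pair) ⊆ {z | p z} := by
    refine closure_minimal ?_ hc
    rintro _ ⟨φ, hφ, rfl⟩
    exact h φ hφ
  exact this hz

lemma hasTrace_iff {v : K.L2} {G : Fin 2 → K.L2} {g : Plane → ℝ} :
    K.HasTrace v G g ↔ ∃ (u : ℕ → Plane → ℝ) (hu : ∀ m, ContDiff ℝ ∞ (u m)),
      Tendsto (fun m => K.smoothPair (hu m)) atTop (𝓝 (v, WithLp.toLp 2 G)) ∧
      ∀ i, Tendsto (fun m => eLpNorm
        (fun t => u m (K.polygon.edgePath ℝ i t) - g (K.polygon.edgePath ℝ i t)) 2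
          (volume.restrict (Icc (0 : ℝ) 1))) atTop (𝓝 0) := by
  constructor
  · rintro ⟨u, hu, h1, h2, h3⟩
    exact ⟨u, hu, (tendsto_smoothPair_iff hu v G).2 ⟨h1, h2⟩, h3⟩
  · rintro ⟨u, hu, h12, h3⟩
    obtain ⟨h1, h2⟩ := (tendsto_smoothPair_iff hu v G).1 h12
    exact ⟨u, hu, h1, h2, h3⟩

/-! ### Integration by parts -/

lemma hasCompactSupport_partialDeriv {φ : Plane → ℝ} (h : HasCompactSupport φ) (i : Fin 2) :
    HasCompactSupport (partialDeriv i φ) :=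
  (h.fderiv ℝ).comp_left (g := fun L : Plane →L[ℝ] ℝ => L (EuclideanSpace.single i 1)) rfl

lemma IsTest.eq_zero {φ : Plane → ℝ} (h : K.IsTest φ) {x : Plane} (hx : x ∉ K.carrier) :
    φ x = 0 :=
  image_eq_zero_of_notMem_tsupport fun hx' => hx (h.tsupport_subset hx')

lemma IsTest.partialDeriv {φ : Plane → ℝ} (h : K.IsTest φ) (i : Fin 2) :
    K.IsTest (partialDeriv i φ) := by
  refine ⟨(h.contDiff.fderiv_right (m := ∞) (by simp)).clm_apply contDiff_const,
    hasCompactSupport_partialDeriv h.hasCompactSupport i, ?_⟩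
  refine (closure_mono ?_).trans ((tsupport_fderiv_subset ℝ (f := φ)).trans h.tsupport_subset)
  intro x hx hx'
  exact hx (by simp only [VEM.partialDeriv, hx']; rfl)

lemma IsTest.integral_mul_partialDeriv {φ : Plane → ℝ} (h : K.IsTest φ) {u : Plane → ℝ}
    (hu : ContDiff ℝ ∞ u) (i : Fin 2) :
    ∫ x, u x * VEM.partialDeriv i φ x ∂K.vol = -∫ x, VEM.partialDeriv i u x * φ x ∂K.vol := by
  rw [setIntegral_eq_integral_of_forall_compl_eq_zero fun x hx => by
      rw [(h.partialDeriv i).eq_zero hx, mul_zero],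
    setIntegral_eq_integral_of_forall_compl_eq_zero fun x hx => by rw [h.eq_zero hx, mul_zero]]
  have c1 := continuous_partialDeriv hu i
  have c2 := continuous_partialDeriv h.contDiff i
  refine integral_mul_fderiv_eq_neg_fderiv_mul_of_integrable ?_ ?_ ?_
    (fun x _ => hu.differentiable (by simp) x) (fun x _ => h.contDiff.differentiable (by simp) x)
  · exact (c1.mul h.contDiff.continuous).integrable_of_hasCompactSupport
      h.hasCompactSupport.mul_left
  · exact (hu.continuous.mul c2).integrable_of_hasCompactSupport
      (hasCompactSupport_partialDeriv h.hasCompactSupport i).mul_left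
  · exact (hu.continuous.mul h.contDiff.continuous).integrable_of_hasCompactSupport
      h.hasCompactSupport.mul_left

lemma hasWeakGradient_iff {v : K.L2} {G : Fin 2 → K.L2} :
    K.HasWeakGradient v G ↔ ∀ φ, ∀ hφ : K.IsTest φ, ∀ i,
      inner ℝ v (K.toL2 (continuous_partialDeriv hφ.contDiff i)) +
        inner ℝ (G i) (K.toL2 hφ.contDiff.continuous) = 0 := by
  unfold HasWeakGradient
  refine forall₂_congr fun φ hφ => forall_congr' fun i => ?_
  rw [inner_toL2, inner_toL2, eq_neg_iff_add_eq_zero]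

/-- Integration by parts against a test function holds for the smooth approximations, and both sides
are continuous in the pair (function, gradient). -/
lemma HasTrace.hasWeakGradient {v : K.L2} {G : Fin 2 → K.L2} {g : Plane → ℝ}
    (h : K.HasTrace v G g) : K.HasWeakGradient v G := by
  obtain ⟨u, hu, h1, -⟩ := hasTrace_iff.1 h
  rw [hasWeakGradient_iff]
  intro φ hφ i
  have hc : Continuous fun z : K.Pair =>
      inner ℝ z.1 (K.toL2 (continuous_partialDeriv hφ.contDiff i)) +
        inner ℝ (z.2 i) (K.toL2 hφ.contDiff.continuous) := by fun_prop
  have := (hc.tendsto _).comp h1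
  refine tendsto_nhds_unique this (tendsto_const_nhds.congr fun m => ?_)
  simp only [Function.comp_apply, smoothPair, inner_toL2_toL2,
    hφ.integral_mul_partialDeriv (hu m) i, neg_add_cancel]

lemma eq_zero_of_inner_test {w : K.L2}
    (h : ∀ φ, ∀ hφ : K.IsTest φ, inner ℝ w (K.toL2 hφ.contDiff.continuous) = 0) : w = 0 := by
  have hloc : LocallyIntegrableOn w K.carrier volume :=
    IntegrableOn.locallyIntegrableOn ((Lp.memLp w).integrable (by norm_num))
  have := K.isOpen.ae_eq_zero_of_integral_contDiff_smul_eq_zero hloc fun φ h1 h2 h3 => by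
    have e := h φ ⟨h1, h2, h3⟩
    rw [inner_toL2, setIntegral_eq_integral_of_forall_compl_eq_zero fun x hx => by
      rw [IsTest.eq_zero ⟨h1, h2, h3⟩ hx, mul_zero]] at e
    simpa only [smul_eq_mul, mul_comm] using e
  rw [Lp.eq_zero_iff_ae_eq_zero]
  exact (ae_restrict_iff' K.isOpen.measurableSet).2 this

lemma HasWeakGradient.unique {v : K.L2} {G G' : Fin 2 → K.L2} (h : K.HasWeakGradient v G)
    (h' : K.HasWeakGradient v G') : G = G' := by
  rw [hasWeakGradient_iff] at h h'
  funext i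
  rw [← sub_eq_zero]
  refine eq_zero_of_inner_test fun φ hφ => ?_
  rw [inner_sub_left]
  linarith [h φ hφ i, h' φ hφ i]

/-! ### The Poincaré inequality -/

/-- Integrating φ² = φ² ∂₀(x₀) by parts gives ∫ φ² = -2 ∫ x₀ φ ∂₀φ. With |x₀| ≤ R on the element,
Cauchy–Schwarz yields the constant 2R. -/
lemma exists_poincare (K : PolygonalElement n) :
    ∃ C : ℝ, 0 ≤ C ∧ ∀ z ∈ K.H10, ‖z.1‖ ≤ C * ‖z.2‖ := by
  obtain ⟨R, hR0, hR⟩ : ∃ R : ℝ, 0 ≤ R ∧ ∀ x ∈ K.carrier, |x 0| ≤ R := by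
    obtain ⟨R, hR⟩ := K.isBounded.exists_norm_le
    refine ⟨max R 0, le_max_right _ _, fun x hx => ?_⟩
    exact ((PiLp.norm_apply_le x 0).trans (hR x hx)).trans (le_max_left _ _)
  refine ⟨2 * R, by positivity, fun z hz => ?_⟩
  refine H10_induction (p := fun z => ‖z.1‖ ≤ 2 * R * ‖z.2‖)
    (isClosed_le (by fun_prop) (by fun_prop)) (fun φ hφ => ?_) hz
  have cφ := hφ.contDiff.continuous
  have cd := continuous_partialDeriv hφ.contDiff 0
  have hcoord : ContDiff ℝ ∞ fun x : Plane => x 0 := by fun_prop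
  have hu : ContDiff ℝ ∞ fun x : Plane => φ x * x 0 := hφ.contDiff.mul hcoord
  have hd : ∀ x, partialDeriv 0 (fun x : Plane => φ x * x 0) x =
      partialDeriv 0 φ x * x 0 + φ x := by
    intro x
    have h1 : DifferentiableAt ℝ φ x := hφ.contDiff.differentiable (by simp) x
    have h2 : HasFDerivAt (fun x : Plane => x 0)
        (EuclideanSpace.proj 0 : Plane →L[ℝ] ℝ) x :=
      (EuclideanSpace.proj 0 : Plane →L[ℝ] ℝ).hasFDerivAt
    unfold VEM.partialDeriv
    rw [(h1.hasFDerivAt.fun_mul h2).fderiv]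
    simp
    ring
  have key := hφ.integral_mul_partialDeriv hu 0
  simp only [hd] at key
  have i1 : Integrable (fun x => φ x * x 0 * partialDeriv 0 φ x) K.vol :=
    ((memLp_of_continuous (cφ.mul hcoord.continuous)).integrable_mul (memLp_of_continuous cd))
  have i2 : Integrable (fun x => φ x * φ x) K.vol :=
    (memLp_of_continuous cφ).integrable_mul (memLp_of_continuous cφ)
  have e1 : ∫ x, (partialDeriv 0 φ x * x 0 + φ x) * φ x ∂K.vol =
      ∫ x, φ x * x 0 * partialDeriv 0 φ x ∂K.vol + ∫ x, φ x * φ x ∂K.vol := by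
    rw [← integral_add i1 i2]
    refine integral_congr_ae (ae_of_all _ fun x => ?_)
    ring
  have cm : Continuous fun x : Plane => φ x * x 0 := hu.continuous
  have e2 : ‖K.toL2 cφ‖ ^ 2 = -2 * inner ℝ (K.toL2 cm) (K.toL2 cd) := by
    rw [← real_inner_self_eq_norm_sq, inner_toL2_toL2, inner_toL2_toL2]
    linarith
  have e3 : ‖K.toL2 cm‖ ≤ R * ‖K.toL2 cφ‖ := by
    refine Lp.norm_le_mul_norm_of_ae_le_mul ?_
    filter_upwards [coeFn_toL2 (K := K) cm, coeFn_toL2 (K := K) cφ,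
      ae_restrict_mem K.isOpen.measurableSet] with x h1 h2 hx
    rw [h1, h2, norm_mul, mul_comm]
    exact mul_le_mul_of_nonneg_right (hR x hx) (norm_nonneg _)
  have e4 : ‖K.toL2 cd‖ ≤ ‖(K.smoothPair hφ.contDiff).2‖ :=
    PiLp.norm_apply_le (K.smoothPair hφ.contDiff).2 0
  have e5 := (abs_le.1 (abs_real_inner_le_norm (K.toL2 cm) (K.toL2 cd))).1
  change ‖K.toL2 cφ‖ ≤ _
  have h0 := norm_nonneg (K.toL2 cφ)
  have h1 := norm_nonneg (K.toL2 cd)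
  rcases h0.eq_or_lt with h | h
  · rw [← h]
    positivity
  · have : ‖K.toL2 cφ‖ * ‖K.toL2 cφ‖ ≤ ‖K.toL2 cφ‖ * (2 * R * ‖K.toL2 cd‖) := by
      nlinarith [mul_le_mul_of_nonneg_right e3 h1]
    refine (le_of_mul_le_mul_left this h).trans ?_
    gcongr

end PolygonalElement

/-! ### Mollification -/

lemma eLpNorm_two_sq {α : Type*} [MeasurableSpace α] {μ : Measure α} (f : α → ℝ) :
    eLpNorm f 2 μ ^ 2 = ∫⁻ x, ‖f x‖ₑ ^ 2 ∂μ := by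
  have h := eLpNorm_nnreal_pow_eq_lintegral (μ := μ) (f := f) (p := 2) (by norm_num)
  simpa using h

lemma tendsto_eLpNorm_two_iff {α : Type*} [MeasurableSpace α] {μ : Measure α} {f : ℕ → α → ℝ} :
    Tendsto (fun m => eLpNorm (f m) 2 μ) atTop (𝓝 0) ↔
      Tendsto (fun m => ∫⁻ x, ‖f m x‖ₑ ^ 2 ∂μ) atTop (𝓝 0) := by
  simp only [← eLpNorm_two_sq]
  constructor
  · intro h
    simpa using ENNReal.Tendsto.pow (n := 2) h
  · intro h
    have := (ENNReal.continuous_rpow_const (y := 1 / 2)).tendsto 0 |>.comp h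
    simp only [Function.comp_def] at this
    rw [ENNReal.zero_rpow_of_pos (by norm_num)] at this
    refine this.congr fun m => ?_
    rw [← ENNReal.rpow_natCast, ← ENNReal.rpow_mul]
    norm_num

lemma tendsto_eLpNorm_of_bounded {α : Type*} [MeasurableSpace α] {μ : Measure α}
    [IsFiniteMeasure μ] {f : ℕ → α → ℝ} (hf : ∀ m, AEStronglyMeasurable (f m) μ) (C : ℝ)
    (hb : ∀ m, ∀ᵐ x ∂μ, ‖f m x‖ ≤ C) (hl : ∀ᵐ x ∂μ, Tendsto (fun m => f m x) atTop (𝓝 0)) :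
    Tendsto (fun m => eLpNorm (f m) 2 μ) atTop (𝓝 0) := by
  rw [tendsto_eLpNorm_two_iff]
  rw [show (0 : ENNReal) = ∫⁻ _, 0 ∂μ by simp]
  refine tendsto_lintegral_of_dominated_convergence' (fun _ => ENNReal.ofReal C ^ 2)
    (fun m => (hf m).enorm.pow_const 2) (fun m => ?_) ?_ ?_
  · filter_upwards [hb m] with x hx
    gcongr
    rw [← ofReal_norm]
    exact ENNReal.ofReal_le_ofReal hx
  · rw [lintegral_const]
    exact ENNReal.mul_ne_top (by simp) (measure_ne_top μ _)
  · filter_upwards [hl] with x hx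
    have := ENNReal.Tendsto.pow (n := 2) hx.enorm
    simpa using this

/-- The bump function around the origin which is used for mollification at scale `ε`. -/
def mollifier (ε : ℝ) (hε : 0 < ε) : ContDiffBump (0 : Plane) :=
  ⟨ε / 2, ε, half_pos hε, half_lt_self hε⟩

/-- The convolution of `f` with a smooth probability density supported in the ball of radius
`ε`. -/
def mollify (ε : ℝ) (hε : 0 < ε) (f : Plane → ℝ) : Plane → ℝ :=
  convolution ((mollifier ε hε).normed volume) f (ContinuousLinearMap.lsmul ℝ ℝ) volume

lemma mollify_apply {ε : ℝ} (hε : 0 < ε) (f : Plane → ℝ) (x : Plane) :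
    mollify ε hε f x = ∫ t, (mollifier ε hε).normed volume t * f (x - t) := rfl

section Mollify

variable {ε : ℝ} (hε : 0 < ε)

lemma contDiff_mollify {f : Plane → ℝ} (hf : LocallyIntegrable f volume) :
    ContDiff ℝ ∞ (mollify ε hε f) :=
  (mollifier ε hε).hasCompactSupport_normed.contDiff_convolution_left _
    (mollifier ε hε).contDiff_normed hf

lemma integrable_mollifier_mul {f : Plane → ℝ} (hf : LocallyIntegrable f volume) (x : Plane) :
    Integrable fun t => (mollifier ε hε).normed volume t * f (x - t) :=
  (mollifier ε hε).hasCompactSupport_normed.convolutionExists_left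
    (ContinuousLinearMap.lsmul ℝ ℝ) (mollifier ε hε).continuous_normed hf x

lemma integrable_mollifier : Integrable ((mollifier ε hε).normed volume) :=
  (mollifier ε hε).integrable_normed

lemma abs_mollify_le {f : Plane → ℝ} {C : ℝ} (hC : ∀ x, |f x| ≤ C) (x : Plane) :
    |mollify ε hε f x| ≤ C := by
  rw [mollify_apply, ← Real.norm_eq_abs]
  refine (norm_integral_le_of_norm_le (g := fun t => (mollifier ε hε).normed volume t * C)
    ((integrable_mollifier hε).mul_const C) (ae_of_all _ fun t => ?_)).trans ?_
  · rw [norm_mul, Real.norm_of_nonneg ((mollifier ε hε).nonneg_normed _)]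
    exact mul_le_mul_of_nonneg_left (hC _) ((mollifier ε hε).nonneg_normed _)
  · rw [integral_mul_const, (mollifier ε hε).integral_normed, one_mul]

lemma mollify_eq {f : Plane → ℝ} {x : Plane} (h : ∀ y ∈ Metric.ball x ε, f y = f x) :
    mollify ε hε f x = f x :=
  (mollifier ε hε).normed_convolution_eq_right h

variable {L : NNReal} {f : Plane → ℝ} (hf : LipschitzWith L f)

include hf

lemma abs_mollify_sub_le (x : Plane) : |mollify ε hε f x - f x| ≤ L * ε := by
  refine (mollifier ε hε).dist_normed_convolution_le hf.continuous.aestronglyMeasurable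
    fun y hy => ?_
  refine (hf.dist_le_mul y x).trans ?_
  gcongr
  exact (Metric.mem_ball.1 hy).le

/-- By Rademacher's theorem `f` is differentiable almost everywhere, and its difference quotients
are bounded by `L`. Hence the derivative may be taken under the convolution integral. The null set
where `fderiv` takes its default value 0 does not matter. -/
lemma partialDeriv_mollify (i : Fin 2) (x : Plane) :
    partialDeriv i (mollify ε hε f) x = mollify ε hε (partialDeriv i f) x := by
  set φ := (mollifier ε hε).normed volume
  set e : Plane := EuclideanSpace.single i 1
  have he : ‖e‖ = 1 := by simp [e]
  have hloc : LocallyIntegrable f volume := hf.continuous.locallyIntegrable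
  have hdiff : ∀ᵐ t : Plane, DifferentiableAt ℝ f (x - t) :=
    (Measure.measurePreserving_sub_left volume x).quasiMeasurePreserving.ae hf.ae_differentiableAt
  have hmeas : Measurable (partialDeriv i f) := measurable_fderiv_apply_const ℝ f e
  have key := (hasDerivAt_integral_of_dominated_loc_of_lip (μ := (volume : Measure Plane))
    (F := fun (h : ℝ) t => φ t * f (x + h • e - t)) (F' := fun t => φ t * partialDeriv i f (x - t))
    (bound := fun t => φ t * L) (x₀ := 0) (s := univ) univ_mem
    (Eventually.of_forall fun h => ?_) ?_ ?_ ?_ ?_ ?_).2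
  · have h1 : HasFDerivAt (mollify ε hε f) (fderiv ℝ (mollify ε hε f) (x + (0 : ℝ) • e))
        (x + (0 : ℝ) • e) :=
      ((contDiff_mollify hε hloc).differentiable (by simp) _).hasFDerivAt
    have h2 : HasDerivAt (fun h : ℝ => x + h • e) e 0 := by
      simpa using ((hasDerivAt_id (0 : ℝ)).smul_const e).const_add x
    have h3 := h1.comp_hasDerivAt (0 : ℝ) h2
    rw [zero_smul, add_zero] at h3
    exact h3.unique key
  · exact (integrable_mollifier_mul hε hloc _).aestronglyMeasurable
  · exact integrable_mollifier_mul hε hloc _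
  · exact ((mollifier ε hε).continuous_normed.measurable.mul
      (hmeas.comp (measurable_const.sub measurable_id))).aestronglyMeasurable
  · refine ae_of_all _ fun t => LipschitzOnWith.of_dist_le_mul fun h _ h' _ => ?_
    have hφ : 0 ≤ φ t := (mollifier ε hε).nonneg_normed t
    rw [Real.coe_nnabs, abs_of_nonneg (mul_nonneg hφ L.coe_nonneg),
      dist_eq_norm, ← mul_sub, norm_mul, Real.norm_of_nonneg hφ, mul_assoc]
    refine mul_le_mul_of_nonneg_left ?_ hφ
    rw [← dist_eq_norm]
    refine (hf.dist_le_mul _ _).trans (le_of_eq ?_)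
    rw [dist_eq_norm, dist_eq_norm, sub_sub_sub_cancel_right, add_sub_add_left_eq_sub, ← sub_smul,
      norm_smul, he, mul_one]
  · exact (integrable_mollifier hε).mul_const _
  · filter_upwards [hdiff] with t ht
    refine HasDerivAt.const_mul (φ t) ?_
    have h2 : HasDerivAt (fun h : ℝ => x + h • e - t) e 0 := by
      simpa using (((hasDerivAt_id (0 : ℝ)).smul_const e).const_add x).sub_const t
    have h1 : HasFDerivAt f (fderiv ℝ f (x - t)) (x + (0 : ℝ) • e - t) := by
      rw [zero_smul, add_zero]
      exact ht.hasFDerivAt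
    exact h1.comp_hasDerivAt (0 : ℝ) h2

lemma abs_partialDeriv_le (i : Fin 2) (x : Plane) : |partialDeriv i f x| ≤ L := by
  rw [← Real.norm_eq_abs]
  refine (ContinuousLinearMap.le_opNorm (fderiv ℝ f x) _).trans ?_
  simpa using norm_fderiv_le_of_lipschitz ℝ hf (x₀ := x)

lemma abs_partialDeriv_mollify_le (i : Fin 2) (x : Plane) :
    |partialDeriv i (mollify ε hε f) x| ≤ L := by
  rw [partialDeriv_mollify hε hf]
  exact abs_mollify_le hε (abs_partialDeriv_le hf i) x

end Mollify

/-! ### Lipschitz functions in H¹ and their traces; cutoff functions -/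

namespace PolygonalElement

variable {n : ℕ} {K : PolygonalElement n}

/-- The mollifications converge uniformly; their gradients are bounded by L and converge at almost
every point by Lebesgue differentiation. On spaces of finite measure this gives convergence in L²,
on the element and on each edge, so f is its own trace. -/
lemma exists_isH1_of_lipschitz {L : NNReal} {f : Plane → ℝ} (hf : LipschitzWith L f) :
    ∃ v G, K.IsH1 v G f := by
  have hmeas : ∀ i, Measurable (partialDeriv i f) := fun i =>
    measurable_fderiv_apply_const ℝ f _
  have hmem : ∀ i, MemLp (partialDeriv i f) 2 K.vol := fun i =>
    MemLp.of_bound (hmeas i).aestronglyMeasurable L (ae_of_all _ (abs_partialDeriv_le hf i))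
  have hloc : LocallyIntegrable f volume := hf.continuous.locallyIntegrable
  have hloc' : ∀ i, LocallyIntegrable (partialDeriv i f) volume := fun i =>
    (locallyIntegrable_const (L : ℝ)).mono (hmeas i).aestronglyMeasurable
      (ae_of_all _ fun x => by
        exact (abs_partialDeriv_le hf i x).trans (le_abs_self _))
  let ε : ℕ → ℝ := fun m => 1 / ((m : ℝ) + 1)
  have hε : ∀ m, 0 < ε m := fun m => by positivity
  have hε1 : ∀ m, ε m ≤ 1 := fun m => by
    rw [div_le_one (by positivity)]
    linarith [(Nat.cast_nonneg m : (0 : ℝ) ≤ m)]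
  have hεlim : Tendsto ε atTop (𝓝 0) := tendsto_one_div_add_atTop_nhds_zero_nat
  have hu : ∀ m, ContDiff ℝ ∞ (mollify (ε m) (hε m) f) := fun m => contDiff_mollify _ hloc
  have hb : ∀ m x, ‖mollify (ε m) (hε m) f x - f x‖ ≤ L := fun m x =>
    (abs_mollify_sub_le (hε m) hf x).trans (mul_le_of_le_one_right L.2 (hε1 m))
  have hlim : ∀ x, Tendsto (fun m => mollify (ε m) (hε m) f x - f x) atTop (𝓝 0) := fun x =>
    squeeze_zero_norm (fun m => abs_mollify_sub_le (hε m) hf x)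
      (by simpa using hεlim.const_mul (L : ℝ))
  have htr : K.HasTrace (K.toL2 hf.continuous) (fun i => (hmem i).toLp _) f := by
    refine ⟨fun m => mollify (ε m) (hε m) f, hu, ?_, fun i => ?_, fun i => ?_⟩
    · refine tendsto_eLpNorm_of_bounded (fun m => ((hu m).continuous.aestronglyMeasurable).sub
        (Lp.aestronglyMeasurable _)) L (fun m => ?_) ?_
      · filter_upwards [coeFn_toL2 (K := K) hf.continuous] with x hx
        rw [hx]
        exact hb m x
      · filter_upwards [coeFn_toL2 (K := K) hf.continuous] with x hx
        rw [hx]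
        exact hlim x
    · refine tendsto_eLpNorm_of_bounded
        (fun m => ((continuous_partialDeriv (hu m) i).aestronglyMeasurable).sub
        (Lp.aestronglyMeasurable _)) (L + L) (fun m => ?_) ?_
      · filter_upwards [MemLp.coeFn_toLp (hmem i)] with x hx
        rw [hx]
        exact (norm_sub_le _ _).trans (add_le_add (abs_partialDeriv_mollify_le (hε m) hf i x)
          (abs_partialDeriv_le hf i x))
      -- The number 2 is the ratio of the outer radius ε to the inner radius ε/2 of the bumps, which
      -- has to stay bounded.
      · have h2 := ContDiffBump.ae_convolution_tendsto_right_of_locallyIntegrable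
          (φ := fun m => mollifier (ε m) (hε m)) (l := atTop) (K := 2) hεlim
          (Eventually.of_forall fun m => (mul_div_cancel₀ (ε m) two_ne_zero).ge) (hloc' i)
        filter_upwards [MemLp.coeFn_toLp (hmem i), ae_restrict_of_ae h2] with x hx h2x
        rw [hx]
        simp only [partialDeriv_mollify _ hf]
        have h3 := h2x.sub_const (partialDeriv i f x)
        rwa [sub_self] at h3
    · exact tendsto_eLpNorm_of_bounded (fun m => (((hu m).continuous.sub hf.continuous).comp
        (continuous_edgePath i)).aestronglyMeasurable) L (fun m => ae_of_all _ fun t => hb m _)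
        (ae_of_all _ fun t => hlim _)
  exact ⟨_, _, htr.hasWeakGradient, hf.continuous.continuousOn, htr⟩

/-- With d the distance to the complement, the function that is 0 for d ≤ δ, 1 for d ≥ 2δ and linear
in d in between is Lipschitz with constant 1/δ. Mollification at scale δ/2 keeps this bound for the
gradient; the result vanishes for d < δ/2 and is 1 for d > 3δ. -/
lemma exists_cutoff (K : PolygonalElement n) {δ : ℝ} (hδ : 0 < δ) :
    ∃ η, K.IsTest η ∧ (∀ x, |η x| ≤ 1) ∧ (∀ i x, |partialDeriv i η x| ≤ δ⁻¹) ∧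
      ∀ x, 3 * δ < Metric.infDist x K.carrierᶜ → η x = 1 ∧ ∀ i, partialDeriv i η x = 0 := by
  set d : Plane → ℝ := fun x => Metric.infDist x K.carrierᶜ
  have hd : LipschitzWith 1 d := Metric.lipschitz_infDist_pt _
  have hdist : ∀ x y, |d x - d y| ≤ dist x y := fun x y => by
    simpa [Real.dist_eq] using hd.dist_le_mul x y
  let f : Plane → ℝ := fun x => max 0 (min 1 (δ⁻¹ * (d x - δ)))
  have hf : LipschitzWith ⟨δ⁻¹, by positivity⟩ f := by
    refine LipschitzWith.of_dist_le_mul fun x y => ?_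
    rw [Real.dist_eq]
    have h1 := abs_max_sub_max_le_max (0 : ℝ) (min 1 (δ⁻¹ * (d x - δ))) 0
      (min 1 (δ⁻¹ * (d y - δ)))
    rw [sub_self, abs_zero] at h1
    refine (h1.trans (max_le (abs_nonneg _) le_rfl)).trans ((abs_min_sub_min_le_max (1 : ℝ) _ 1 _).trans ?_)
    rw [sub_self, abs_zero, max_eq_right (abs_nonneg _), ← mul_sub, abs_mul,
      abs_of_pos (inv_pos.2 hδ), sub_sub_sub_cancel_right]
    exact mul_le_mul_of_nonneg_left (hdist x y) (inv_pos.2 hδ).le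
  have hf0 : ∀ x, d x ≤ δ → f x = 0 := fun x hx =>
    max_eq_left ((min_le_right _ _).trans
      (mul_nonpos_of_nonneg_of_nonpos (inv_pos.2 hδ).le (by linarith)))
  have hf1 : ∀ x, 2 * δ ≤ d x → f x = 1 := fun x hx => by
    have : 1 ≤ δ⁻¹ * (d x - δ) := by
      rw [inv_mul_eq_div, le_div_iff₀ hδ]
      linarith
    simp only [f]
    rw [min_eq_left this, max_eq_right zero_le_one]
  have hfb : ∀ x, |f x| ≤ 1 := fun x => by
    rw [abs_of_nonneg (le_max_left _ _)]
    exact max_le zero_le_one (min_le_left _ _)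
  have hε : 0 < δ / 2 := half_pos hδ
  have hη1 : ∀ x, 3 * δ < d x → mollify (δ / 2) hε f x = 1 := fun x hx => by
    have hy : ∀ y, dist y x < δ / 2 → f y = 1 := fun y hy => hf1 y (by
      have := (abs_le.1 ((hdist y x).trans hy.le)).1
      linarith)
    have hx1 : f x = 1 := hy x (by rwa [dist_self])
    rw [mollify_eq hε fun y hy' => ?_, hx1]
    rw [hx1]
    exact hy y hy'
  have hη0 : ∀ x, d x < δ / 2 → mollify (δ / 2) hε f x = 0 := fun x hx => by
    have hy : ∀ y, dist y x < δ / 2 → f y = 0 := fun y hy => hf0 y (by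
      have := (abs_le.1 ((hdist y x).trans hy.le)).2
      linarith)
    have hx1 : f x = 0 := hy x (by rwa [dist_self])
    rw [mollify_eq hε fun y hy' => ?_, hx1]
    rw [hx1]
    exact hy y hy'
  have hsub : tsupport (mollify (δ / 2) hε f) ⊆ K.carrier := by
    have h1 : tsupport (mollify (δ / 2) hε f) ⊆ {x | δ / 2 ≤ d x} := by
      refine closure_minimal (fun x hx => ?_) (isClosed_le continuous_const hd.continuous)
      by_contra hx'
      exact hx (hη0 x (not_le.1 hx'))
    intro x hx
    by_contra hx'
    have h2 : d x = 0 := Metric.infDist_zero_of_mem hx'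
    have h3 : δ / 2 ≤ d x := h1 hx
    linarith
  refine ⟨mollify (δ / 2) hε f, ⟨contDiff_mollify hε hf.continuous.locallyIntegrable, ?_, hsub⟩,
    abs_mollify_le hε hfb, abs_partialDeriv_mollify_le hε hf, fun x hx => ⟨hη1 x hx, fun i => ?_⟩⟩
  · exact Metric.isCompact_of_isClosed_isBounded (isClosed_tsupport _) (K.isBounded.subset hsub)
  · have : mollify (δ / 2) hε f =ᶠ[𝓝 x] fun _ => 1 := by
      filter_upwards [(isOpen_lt continuous_const hd.continuous).mem_nhds hx] with y hy
      exact hη1 y hy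
    unfold VEM.partialDeriv
    rw [this.fderiv_eq]
    simp

end PolygonalElement

namespace PolygonalElement

variable {n : ℕ} {K : PolygonalElement n}

/-! ### Geometry of the boundary -/

lemma edgePath_apply (i : Fin n) (t : ℝ) :
    K.polygon.edgePath ℝ i t =
      K.polygon i + t • (K.polygon (finRotate n i) - K.polygon i) := by
  rw [Polygon.edgePath, AffineMap.lineMap_apply_module', add_comm]

lemma edgePath_zero (i : Fin n) : K.polygon.edgePath ℝ i 0 = K.polygon i :=
  AffineMap.lineMap_apply_zero _ _

lemma edgePath_one (i : Fin n) : K.polygon.edgePath ℝ i 1 = K.polygon (finRotate n i) :=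
  AffineMap.lineMap_apply_one _ _

lemma edgePath_inj {i j : Fin n} {s t : ℝ} (hs : s ∈ Ico (0 : ℝ) 1) (ht : t ∈ Ico (0 : ℝ) 1)
    (h : K.polygon.edgePath ℝ i s = K.polygon.edgePath ℝ j t) : i = j ∧ s = t := by
  have e : (i, s) = (j, t) :=
    K.simple (⟨mem_univ _, hs⟩ : (i, s) ∈ univ ×ˢ Ico (0 : ℝ) 1)
      (⟨mem_univ _, ht⟩ : (j, t) ∈ univ ×ˢ Ico (0 : ℝ) 1) h
  exact Prod.mk.inj e

lemma vertex_ne (i : Fin n) : K.polygon (finRotate n i) ≠ K.polygon i := by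
  intro h
  have := edgePath_inj (K := K) (i := i) (j := i) (s := 0) (t := 1 / 2) (by norm_num)
    (by norm_num) (by rw [edgePath_apply, edgePath_apply, h, sub_self, smul_zero, smul_zero])
  norm_num at this

lemma edgeLength_pos (i : Fin n) : 0 < K.edgeLength i := dist_pos.2 (vertex_ne i).symm

lemma finRotate_ne (K : PolygonalElement n) (i : Fin n) : finRotate n i ≠ i := fun h =>
  vertex_ne (K := K) i (by rw [h])

/-- Injectivity is known for half-open edges only, so a parameter 1 is first replaced by the
parameter 0 of the next edge. -/
lemma edge_inter {i j : Fin n} (hij : i ≠ j) {s t : ℝ} (hs : s ∈ Icc (0 : ℝ) 1)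
    (ht : t ∈ Icc (0 : ℝ) 1) (h : K.polygon.edgePath ℝ i s = K.polygon.edgePath ℝ j t) :
    (j = finRotate n i ∧ s = 1 ∧ t = 0) ∨ (i = finRotate n j ∧ s = 0 ∧ t = 1) := by
  have h0 : (0 : ℝ) ∈ Ico (0 : ℝ) 1 := by norm_num
  rcases hs.2.eq_or_lt with rfl | hs1 <;> rcases ht.2.eq_or_lt with rfl | ht1
  · rw [edgePath_one, edgePath_one, ← edgePath_zero, ← edgePath_zero] at h
    exact absurd ((finRotate n).injective (edgePath_inj h0 h0 h).1) hij
  · rw [edgePath_one, ← edgePath_zero] at h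
    obtain ⟨h1, h2⟩ := edgePath_inj h0 ⟨ht.1, ht1⟩ h
    exact Or.inl ⟨h1.symm, rfl, h2.symm⟩
  · rw [edgePath_one, ← edgePath_zero (finRotate n j)] at h
    obtain ⟨h1, h2⟩ := edgePath_inj ⟨hs.1, hs1⟩ h0 h
    exact Or.inr ⟨h1, h2, rfl⟩
  · exact absurd (edgePath_inj ⟨hs.1, hs1⟩ ⟨ht.1, ht1⟩ h).1 hij

/-- By homogeneity it is enough to take the minimum over the compact segment σ + τ = 1. Applied to
two consecutive edge vectors, it says that the edges do not fold back onto each other. -/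
lemma exists_mul_add_le_norm {E : Type*} [NormedAddCommGroup E] [NormedSpace ℝ E] {u w : E}
    (h : ∀ σ ∈ Icc (0 : ℝ) 1, σ • u + (1 - σ) • w ≠ 0) :
    ∃ m > 0, ∀ σ τ : ℝ, 0 ≤ σ → 0 ≤ τ → m * (σ + τ) ≤ ‖σ • u + τ • w‖ := by
  have hc : Continuous fun σ : ℝ => ‖σ • u + (1 - σ) • w‖ := by fun_prop
  obtain ⟨σ₀, h0, hmin⟩ := isCompact_Icc.exists_isMinOn (nonempty_Icc.2 (zero_le_one (α := ℝ)))
    hc.continuousOn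
  refine ⟨_, norm_pos_iff.2 (h σ₀ h0), fun σ τ hσ hτ => ?_⟩
  rcases (add_nonneg hσ hτ).eq_or_lt with hz | hpos
  · rw [← hz, mul_zero]
    exact norm_nonneg _
  · have h1 : σ / (σ + τ) ∈ Icc (0 : ℝ) 1 :=
      ⟨by positivity, (div_le_one hpos).2 (by linarith)⟩
    have h2 := hmin h1
    simp only [mem_ofPred_eq] at h2
    have h3 : σ • u + τ • w =
        (σ + τ) • ((σ / (σ + τ)) • u + (1 - σ / (σ + τ)) • w) := by
      rw [smul_add, smul_smul, smul_smul]
      congr 2 <;> field_simp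
      ring
    rw [h3, norm_smul, Real.norm_of_nonneg hpos.le, mul_comm]
    exact mul_le_mul_of_nonneg_left h2 hpos.le

/-- Passing through the common vertex costs at most M((1 - s) + t), and this sum is comparable to
the distance of the two points because the edges form a nonzero angle. -/
lemma exists_lipschitz_adjacent {g : Plane → ℝ} {M : ℝ} (hM : 0 ≤ M)
    (hg : ∀ i, ∀ s ∈ Icc (0 : ℝ) 1, ∀ t ∈ Icc (0 : ℝ) 1,
      |g (K.polygon.edgePath ℝ i s) - g (K.polygon.edgePath ℝ i t)| ≤ M * |s - t|) (i : Fin n) :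
    ∃ L, 0 ≤ L ∧ ∀ s ∈ Icc (0 : ℝ) 1, ∀ t ∈ Icc (0 : ℝ) 1,
      |g (K.polygon.edgePath ℝ i s) - g (K.polygon.edgePath ℝ (finRotate n i) t)| ≤
        L * dist (K.polygon.edgePath ℝ i s) (K.polygon.edgePath ℝ (finRotate n i) t) := by
  set j := finRotate n i
  have hij : i ≠ j := (finRotate_ne K i).symm
  have hz : K.polygon.edgePath ℝ i 1 = K.polygon.edgePath ℝ j 0 := by
    rw [edgePath_one, edgePath_zero]
  set u := K.polygon j - K.polygon i
  set w := K.polygon (finRotate n j) - K.polygon j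
  have hdiff : ∀ s t, K.polygon.edgePath ℝ j t - K.polygon.edgePath ℝ i s =
      (1 - s) • u + t • w := by
    intro s t
    rw [edgePath_apply, edgePath_apply]
    simp only [u, w, j]
    module
  have hne : ∀ σ ∈ Icc (0 : ℝ) 1, σ • u + (1 - σ) • w ≠ 0 := by
    intro σ hσ h0
    -- A vanishing combination would make the two edges meet at equal parameters, whereas the common
    -- vertex has parameters 1 and 0.
    have h1 := hdiff (1 - σ) (1 - σ)
    rw [sub_sub_cancel, h0, sub_eq_zero] at h1
    have hσ' : 1 - σ ∈ Icc (0 : ℝ) 1 := ⟨by linarith [hσ.2], by linarith [hσ.1]⟩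
    rcases edge_inter hij hσ' hσ' h1.symm with h2 | h2
    · linarith [h2.2.1, h2.2.2]
    · linarith [h2.2.1, h2.2.2]
  obtain ⟨m, hm, hmin⟩ := exists_mul_add_le_norm hne
  refine ⟨M * m⁻¹, by positivity, fun s hs t ht => ?_⟩
  have h1 := hg i s hs 1 (by norm_num)
  have h2 := hg j 0 (by norm_num) t ht
  have h3 := hmin (1 - s) t (by linarith [hs.2]) ht.1
  rw [← hdiff, ← dist_eq_norm, dist_comm] at h3
  rw [abs_sub_comm s 1, abs_of_nonneg (by linarith [hs.2] : 0 ≤ 1 - s)] at h1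
  rw [zero_sub, abs_neg, abs_of_nonneg ht.1, ← hz] at h2
  calc _ ≤ M * (1 - s) + M * t := (abs_sub_le _ _ _).trans (add_le_add h1 h2)
    _ = M * m⁻¹ * (m * (1 - s + t)) := by field_simp
    _ ≤ _ := mul_le_mul_of_nonneg_left h3 (by positivity)

/-- Points on one edge are compared by its length, points on consecutive edges by the previous
lemma. Any other two edges are disjoint compact sets, so their distance is positive and boundedness
of g suffices. -/
lemma exists_lipschitz_pair {g : Plane → ℝ} {M : ℝ} (hM : 0 ≤ M)
    (hg : ∀ i, ∀ s ∈ Icc (0 : ℝ) 1, ∀ t ∈ Icc (0 : ℝ) 1,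
      |g (K.polygon.edgePath ℝ i s) - g (K.polygon.edgePath ℝ i t)| ≤ M * |s - t|)
    (i j : Fin n) :
    ∃ L, 0 ≤ L ∧ ∀ s ∈ Icc (0 : ℝ) 1, ∀ t ∈ Icc (0 : ℝ) 1,
      |g (K.polygon.edgePath ℝ i s) - g (K.polygon.edgePath ℝ j t)| ≤
        L * dist (K.polygon.edgePath ℝ i s) (K.polygon.edgePath ℝ j t) := by
  by_cases hij : i = j
  · subst hij
    have hl := edgeLength_pos (K := K) i
    refine ⟨M * (K.edgeLength i)⁻¹, by positivity, fun s hs t ht => ?_⟩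
    refine (hg i s hs t ht).trans (le_of_eq ?_)
    rw [Polygon.edgePath, dist_lineMap_lineMap, Real.dist_eq]
    change _ = M * (K.edgeLength i)⁻¹ * (|s - t| * K.edgeLength i)
    field_simp
  by_cases h1 : j = finRotate n i
  · subst h1
    exact exists_lipschitz_adjacent hM hg i
  by_cases h2 : i = finRotate n j
  · subst h2
    obtain ⟨L, hL, h⟩ := exists_lipschitz_adjacent hM hg j
    refine ⟨L, hL, fun s hs t ht => ?_⟩
    rw [abs_sub_comm, dist_comm]
    exact h t ht s hs
  have hc : Continuous fun x : ℝ × ℝ =>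
      dist (K.polygon.edgePath ℝ i x.1) (K.polygon.edgePath ℝ j x.2) :=
    ((continuous_edgePath i).comp continuous_fst).dist
      ((continuous_edgePath j).comp continuous_snd)
  obtain ⟨x₀, hx₀, hmin⟩ := (isCompact_Icc.prod isCompact_Icc).exists_isMinOn
    ((nonempty_Icc.2 (zero_le_one (α := ℝ))).prod (nonempty_Icc.2 (zero_le_one (α := ℝ))))
    hc.continuousOn
  have hd : 0 < dist (K.polygon.edgePath ℝ i x₀.1) (K.polygon.edgePath ℝ j x₀.2) := by
    refine dist_pos.2 fun h => ?_
    rcases edge_inter hij hx₀.1 hx₀.2 h with h3 | h3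
    · exact h1 h3.1
    · exact h2 h3.1
  set d := dist (K.polygon.edgePath ℝ i x₀.1) (K.polygon.edgePath ℝ j x₀.2)
  have hb : ∀ i, ∀ s ∈ Icc (0 : ℝ) 1,
      |g (K.polygon.edgePath ℝ i s)| ≤ |g (K.polygon.edgePath ℝ i 0)| + M := by
    intro i s hs
    have h3 := hg i s hs 0 (by norm_num)
    rw [sub_zero, abs_of_nonneg hs.1] at h3
    have h4 := abs_sub_abs_le_abs_sub (g (K.polygon.edgePath ℝ i s))
      (g (K.polygon.edgePath ℝ i 0))
    nlinarith [hs.2]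
  set B := |g (K.polygon.edgePath ℝ i 0)| + M + (|g (K.polygon.edgePath ℝ j 0)| + M)
  have hB : 0 ≤ B := by positivity
  refine ⟨B * d⁻¹, by positivity, fun s hs t ht => ?_⟩
  calc _ ≤ B := (abs_sub _ _).trans (add_le_add (hb i s hs) (hb j t ht))
    _ = B * d⁻¹ * d := by field_simp
    _ ≤ _ := mul_le_mul_of_nonneg_left (hmin (⟨hs, ht⟩ : (s, t) ∈ _ ×ˢ _)) (by positivity)

lemma mem_frontier_iff {x : Plane} :
    x ∈ frontier K.carrier ↔ ∃ i, ∃ t ∈ Icc (0 : ℝ) 1, K.polygon.edgePath ℝ i t = x := by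
  rw [K.frontier_eq, Polygon.boundary, mem_iUnion]
  rfl

lemma exists_lipschitzOnWith_frontier {g : Plane → ℝ} {M : ℝ} (hM : 0 ≤ M)
    (hg : ∀ i, ∀ s ∈ Icc (0 : ℝ) 1, ∀ t ∈ Icc (0 : ℝ) 1,
      |g (K.polygon.edgePath ℝ i s) - g (K.polygon.edgePath ℝ i t)| ≤ M * |s - t|) :
    ∃ L, LipschitzOnWith L g (frontier K.carrier) := by
  choose L hL0 hL using exists_lipschitz_pair hM hg
  refine ⟨⟨∑ i, ∑ j, L i j, Finset.sum_nonneg fun i _ => Finset.sum_nonneg fun j _ => hL0 i j⟩,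
    LipschitzOnWith.of_dist_le_mul fun x hx y hy => ?_⟩
  obtain ⟨i, s, hs, rfl⟩ := mem_frontier_iff.1 hx
  obtain ⟨j, t, ht, rfl⟩ := mem_frontier_iff.1 hy
  refine (hL i j s hs t ht).trans (mul_le_mul_of_nonneg_right ?_ dist_nonneg)
  refine (Finset.single_le_sum (f := fun j => L i j) (fun j _ => hL0 i j)
    (Finset.mem_univ j)).trans ?_
  exact Finset.single_le_sum (f := fun i => ∑ j, L i j)
    (fun i _ => Finset.sum_nonneg fun j _ => hL0 i j) (Finset.mem_univ i)

lemma exists_lipschitz_poly (p : Polynomial ℝ) :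
    ∃ M : ℝ, 0 ≤ M ∧ ∀ s ∈ Icc (0 : ℝ) 1, ∀ t ∈ Icc (0 : ℝ) 1,
      |p.eval s - p.eval t| ≤ M * |s - t| := by
  obtain ⟨M, hM⟩ := isCompact_Icc.exists_bound_of_continuousOn (s := Icc (0 : ℝ) 1)
    p.derivative.continuous.continuousOn
  refine ⟨M, (norm_nonneg _).trans (hM 0 (by norm_num)), fun s hs t ht => ?_⟩
  exact (convex_Icc (0 : ℝ) 1).norm_image_sub_le_of_norm_hasDerivWithin_le
    (fun x _ => (p.hasDerivAt x).hasDerivWithinAt) hM ht hs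

/-- The edge polynomials agree at the vertices, so they define a function on the boundary through
the inverse of its injective parametrization. It is Lipschitz for the distance of the plane and
therefore extends to the plane. -/
lemma exists_lipschitz_of_polys (p : Fin n → Polynomial ℝ)
    (hp : ∀ i, (p i).eval 1 = (p (finRotate n i)).eval 0) :
    ∃ (L : NNReal) (f : Plane → ℝ), LipschitzWith L f ∧
      ∀ i, ∀ t ∈ Icc (0 : ℝ) 1, f (K.polygon.edgePath ℝ i t) = (p i).eval t := by
  have : Nonempty (Fin n × ℝ) := ⟨(⟨0, by have := K.three_le; omega⟩, 0)⟩
  let F : Fin n × ℝ → Plane := fun s => K.polygon.edgePath ℝ s.1 s.2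
  let S : Set (Fin n × ℝ) := univ ×ˢ Ico (0 : ℝ) 1
  let g : Plane → ℝ := fun x => (p (Function.invFunOn F S x).1).eval (Function.invFunOn F S x).2
  have hg0 : ∀ i, ∀ t ∈ Ico (0 : ℝ) 1, g (K.polygon.edgePath ℝ i t) = (p i).eval t := by
    intro i t ht
    have := K.simple.leftInvOn_invFunOn (⟨mem_univ _, ht⟩ : (i, t) ∈ univ ×ˢ Ico (0 : ℝ) 1)
    change (p (Function.invFunOn F S (F (i, t))).1).eval (Function.invFunOn F S (F (i, t))).2 = _
    rw [this]
  have hg : ∀ i, ∀ t ∈ Icc (0 : ℝ) 1, g (K.polygon.edgePath ℝ i t) = (p i).eval t := by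
    intro i t ht
    rcases ht.2.eq_or_lt with rfl | ht1
    · rw [edgePath_one, ← edgePath_zero, hg0 _ _ (by norm_num), hp]
    · exact hg0 i t ⟨ht.1, ht1⟩
  choose M hM0 hM using fun i => exists_lipschitz_poly (p i)
  obtain ⟨L, hL⟩ := exists_lipschitzOnWith_frontier (K := K) (g := g) (M := ∑ i, M i)
    (Finset.sum_nonneg fun i _ => hM0 i) fun i s hs t ht => by
      rw [hg i s hs, hg i t ht]
      exact (hM i s hs t ht).trans (mul_le_mul_of_nonneg_right
        (Finset.single_le_sum (fun i _ => hM0 i) (Finset.mem_univ i)) (abs_nonneg _))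
  obtain ⟨f, hf, e⟩ := hL.extend_real
  exact ⟨L, f, hf, fun i t ht => (e (edgePath_mem_frontier i ht)).symm.trans (hg i t ht)⟩

/-! ### Star-shaped elements -/

/-- The element is star-shaped with respect to the ball around `c` of radius `r`. -/
structure StarBall (K : PolygonalElement n) (c : Plane) (r : ℝ) : Prop where
  pos : 0 < r
  star : ∀ y ∈ Metric.ball c r, StarConvex ℝ y K.carrier

lemma IsRegular.exists_starBall {ρ : ℝ} (hρ : 0 < ρ) (h : K.IsRegular ρ) :
    ∃ c r, K.StarBall c r := by
  obtain ⟨⟨c, r, h1, -, h3⟩, -⟩ := h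
  refine ⟨c, r, lt_of_lt_of_le (mul_pos hρ ?_) h1, h3⟩
  obtain ⟨x, hx⟩ := K.isConnected.nonempty
  exact Metric.diam_pos (infinite_of_mem_nhds x (K.isOpen.mem_nhds hx)).nontrivial K.isBounded

namespace StarBall

variable {c : Plane} {r : ℝ} (h : K.StarBall c r)

include h

/-- For z in the element, the ball on the left consists of the points (1 - s)y + sz with y in the
ball around c, and star-shapedness applies. -/
lemma ball_subset {z : Plane} (hz : z ∈ closure K.carrier) {s : ℝ} (hs0 : 0 ≤ s) (hs1 : s < 1) :
    Metric.ball (c + s • (z - c)) ((1 - s) * r) ⊆ K.carrier := by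
  intro w hw
  rw [Metric.mem_ball, dist_eq_norm] at hw
  have hs : 0 < 1 - s := sub_pos.2 hs1
  -- As z is only in the closure, it is replaced by a point z' of the element. The room left by the
  -- strict inequality for w keeps the corresponding y in the ball.
  obtain ⟨z', hz', hd⟩ := Metric.mem_closure_iff.1 hz _ (sub_pos.2 hw)
  rw [dist_eq_norm] at hd
  have hc' : (1 - s)⁻¹ • (w - s • z') ∈ Metric.ball c r := by
    rw [Metric.mem_ball, dist_eq_norm]
    have e : (1 - s)⁻¹ • (w - s • z') - c =
        (1 - s)⁻¹ • ((w - (c + s • (z - c))) + s • (z - z')) := by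
      have : c = (1 - s)⁻¹ • ((1 - s) • c) := by rw [smul_smul, inv_mul_cancel₀ hs.ne', one_smul]
      nth_rw 1 [this]
      rw [← smul_sub]
      congr 1
      module
    rw [e, norm_smul, Real.norm_of_nonneg (inv_nonneg.2 hs.le), inv_mul_lt_iff₀ hs]
    refine (norm_add_le _ _).trans_lt ?_
    rw [norm_smul, Real.norm_of_nonneg hs0]
    nlinarith [norm_nonneg (z - z')]
  have := h.star _ hc' hz' hs.le hs0 (by ring)
  rwa [smul_smul, mul_inv_cancel₀ hs.ne', one_smul, sub_add_cancel] at this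

lemma segment_mem {z : Plane} (hz : z ∈ closure K.carrier) {s : ℝ} (hs0 : 0 ≤ s) (hs1 : s < 1) :
    c + s • (z - c) ∈ K.carrier :=
  h.ball_subset hz hs0 hs1 (Metric.mem_ball_self (mul_pos (sub_pos.2 hs1) h.pos))

omit h in
lemma compl_nonempty (K : PolygonalElement n) : K.carrierᶜ.Nonempty := by
  rw [nonempty_compl]
  intro e
  exact NormedSpace.unbounded_univ ℝ Plane (e ▸ K.isBounded)

lemma le_infDist {z : Plane} (hz : z ∈ closure K.carrier) {s : ℝ} (hs0 : 0 ≤ s) (hs1 : s < 1) :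
    (1 - s) * r ≤ Metric.infDist (c + s • (z - c)) K.carrierᶜ := by
  rw [Metric.le_infDist (compl_nonempty K)]
  intro y hy
  by_contra hlt
  refine hy (h.ball_subset hz hs0 hs1 ?_)
  rw [Metric.mem_ball, dist_comm]
  exact not_le.1 hlt

omit h in
-- The ray from c through x leaves the bounded element; its first exit point c + l(x - c) with l > 1
-- lies on an edge, and s = 1/l.
lemma exists_edgePath {x : Plane} (hx : x ∈ K.carrier) (hxc : x ≠ c) :
    ∃ i, ∃ t ∈ Icc (0 : ℝ) 1, ∃ s ∈ Ioo (0 : ℝ) 1,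
      c + s • (K.polygon.edgePath ℝ i t - c) = x := by
  let f : ℝ → Plane := fun l => c + l • (x - c)
  have hf : Continuous f := by fun_prop
  let S : Set ℝ := Ici 1 ∩ f ⁻¹' K.carrierᶜ
  have hS : IsClosed S := isClosed_Ici.inter (K.isOpen.isClosed_compl.preimage hf)
  have hSne : S.Nonempty := by
    obtain ⟨R, hR⟩ := K.isBounded.subset_closedBall c
    have hn : 0 < ‖x - c‖ := norm_pos_iff.2 (sub_ne_zero.2 hxc)
    refine ⟨max 1 ((|R| + 1) / ‖x - c‖), mem_Ici.2 (le_max_left _ _), fun hmem => ?_⟩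
    have h1 := hR hmem
    rw [Metric.mem_closedBall, dist_eq_norm, add_sub_cancel_left, norm_smul,
      Real.norm_of_nonneg (zero_le_one.trans (le_max_left _ _))] at h1
    have h2 : (|R| + 1) / ‖x - c‖ * ‖x - c‖ ≤
        max 1 ((|R| + 1) / ‖x - c‖) * ‖x - c‖ :=
      mul_le_mul_of_nonneg_right (le_max_right _ _) hn.le
    rw [div_mul_cancel₀ _ hn.ne'] at h2
    linarith [le_abs_self R]
  have hbdd : BddBelow S := ⟨1, fun l hl => hl.1⟩
  have hl := hS.csInf_mem hSne hbdd
  set l := sInf S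
  have hf1 : f 1 = x := by simp [f]
  have hl1 : 1 < l := lt_of_le_of_ne hl.1 fun e => hl.2 (by rw [← e, hf1]; exact hx)
  have hcl : f l ∈ closure K.carrier := by
    have hmaps : MapsTo f (Ico 1 l) K.carrier := fun m hm => by
      by_contra hm'
      exact absurd (csInf_le hbdd (⟨hm.1, hm'⟩ : m ∈ S)) (not_le.2 hm.2)
    refine hmaps.closure hf ?_
    rw [closure_Ico hl1.ne]
    exact ⟨hl1.le, le_rfl⟩
  have hfr : f l ∈ frontier K.carrier := by
    rw [frontier, K.isOpen.interior_eq]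
    exact ⟨hcl, hl.2⟩
  obtain ⟨i, t, ht, e⟩ := mem_frontier_iff.1 hfr
  have hlpos : 0 < l := zero_lt_one.trans hl1
  refine ⟨i, t, ht, l⁻¹, ⟨inv_pos.2 hlpos, inv_lt_one_of_one_lt₀ hl1⟩, ?_⟩
  rw [e]
  simp only [f]
  rw [add_sub_cancel_left, smul_smul, inv_mul_cancel₀ hlpos.ne', one_smul, add_sub_cancel]

lemma notMem_edge {i : Fin n} {t : ℝ} (ht : t ∈ Icc (0 : ℝ) 1) {s : ℝ} (hs0 : 0 ≤ s) (hs1 : s < 1)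
    {z : Plane} (hz : z ∈ closure K.carrier) : K.polygon.edgePath ℝ i t ≠ c + s • (z - c) := by
  intro e
  have h1 := edgePath_mem_frontier (K := K) i ht
  rw [frontier, K.isOpen.interior_eq, e] at h1
  exact h1.2 (h.segment_mem hz hs0 hs1)

omit h in
/-- The determinant of the vectors from `c` to the initial vertex of an edge and along the edge. -/
def edgeDet (K : PolygonalElement n) (c : Plane) (i : Fin n) : ℝ :=
  (K.polygon i 0 - c 0) * (K.polygon (finRotate n i) 1 - K.polygon i 1) -
    (K.polygon i 1 - c 1) * (K.polygon (finRotate n i) 0 - K.polygon i 0)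

/-- Otherwise c lies on the line through the edge with endpoints a and b, say c = a - μ(b - a). If μ
> 0 then a lies strictly between c and b, if μ < -1 then b lies strictly between c and a, and in the
remaining case c is on the edge. Each time a boundary point would be in the open element by
`segment_mem`. -/
lemma edgeDet_ne_zero (i : Fin n) : edgeDet K c i ≠ 0 := by
  intro h0
  set a := K.polygon i with ha
  set b := K.polygon (finRotate n i) with hb
  have hab : b - a ≠ 0 := sub_ne_zero.2 (vertex_ne i)
  obtain ⟨μ, hμ⟩ : ∃ μ : ℝ, a - c = μ • (b - a) := by
    unfold edgeDet at h0
    rw [← ha, ← hb] at h0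
    by_cases hb0 : b 0 - a 0 = 0
    · have hb1 : b 1 - a 1 ≠ 0 := by
        intro hb1
        refine hab (PiLp.ext fun j => ?_)
        fin_cases j
        · exact hb0
        · exact hb1
      refine ⟨(a 1 - c 1) / (b 1 - a 1), PiLp.ext fun j => ?_⟩
      rw [hb0, mul_zero, sub_zero] at h0
      have h1 := (mul_eq_zero.1 h0).resolve_right hb1
      fin_cases j
      · simp [h1, hb0]
      · simp [hb1]
    · refine ⟨(a 0 - c 0) / (b 0 - a 0), PiLp.ext fun j => ?_⟩
      fin_cases j
      · simp [hb0]
      · simp only [Fin.mk_one, PiLp.sub_apply, PiLp.smul_apply, smul_eq_mul]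
        field_simp
        linarith
  have hc : c = a - μ • (b - a) := by rw [← hμ, sub_sub_cancel]
  have hcl : ∀ t ∈ Icc (0 : ℝ) 1, K.polygon.edgePath ℝ i t ∈ closure K.carrier := fun t ht =>
    frontier_subset_closure (edgePath_mem_frontier i ht)
  have h00 : (0 : ℝ) ∈ Icc (0 : ℝ) 1 := by norm_num
  have h11 : (1 : ℝ) ∈ Icc (0 : ℝ) 1 := by norm_num
  rcases lt_or_ge 0 μ with hpos | hneg
  · refine h.notMem_edge (i := i) h00 (s := μ / (1 + μ)) (by positivity)
      ((div_lt_one (by positivity)).2 (by linarith)) (hcl 1 h11) ?_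
    have e : K.polygon.edgePath ℝ i 1 - c = (1 + μ) • (b - a) := by
      rw [edgePath_one, ← hb, hc]
      module
    rw [e, smul_smul, div_mul_cancel₀ _ (by positivity), edgePath_zero, ← ha, ← hμ,
      add_sub_cancel]
  · rcases lt_or_ge μ (-1) with hlt | hge
    · have hμ0 : μ ≠ 0 := by linarith
      refine h.notMem_edge (i := i) h11 (s := (1 + μ) / μ)
        (div_nonneg_of_nonpos (by linarith) hneg)
        ((div_lt_one_of_neg (by linarith)).2 (by linarith)) (hcl 0 h00) ?_
      rw [edgePath_zero, edgePath_one, ← ha, ← hb, hμ, smul_smul, div_mul_cancel₀ _ hμ0, hc]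
      module
    · refine h.notMem_edge (i := i) (t := -μ) ⟨by linarith, by linarith⟩ (s := 0) le_rfl zero_lt_one
        (hcl 0 h00) ?_
      rw [edgePath_apply, zero_smul, add_zero, ← ha, ← hb]
      conv_rhs => rw [hc]
      module

end StarBall

end PolygonalElement

/-! ### Inequalities along rays -/

lemma enorm_sq_eq (a : ℝ) : ‖a‖ₑ ^ 2 = ENNReal.ofReal (a ^ 2) := by
  rw [Real.enorm_eq_ofReal_abs, ← ENNReal.ofReal_pow (abs_nonneg a), sq_abs]

lemma enorm_add_sq_le (a b : ℝ) : ‖a + b‖ₑ ^ 2 ≤ 2 * ‖a‖ₑ ^ 2 + 2 * ‖b‖ₑ ^ 2 := by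
  simp only [enorm_sq_eq]
  rw [← ENNReal.ofReal_ofNat 2, ← ENNReal.ofReal_mul zero_le_two, ← ENNReal.ofReal_mul zero_le_two,
    ← ENNReal.ofReal_add (by positivity) (by positivity)]
  exact ENNReal.ofReal_le_ofReal (by nlinarith [sq_nonneg (a - b)])

lemma sq_lintegral_enorm_le {α : Type*} [MeasurableSpace α] {μ : Measure α} {f : α → ℝ}
    (hf : AEStronglyMeasurable f μ) :
    (∫⁻ x, ‖f x‖ₑ ∂μ) ^ 2 ≤ μ univ * ∫⁻ x, ‖f x‖ₑ ^ 2 ∂μ := by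
  have h := eLpNorm_le_eLpNorm_mul_rpow_measure_univ (p := 1) (q := 2) (by norm_num) hf
  rw [eLpNorm_one_eq_lintegral_enorm] at h
  calc _ ≤ (eLpNorm f 2 μ * μ univ ^ (1 / (1 : ENNReal).toReal - 1 / (2 : ENNReal).toReal)) ^ 2 :=
        pow_le_pow_left' h 2
    _ = _ := by
        rw [mul_pow, eLpNorm_two_sq, ← ENNReal.rpow_natCast, ← ENNReal.rpow_mul, mul_comm]
        norm_num

/-- The fundamental theorem of calculus followed by Cauchy–Schwarz. -/
lemma enorm_sub_sq_le_lintegral {f f' : ℝ → ℝ} {a b : ℝ} (hf : ∀ x, HasDerivAt f (f' x) x)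
    (hc : Continuous f') {s t : ℝ} (hs : s ∈ Icc a b) (ht : t ∈ Icc a b) :
    ‖f s - f t‖ₑ ^ 2 ≤ ENNReal.ofReal (b - a) * ∫⁻ x in Ioo a b, ‖f' x‖ₑ ^ 2 := by
  have h1 : f s - f t = ∫ x in t..s, f' x :=
    (intervalIntegral.integral_eq_sub_of_hasDerivAt (fun x _ => hf x)
      (hc.intervalIntegrable t s)).symm
  have h2 : ‖f s - f t‖ₑ ≤ ∫⁻ x in Ioo a b, ‖f' x‖ₑ := by
    have e : ‖∫ x in t..s, f' x‖ₑ = ‖∫ x in uIoc t s, f' x‖ₑ := by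
      rw [← ofReal_norm, ← ofReal_norm, intervalIntegral.norm_integral_eq_norm_integral_uIoc]
    rw [h1, e]
    refine (enorm_integral_le_lintegral_enorm _).trans ?_
    rw [restrict_Ioo_eq_restrict_Ioc]
    refine lintegral_mono_set ?_
    exact Ioc_subset_Ioc (le_min ht.1 hs.1) (max_le ht.2 hs.2)
  refine (pow_le_pow_left' h2 2).trans ((sq_lintegral_enorm_le hc.aestronglyMeasurable).trans ?_)
  rw [Measure.restrict_apply_univ, Real.volume_Ioo]

lemma enorm_sq_le_of_ray {f f' : ℝ → ℝ} {a b : ℝ} (hf : ∀ x, HasDerivAt f (f' x) x)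
    (hc : Continuous f') {s t : ℝ} (hs : s ∈ Icc a b) (ht : t ∈ Icc a b) :
    ‖f s‖ₑ ^ 2 ≤ 2 * ‖f t‖ₑ ^ 2 +
      2 * (ENNReal.ofReal (b - a) * ∫⁻ x in Ioo a b, ‖f' x‖ₑ ^ 2) := by
  have h := enorm_add_sq_le (f t) (f s - f t)
  rw [add_sub_cancel] at h
  exact h.trans (by gcongr; exact enorm_sub_sq_le_lintegral hf hc hs ht)

/-- The square of the norm of the gradient of `u`. -/
def gradSq (u : Plane → ℝ) (x : Plane) : ENNReal := ∑ j, ‖partialDeriv j u x‖ₑ ^ 2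

lemma fderiv_apply_eq {u : Plane → ℝ} (x w : Plane) :
    fderiv ℝ u x w = w 0 * partialDeriv 0 u x + w 1 * partialDeriv 1 u x := by
  have hw : w = w 0 • EuclideanSpace.single 0 (1 : ℝ) + w 1 • EuclideanSpace.single 1 (1 : ℝ) := by
    refine PiLp.ext fun j => ?_
    fin_cases j <;> simp
  conv_lhs => rw [hw]
  rw [map_add, map_smul, map_smul]
  rfl

lemma enorm_fderiv_apply_sq_le {u : Plane → ℝ} (x w : Plane) {R : ℝ} (hw : ‖w‖ ≤ R) :
    ‖fderiv ℝ u x w‖ₑ ^ 2 ≤ ENNReal.ofReal (R ^ 2) * gradSq u x := by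
  rw [fderiv_apply_eq, gradSq, Fin.sum_univ_two]
  simp only [enorm_sq_eq]
  rw [← ENNReal.ofReal_add (by positivity) (by positivity), ← ENNReal.ofReal_mul (by positivity)]
  refine ENNReal.ofReal_le_ofReal ?_
  have h1 : w 0 ^ 2 + w 1 ^ 2 ≤ R ^ 2 := by
    have := EuclideanSpace.real_norm_sq_eq w
    rw [Fin.sum_univ_two] at this
    rw [← this]
    exact pow_le_pow_left₀ (norm_nonneg _) hw 2
  set p := partialDeriv 0 u x
  set q := partialDeriv 1 u x
  -- Lagrange's identity: the square added here is the defect in the Cauchy–Schwarz inequality.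
  nlinarith [sq_nonneg (w 0 * q - w 1 * p), mul_le_mul_of_nonneg_right h1
    (by positivity : 0 ≤ p ^ 2 + q ^ 2)]

lemma measurable_gradSq {u : Plane → ℝ} (hu : ContDiff ℝ ∞ u) : Measurable (gradSq u) :=
  Finset.measurable_sum _ fun j _ =>
    ((PolygonalElement.continuous_partialDeriv hu j).measurable.enorm).pow_const 2

namespace PolygonalElement

variable {n : ℕ} {K : PolygonalElement n}

/-! ### The fan of triangles with apex `c` -/

/-- The point at the fraction `s` of the way from `c` to the point with parameter `t` on the
`i`-th edge. -/
def fanMap (K : PolygonalElement n) (c : Plane) (i : Fin n) (x : ℝ × ℝ) : Plane :=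
  c + x.1 • (K.polygon.edgePath ℝ i x.2 - c)

/-- The part of the triangle spanned by `c` and the `i`-th edge where `1 - σ < s < 1`. -/
def layer (K : PolygonalElement n) (c : Plane) (i : Fin n) (σ : ℝ) : Set Plane :=
  K.fanMap c i '' (Ioo (1 - σ) 1 ×ˢ Icc (0 : ℝ) 1)

/-- The integral over a layer, without the Jacobian determinant. -/
def layerIntegral (K : PolygonalElement n) (c : Plane) (i : Fin n) (σ : ℝ) (F : Plane → ENNReal) :
    ENNReal :=
  ∫⁻ t in Icc (0 : ℝ) 1, ∫⁻ s in Ioo (1 - σ) 1, F (K.fanMap c i (s, t))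

lemma continuous_fanMap (c : Plane) (i : Fin n) : Continuous (K.fanMap c i) :=
  continuous_const.add (continuous_fst.smul
    (((continuous_edgePath i).comp continuous_snd).sub continuous_const))

lemma fanMap_one (c : Plane) (i : Fin n) (t : ℝ) :
    K.fanMap c i (1, t) = K.polygon.edgePath ℝ i t := by
  simp [fanMap]

/-- The plane as a product. -/
def planeEquiv : Plane ≃ᵐ ℝ × ℝ :=
  (MeasurableEquiv.toLp 2 (Fin 2 → ℝ)).symm.trans MeasurableEquiv.finTwoArrow

lemma planeEquiv_apply (x : Plane) : planeEquiv x = (x 0, x 1) := rfl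

lemma measurePreserving_planeEquiv : MeasurePreserving planeEquiv volume volume :=
  (volume_preserving_finTwoArrow ℝ).comp
    (EuclideanSpace.volume_preserving_symm_measurableEquiv_toLp (Fin 2))

lemma planeEquiv_fanMap (c : Plane) (i : Fin n) (x : ℝ × ℝ) :
    planeEquiv (K.fanMap c i x) =
      (c 0 + x.1 * (K.polygon i 0 - c 0 + x.2 * (K.polygon (finRotate n i) 0 - K.polygon i 0)),
        c 1 + x.1 * (K.polygon i 1 - c 1 +
          x.2 * (K.polygon (finRotate n i) 1 - K.polygon i 1))) := by
  rw [planeEquiv_apply, fanMap, edgePath_apply]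
  simp only [PiLp.add_apply, PiLp.smul_apply, PiLp.sub_apply, smul_eq_mul, Prod.mk.injEq]
  constructor <;> ring

namespace StarBall

variable {c : Plane} {r : ℝ} (h : K.StarBall c r)

include h

/-- The cross product of the image, seen from c, with the edge direction is s times `edgeDet`, which
determines s. The cross product with the vector from c to the initial vertex then determines t. -/
lemma injOn_fanMap (i : Fin n) {σ : ℝ} (hσ : σ ≤ 1) :
    InjOn (fun x => planeEquiv (K.fanMap c i x)) (Ioo (1 - σ) 1 ×ˢ Icc (0 : ℝ) 1) := by
  rintro ⟨s, t⟩ ⟨hs, -⟩ ⟨s', t'⟩ - e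
  have hJ := h.edgeDet_ne_zero i
  simp only [planeEquiv_fanMap, Prod.mk.injEq, add_right_inj] at e
  obtain ⟨e0, e1⟩ := e
  unfold edgeDet at hJ
  set p := K.polygon i 0 - c 0
  set p' := K.polygon i 1 - c 1
  set d := K.polygon (finRotate n i) 0 - K.polygon i 0
  set d' := K.polygon (finRotate n i) 1 - K.polygon i 1
  have h1 : s = s' := by
    refine sub_eq_zero.1 ((mul_eq_zero.1 ?_).resolve_right hJ)
    linear_combination d' * e0 - d * e1
  subst h1
  have hs0 : s ≠ 0 := by
    have := hs.1
    dsimp only at this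
    linarith
  have h2 : t = t' := by
    refine sub_eq_zero.1 ((mul_eq_zero.1 ?_).resolve_right (mul_ne_zero hs0 hJ))
    linear_combination p * e1 - p' * e0
  rw [h2]

/-- Change of variables; the Jacobian determinant of the fan map is s times `edgeDet` up to sign. -/
lemma lintegral_layer (i : Fin n) {σ : ℝ} (hσ : σ ≤ 1) {F : Plane → ENNReal} (hF : Measurable F) :
    ∫⁻ x in K.layer c i σ, F x = ∫⁻ t in Icc (0 : ℝ) 1, ∫⁻ s in Ioo (1 - σ) 1,
      ENNReal.ofReal (s * |edgeDet K c i|) * F (K.fanMap c i (s, t)) := by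
  set S : Set (ℝ × ℝ) := Ioo (1 - σ) 1 ×ˢ Icc (0 : ℝ) 1
  have hS : MeasurableSet S := measurableSet_Ioo.prod measurableSet_Icc
  have e1 := measurePreserving_planeEquiv.symm.setLIntegral_comp_preimage_emb
    planeEquiv.symm.measurableEmbedding F (K.layer c i σ)
  have e2 : planeEquiv.symm ⁻¹' (K.layer c i σ) =
      (fun x => planeEquiv (K.fanMap c i x)) '' S := by
    rw [← MeasurableEquiv.image_eq_preimage_symm, layer, image_image]
  set p := K.polygon i 0 - c 0 with hp
  set p' := K.polygon i 1 - c 1 with hp'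
  set d := K.polygon (finRotate n i) 0 - K.polygon i 0 with hd
  set d' := K.polygon (finRotate n i) 1 - K.polygon i 1 with hd'
  have hder : ∀ x ∈ S, HasFDerivWithinAt (fun x => planeEquiv (K.fanMap c i x))
      (LinearMap.toContinuousLinearMap
        ((Matrix.toLin (Module.Basis.finTwoProd ℝ) (Module.Basis.finTwoProd ℝ))
          !![p + x.2 * d, x.1 * d; p' + x.2 * d', x.1 * d'])) S x := by
    intro x _
    refine HasFDerivAt.hasFDerivWithinAt ?_
    rw [Matrix.toLin_finTwoProd_toContinuousLinearMap]
    simp only [planeEquiv_fanMap, ← hp, ← hp', ← hd, ← hd']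
    have hfst : HasFDerivAt (fun y : ℝ × ℝ => y.1) (ContinuousLinearMap.fst ℝ ℝ ℝ) x :=
      hasFDerivAt_fst
    have hsnd : HasFDerivAt (fun y : ℝ × ℝ => y.2) (ContinuousLinearMap.snd ℝ ℝ ℝ) x :=
      hasFDerivAt_snd
    refine HasFDerivAt.prodMk ?_ ?_
    · refine ((hfst.mul ((hsnd.mul_const d).const_add p)).const_add (c 0)).congr_fderiv ?_
      ext <;> simp
    · refine ((hfst.mul ((hsnd.mul_const d').const_add p')).const_add (c 1)).congr_fderiv ?_
      ext <;> simp
  rw [← e1, e2, lintegral_image_eq_lintegral_abs_det_fderiv_mul volume hS hder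
    (h.injOn_fanMap i hσ)]
  have e3 : ∀ x : ℝ × ℝ, x ∈ S →
      ENNReal.ofReal |(LinearMap.toContinuousLinearMap
        ((Matrix.toLin (Module.Basis.finTwoProd ℝ) (Module.Basis.finTwoProd ℝ))
          !![p + x.2 * d, x.1 * d; p' + x.2 * d', x.1 * d'])).det| *
        F (planeEquiv.symm (planeEquiv (K.fanMap c i x))) =
      ENNReal.ofReal (x.1 * |edgeDet K c i|) * F (K.fanMap c i x) := by
    intro x hx
    rw [MeasurableEquiv.symm_apply_apply]
    congr 2
    rw [LinearMap.det_toContinuousLinearMap, LinearMap.det_toLin, Matrix.det_fin_two_of]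
    have hx0 : 0 ≤ x.1 := by
      have := hx.1.1
      linarith
    rw [← abs_of_nonneg hx0, ← abs_mul, abs_of_nonneg hx0]
    congr 1
    unfold edgeDet
    ring
  rw [setLIntegral_congr_fun hS e3, Measure.volume_eq_prod, setLIntegral_prod_symm]
  refine Measurable.aemeasurable ?_
  exact (ENNReal.measurable_ofReal.comp (measurable_fst.mul_const _)).mul
    (hF.comp (continuous_fanMap c i).measurable)

lemma lintegral_layer_le (i : Fin n) {σ : ℝ} (hσ : σ ≤ 1) {F : Plane → ENNReal}
    (hF : Measurable F) :
    ∫⁻ x in K.layer c i σ, F x ≤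
      ENNReal.ofReal |edgeDet K c i| * K.layerIntegral c i σ F := by
  rw [h.lintegral_layer i hσ hF, layerIntegral, ← lintegral_const_mul' _ _ ENNReal.ofReal_ne_top]
  refine lintegral_mono fun t => ?_
  dsimp only
  rw [← lintegral_const_mul' _ _ ENNReal.ofReal_ne_top]
  refine setLIntegral_mono' measurableSet_Ioo fun s hs => ?_
  gcongr
  exact mul_le_of_le_one_left (abs_nonneg _) hs.2.le

/-- For σ ≤ 1/2 all s in the layer exceed 1/2, so the Jacobian is at least |`edgeDet`|/2. -/
lemma layerIntegral_le (i : Fin n) {σ : ℝ} (hσ : σ ≤ 1 / 2) {F : Plane → ENNReal}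
    (hF : Measurable F) :
    K.layerIntegral c i σ F ≤
      ENNReal.ofReal (2 * |edgeDet K c i|⁻¹) * ∫⁻ x in K.layer c i σ, F x := by
  have hJ := abs_pos.2 (h.edgeDet_ne_zero i)
  rw [h.lintegral_layer i (by linarith) hF, layerIntegral,
    ← lintegral_const_mul' _ _ ENNReal.ofReal_ne_top]
  refine lintegral_mono fun t => ?_
  dsimp only
  rw [← lintegral_const_mul' _ _ ENNReal.ofReal_ne_top]
  refine setLIntegral_mono' measurableSet_Ioo fun s hs => ?_
  rw [← mul_assoc, ← ENNReal.ofReal_mul (by positivity)]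
  refine le_mul_of_one_le_left zero_le ?_
  rw [ENNReal.one_le_ofReal]
  have h1 : 2 * |edgeDet K c i|⁻¹ * (s * |edgeDet K c i|) = 2 * s := by
    field_simp
  rw [h1]
  have := hs.1
  linarith

lemma layer_subset (i : Fin n) {σ : ℝ} (hσ : σ ≤ 1) : K.layer c i σ ⊆ K.carrier := by
  rintro _ ⟨⟨s, t⟩, ⟨hs, ht⟩, rfl⟩
  have := hs.1
  dsimp only at this
  exact h.segment_mem (frontier_subset_closure (edgePath_mem_frontier i ht)) (by linarith) hs.2

omit h in
lemma exists_bound (K : PolygonalElement n) (c : Plane) :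
    ∃ R : ℝ, ∀ i, ∀ t ∈ Icc (0 : ℝ) 1, ‖K.polygon.edgePath ℝ i t - c‖ ≤ R := by
  obtain ⟨R, hR⟩ := K.isBounded.closure.subset_closedBall c
  refine ⟨R, fun i t ht => ?_⟩
  rw [← dist_eq_norm]
  exact hR (frontier_subset_closure (edgePath_mem_frontier i ht))

omit h in
lemma ray_le {R : ℝ} (hR : ∀ i, ∀ t ∈ Icc (0 : ℝ) 1, ‖K.polygon.edgePath ℝ i t - c‖ ≤ R)
    {u : Plane → ℝ} (hu : ContDiff ℝ ∞ u) (i : Fin n) {t : ℝ} (ht : t ∈ Icc (0 : ℝ) 1)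
    {a s s' : ℝ} (hs : s ∈ Icc a 1) (hs' : s' ∈ Icc a 1) :
    ‖u (K.fanMap c i (s, t))‖ₑ ^ 2 ≤ 2 * ‖u (K.fanMap c i (s', t))‖ₑ ^ 2 +
      2 * (ENNReal.ofReal (1 - a) * (ENNReal.ofReal (R ^ 2) *
        ∫⁻ x in Ioo a 1, gradSq u (K.fanMap c i (x, t)))) := by
  set w := K.polygon.edgePath ℝ i t - c
  have hd : ∀ x : ℝ, HasDerivAt (fun x => u (K.fanMap c i (x, t)))
      (fderiv ℝ u (K.fanMap c i (x, t)) w) x := fun x => by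
    have h1 : HasDerivAt (fun x : ℝ => K.fanMap c i (x, t)) w x := by
      simpa [fanMap] using ((hasDerivAt_id x).smul_const w).const_add c
    exact ((hu.differentiable (by simp) _).hasFDerivAt).comp_hasDerivAt x h1
  have hc : Continuous fun x : ℝ => fderiv ℝ u (K.fanMap c i (x, t)) w :=
    ((hu.continuous_fderiv (by simp)).comp ((continuous_fanMap c i).comp
      (continuous_id.prodMk continuous_const))).clm_apply continuous_const
  refine (enorm_sq_le_of_ray hd hc hs hs').trans ?_
  gcongr
  rw [← lintegral_const_mul' _ _ ENNReal.ofReal_ne_top]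
  exact lintegral_mono fun x => enorm_fderiv_apply_sq_le _ _ (hR i t ht)

omit h in
lemma measurable_fan_integral {F : Plane → ENNReal} (hF : Measurable F) (i : Fin n) (a : ℝ) :
    Measurable fun t => ∫⁻ x in Ioo a 1, F (K.fanMap c i (x, t)) :=
  Measurable.lintegral_prod_left' (hF.comp (continuous_fanMap c i).measurable)

omit h in
lemma measurable_fan_edge {F : Plane → ENNReal} (hF : Measurable F) (i : Fin n) (s : ℝ) :
    Measurable fun t => F (K.fanMap c i (s, t)) :=
  hF.comp ((continuous_fanMap c i).comp (continuous_const.prodMk continuous_id)).measurable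

omit h in
-- Each ray is followed inward from its boundary point s = 1, and the estimate is integrated over
-- the layer of width σ.
lemma layerIntegral_sq_le {R : ℝ}
    (hR : ∀ i, ∀ t ∈ Icc (0 : ℝ) 1, ‖K.polygon.edgePath ℝ i t - c‖ ≤ R)
    {u : Plane → ℝ} (hu : ContDiff ℝ ∞ u) (i : Fin n) {σ : ℝ} (hσ0 : 0 ≤ σ) :
    K.layerIntegral c i σ (fun x => ‖u x‖ₑ ^ 2) ≤ ENNReal.ofReal σ *
      (2 * ∫⁻ t in Icc (0 : ℝ) 1, ‖u (K.polygon.edgePath ℝ i t)‖ₑ ^ 2) + ENNReal.ofReal σ *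
        (2 * (ENNReal.ofReal σ * (ENNReal.ofReal (R ^ 2) *
          K.layerIntegral c i σ (gradSq u)))) := by
  have hm : Measurable fun x => ‖u x‖ₑ ^ 2 := hu.continuous.measurable.enorm.pow_const 2
  have hm1 := measurable_fan_edge (K := K) (c := c) hm i 1
  simp only [fanMap_one] at hm1
  have hm2 := measurable_fan_integral (K := K) (c := c) (measurable_gradSq hu) i (1 - σ)
  unfold layerIntegral
  rw [← lintegral_const_mul' _ _ ENNReal.ofReal_ne_top,
    ← lintegral_const_mul' _ _ ENNReal.ofReal_ne_top,
    ← lintegral_const_mul' _ _ (by simp : (2 : ENNReal) ≠ ⊤), ← mul_add,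
    ← lintegral_const_mul' _ _ (by simp : (2 : ENNReal) ≠ ⊤), ← lintegral_add_left
    (hm1.const_mul 2), ← lintegral_const_mul' _ _ ENNReal.ofReal_ne_top]
  refine setLIntegral_mono' measurableSet_Icc fun t ht => ?_
  have key : ∀ s ∈ Ioo (1 - σ) 1, ‖u (K.fanMap c i (s, t))‖ₑ ^ 2 ≤ _ := fun s hs =>
    ray_le hR hu i ht (a := 1 - σ) (s := s) (s' := 1) ⟨hs.1.le, hs.2.le⟩ ⟨by linarith, le_rfl⟩
  refine (setLIntegral_mono' measurableSet_Ioo key).trans ?_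
  rw [setLIntegral_const, Real.volume_Ioo, sub_sub_cancel, mul_comm, fanMap_one]

omit h in
-- The same rays are followed outward: the boundary value is estimated from every point of the
-- layer, and the estimates are averaged over s.
lemma edge_le_layerIntegral {R : ℝ}
    (hR : ∀ i, ∀ t ∈ Icc (0 : ℝ) 1, ‖K.polygon.edgePath ℝ i t - c‖ ≤ R)
    {u : Plane → ℝ} (hu : ContDiff ℝ ∞ u) (i : Fin n) {σ : ℝ} (hσ0 : 0 ≤ σ) :
    ENNReal.ofReal σ * ∫⁻ t in Icc (0 : ℝ) 1, ‖u (K.polygon.edgePath ℝ i t)‖ₑ ^ 2 ≤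
      2 * K.layerIntegral c i σ (fun x => ‖u x‖ₑ ^ 2) + ENNReal.ofReal σ *
        (2 * (ENNReal.ofReal σ * (ENNReal.ofReal (R ^ 2) *
          K.layerIntegral c i σ (gradSq u)))) := by
  have hm : Measurable fun x => ‖u x‖ₑ ^ 2 := hu.continuous.measurable.enorm.pow_const 2
  have hm1 := measurable_fan_integral (K := K) (c := c) hm i (1 - σ)
  unfold layerIntegral
  rw [← lintegral_const_mul' _ _ ENNReal.ofReal_ne_top,
    ← lintegral_const_mul' _ _ ENNReal.ofReal_ne_top,
    ← lintegral_const_mul' _ _ ENNReal.ofReal_ne_top,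
    ← lintegral_const_mul' _ _ (by simp : (2 : ENNReal) ≠ ⊤),
    ← lintegral_const_mul' _ _ (by simp : (2 : ENNReal) ≠ ⊤),
    ← lintegral_const_mul' _ _ ENNReal.ofReal_ne_top, ← lintegral_add_left (hm1.const_mul 2)]
  refine setLIntegral_mono' measurableSet_Icc fun t ht => ?_
  have key : ∀ s ∈ Ioo (1 - σ) 1, ‖u (K.fanMap c i (1, t))‖ₑ ^ 2 ≤ _ := fun s hs =>
    ray_le hR hu i ht (a := 1 - σ) (s := 1) (s' := s) ⟨by linarith, le_rfl⟩ ⟨hs.1.le, hs.2.le⟩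
  have := setLIntegral_mono' (μ := volume) measurableSet_Ioo key
  rw [lintegral_add_right _ measurable_const, setLIntegral_const, setLIntegral_const,
    Real.volume_Ioo, sub_sub_cancel, fanMap_one,
    lintegral_const_mul' _ _ (by simp : (2 : ENNReal) ≠ ⊤)] at this
  rw [mul_comm (ENNReal.ofReal σ), mul_comm (ENNReal.ofReal σ) (2 * _)]
  exact this

end StarBall

end PolygonalElement

namespace PolygonalElement

variable {n : ℕ} {K : PolygonalElement n}

/-! ### Trace and boundary layer inequalities -/

/-- The square of the `L²` norm of `u` on the `i`-th edge, parametrized by the unit interval. -/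
def edgeSq (K : PolygonalElement n) (i : Fin n) (u : Plane → ℝ) : ENNReal :=
  ∫⁻ t in Icc (0 : ℝ) 1, ‖u (K.polygon.edgePath ℝ i t)‖ₑ ^ 2

/-- The boundary layer of relative width `σ`. -/
def strip (K : PolygonalElement n) (c : Plane) (σ : ℝ) : Set Plane := ⋃ i, K.layer c i σ

lemma layer_subset_strip (c : Plane) (i : Fin n) (σ : ℝ) : K.layer c i σ ⊆ K.strip c σ :=
  subset_iUnion (fun i => K.layer c i σ) i

lemma lintegral_strip_le (c : Plane) (σ : ℝ) (F : Plane → ENNReal) :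
    ∫⁻ x in K.strip c σ, F x ≤ ∑ i, ∫⁻ x in K.layer c i σ, F x := by
  refine (lintegral_iUnion_le _ _).trans (le_of_eq ?_)
  rw [tsum_fintype]

namespace StarBall

variable {c : Plane} {r : ℝ} (h : K.StarBall c r)

include h

/-- The trace inequality, from the layers with σ = 1/2. It makes the restriction of smooth functions
to the edges continuous for the H¹ norm. -/
lemma exists_edgeSq_le : ∃ C : NNReal, ∀ i, ∀ u, ContDiff ℝ ∞ u →
    K.edgeSq i u ≤ C * (∫⁻ x, ‖u x‖ₑ ^ 2 ∂K.vol + ∫⁻ x, gradSq u x ∂K.vol) := by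
  obtain ⟨R, hR⟩ := exists_bound K c
  have hone : ∀ i, ∃ C : NNReal, ∀ u, ContDiff ℝ ∞ u →
      K.edgeSq i u ≤ C * (∫⁻ x, ‖u x‖ₑ ^ 2 ∂K.vol + ∫⁻ x, gradSq u x ∂K.vol) := by
    intro i
    set J := ENNReal.ofReal (2 * |edgeDet K c i|⁻¹)
    refine ⟨(2 * (2 * J) + ENNReal.ofReal (R ^ 2) * J).toNNReal, fun u hu => ?_⟩
    rw [ENNReal.coe_toNNReal (by simp [J, ENNReal.mul_eq_top])]
    have hm : Measurable fun x => ‖u x‖ₑ ^ 2 := hu.continuous.measurable.enorm.pow_const 2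
    have h1 := edge_le_layerIntegral hR hu i (σ := 1 / 2) (by norm_num)
    have h2 := (h.layerIntegral_le i le_rfl hm).trans
      (mul_le_mul_right (lintegral_mono_set (h.layer_subset i (by norm_num))) J)
    have h3 := (h.layerIntegral_le i le_rfl (measurable_gradSq hu)).trans
      (mul_le_mul_right (lintegral_mono_set (h.layer_subset i (by norm_num))) J)
    have hhalf : (2 : ENNReal) * ENNReal.ofReal (1 / 2) = 1 := by
      rw [← ENNReal.ofReal_ofNat 2, ← ENNReal.ofReal_mul zero_le_two]
      norm_num
    set U := ∫⁻ x, ‖u x‖ₑ ^ 2 ∂K.vol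
    set D := ∫⁻ x, gradSq u x ∂K.vol
    set s := ENNReal.ofReal (1 / 2)
    calc K.edgeSq i u = 2 * (s * K.edgeSq i u) := by rw [← mul_assoc, hhalf, one_mul]
      _ ≤ 2 * (2 * (J * U) + s * (2 * (s * (ENNReal.ofReal (R ^ 2) * (J * D))))) := by
        refine mul_le_mul_right (h1.trans ?_) 2
        gcongr
      _ = 2 * (2 * J) * U + (2 * s) * (2 * s) * (ENNReal.ofReal (R ^ 2) * J) * D := by ring
      _ = 2 * (2 * J) * U + ENNReal.ofReal (R ^ 2) * J * D := by rw [hhalf, one_mul, one_mul]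
      _ ≤ _ := by
        rw [mul_add]
        gcongr
        · exact le_self_add
        · exact le_add_self
  choose C hC using hone
  refine ⟨∑ i, C i, fun i u hu => (hC i u hu).trans ?_⟩
  gcongr
  exact Finset.single_le_sum (fun _ _ => zero_le) (Finset.mem_univ i)

/-- The constant does not depend on σ. The factor σ² in front of the gradient is decisive: it
compensates the squared gradient of a cutoff function that varies over the width σ. -/
lemma exists_layer_le : ∃ C : NNReal, ∀ i, ∀ u, ContDiff ℝ ∞ u → ∀ σ, 0 ≤ σ → σ ≤ 1 / 2 →
    ∫⁻ x in K.layer c i σ, ‖u x‖ₑ ^ 2 ≤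
      C * (ENNReal.ofReal σ * K.edgeSq i u +
        ENNReal.ofReal σ ^ 2 * ∫⁻ x in K.layer c i σ, gradSq u x) := by
  obtain ⟨R, hR⟩ := exists_bound K c
  have hone : ∀ i, ∃ C : NNReal, ∀ u, ContDiff ℝ ∞ u → ∀ σ, 0 ≤ σ → σ ≤ 1 / 2 →
      ∫⁻ x in K.layer c i σ, ‖u x‖ₑ ^ 2 ≤
        C * (ENNReal.ofReal σ * K.edgeSq i u +
          ENNReal.ofReal σ ^ 2 * ∫⁻ x in K.layer c i σ, gradSq u x) := by
    intro i
    set J := ENNReal.ofReal (2 * |edgeDet K c i|⁻¹)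
    set J' := ENNReal.ofReal |edgeDet K c i|
    refine ⟨(J' * 2 + J' * 2 * (ENNReal.ofReal (R ^ 2) * J)).toNNReal, fun u hu σ h0 h1 => ?_⟩
    rw [ENNReal.coe_toNNReal (by simp [J, J', ENNReal.mul_eq_top])]
    have hm : Measurable fun x => ‖u x‖ₑ ^ 2 := hu.continuous.measurable.enorm.pow_const 2
    have e1 := h.lintegral_layer_le i (by linarith : σ ≤ 1) hm
    have e2 := layerIntegral_sq_le hR hu i h0
    have e3 := h.layerIntegral_le i h1 (measurable_gradSq hu)
    set D := ∫⁻ x in K.layer c i σ, gradSq u x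
    set s := ENNReal.ofReal σ
    calc _ ≤ J' * (s * (2 * K.edgeSq i u) +
          s * (2 * (s * (ENNReal.ofReal (R ^ 2) * (J * D))))) := by
          refine e1.trans (mul_le_mul_right (e2.trans ?_) _)
          unfold edgeSq
          gcongr
      _ = J' * 2 * (s * K.edgeSq i u) +
          J' * 2 * (ENNReal.ofReal (R ^ 2) * J) * (s ^ 2 * D) := by ring
      _ ≤ _ := by
        rw [mul_add]
        gcongr
        · exact le_self_add
        · exact le_add_self
  choose C hC using hone
  refine ⟨∑ i, C i, fun i u hu σ h0 h1 => (hC i u hu σ h0 h1).trans ?_⟩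
  gcongr
  exact Finset.single_le_sum (fun _ _ => zero_le) (Finset.mem_univ i)

lemma volume_strip_le {σ : ℝ} (hσ : σ ≤ 1) :
    volume (K.strip c σ) ≤ (∑ i, ENNReal.ofReal |edgeDet K c i|) * ENNReal.ofReal σ := by
  rw [← setLIntegral_one]
  refine (lintegral_strip_le c σ _).trans ?_
  rw [Finset.sum_mul]
  refine Finset.sum_le_sum fun i _ => ?_
  refine (h.lintegral_layer_le i hσ measurable_const).trans (le_of_eq ?_)
  simp [layerIntegral]

/-- A point c + s(z - c) with z on the boundary has distance at least (1 - s)r from the complement,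
so here 1 - s ≤ 3σ/4 < σ. The threshold is the one of `exists_cutoff` with δ = σr/4. -/
lemma mem_strip {σ : ℝ} (hσ0 : 0 < σ) (hσ : σ ≤ 1 / 2) {x : Plane} (hx : x ∈ K.carrier)
    (hd : Metric.infDist x K.carrierᶜ ≤ 3 * (σ * r / 4)) : x ∈ K.strip c σ := by
  have hr := h.pos
  have hσr : σ * r ≤ 1 / 2 * r := mul_le_mul_of_nonneg_right hσ hr.le
  have hσr' : 0 < σ * r := mul_pos hσ0 hr
  have hxc : x ≠ c := by
    rintro rfl
    have h1 := h.le_infDist (subset_closure hx) le_rfl zero_lt_one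
    rw [zero_smul, add_zero, sub_zero, one_mul] at h1
    linarith
  obtain ⟨i, t, ht, s, hs, e⟩ := exists_edgePath hx hxc
  have h1 := h.le_infDist (frontier_subset_closure (edgePath_mem_frontier i ht)) hs.1.le hs.2
  rw [e] at h1
  have h2 : 1 - s < σ := by
    by_contra hlt
    have := mul_le_mul_of_nonneg_right (not_lt.1 hlt) hr.le
    linarith
  exact mem_iUnion.2 ⟨i, (s, t), ⟨⟨by dsimp only; linarith, hs.2⟩, ht⟩, e⟩

omit h in
lemma lintegral_le_of_strip {F F₁ F₂ : Plane → ENNReal} {σ : ℝ} (h1 : AEMeasurable F₁ K.vol)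
    (hF : ∀ᵐ x ∂K.vol, F x ≤ F₁ x + (K.strip c σ).indicator F₂ x) :
    ∫⁻ x, F x ∂K.vol ≤ ∫⁻ x, F₁ x ∂K.vol + ∫⁻ x in K.strip c σ, F₂ x ∂K.vol := by
  refine (lintegral_mono_ae hF).trans ?_
  rw [lintegral_add_left' h1]
  exact add_le_add le_rfl (lintegral_indicator_le _ _)

omit h in
/-- The distance of a smooth function to a pair of a function and its gradient, plus the
contributions of the boundary and of the boundary layer. -/
def cutoffError (K : PolygonalElement n) (c : Plane) (σ : ℝ) (u : Plane → ℝ) (v : K.L2)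
    (G : Fin 2 → K.L2) : ENNReal :=
  ∫⁻ x, ‖u x - v x‖ₑ ^ 2 ∂K.vol + ∑ j, ∫⁻ x, ‖partialDeriv j u x - G j x‖ₑ ^ 2 ∂K.vol +
    ENNReal.ofReal σ⁻¹ * ∑ i, K.edgeSq i u +
    (∫⁻ x in K.strip c σ, ‖v x‖ₑ ^ 2 ∂K.vol +
      ∑ j, ∫⁻ x in K.strip c σ, ‖G j x‖ₑ ^ 2 ∂K.vol)

omit h in
lemma aemeasurable_sub_sq {f : Plane → ℝ} (hf : Continuous f) (v : K.L2) :
    AEMeasurable (fun x => ‖f x - v x‖ₑ ^ 2) K.vol :=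
  (hf.aestronglyMeasurable.sub (Lp.aestronglyMeasurable v)).enorm.pow_const 2

lemma lintegral_layer_gradSq_le {u : Plane → ℝ} (hu : ContDiff ℝ ∞ u) (v : K.L2)
    (G : Fin 2 → K.L2) (i : Fin n) {σ : ℝ} (hσ : σ ≤ 1) :
    ∫⁻ x in K.layer c i σ, gradSq u x ≤ 4 * cutoffError K c σ u v G := by
  have hsub := h.layer_subset i hσ
  have hvol : volume.restrict (K.layer c i σ) = K.vol.restrict (K.layer c i σ) := by
    rw [Measure.restrict_restrict_of_subset hsub]
  have hle : ∀ j, ∫⁻ x in K.layer c i σ, ‖partialDeriv j u x‖ₑ ^ 2 ≤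
      2 * ∫⁻ x, ‖partialDeriv j u x - G j x‖ₑ ^ 2 ∂K.vol +
        2 * ∫⁻ x in K.strip c σ, ‖G j x‖ₑ ^ 2 ∂K.vol := by
    intro j
    have hm := (aemeasurable_sub_sq (continuous_partialDeriv hu j) (G j)).mono_measure
      (Measure.restrict_le_self (s := K.layer c i σ))
    rw [hvol]
    calc _ ≤ ∫⁻ x in K.layer c i σ, 2 * ‖partialDeriv j u x - G j x‖ₑ ^ 2 + 2 * ‖G j x‖ₑ ^ 2
            ∂K.vol := lintegral_mono fun x => by
          simpa using enorm_add_sq_le (partialDeriv j u x - G j x) (G j x)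
      _ = 2 * ∫⁻ x in K.layer c i σ, ‖partialDeriv j u x - G j x‖ₑ ^ 2 ∂K.vol +
          2 * ∫⁻ x in K.layer c i σ, ‖G j x‖ₑ ^ 2 ∂K.vol := by
          rw [lintegral_add_left' (hm.const_mul 2), lintegral_const_mul' _ _ (by simp),
            lintegral_const_mul' _ _ (by simp)]
      _ ≤ _ := by
          gcongr
          · exact Measure.restrict_le_self
          · exact layer_subset_strip c i σ
  unfold gradSq
  rw [lintegral_finsetSum _ fun j _ =>
    ((continuous_partialDeriv hu j).measurable.enorm.pow_const 2)]
  refine (Finset.sum_le_sum fun j _ => hle j).trans ?_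
  rw [Finset.sum_add_distrib, ← Finset.mul_sum, ← Finset.mul_sum]
  unfold cutoffError
  set A := ∑ j, ∫⁻ x, ‖partialDeriv j u x - G j x‖ₑ ^ 2 ∂K.vol
  set B := ∑ j, ∫⁻ x in K.strip c σ, ‖G j x‖ₑ ^ 2 ∂K.vol
  rw [← mul_add]
  refine mul_le_mul' (by norm_num) (add_le_add ?_ le_add_self)
  rw [add_assoc]
  exact le_add_of_nonneg_of_le zero_le le_self_add

/-- Write ηu - v = η(u - v) + (η - 1)v and ∂(ηu) - G = η(∂u - G) + (η - 1)G + u∂η. The factors η - 1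
and ∂η vanish off the strip, where η = 1. The term u∂η, of size |u|/σ, is controlled by
`exists_layer_le`. -/
lemma exists_cutoff_estimate : ∃ C : NNReal, ∀ σ, 0 < σ → σ ≤ 1 / 2 →
    ∃ η, K.IsTest η ∧ ∀ u, ContDiff ℝ ∞ u → ∀ (v : K.L2) (G : Fin 2 → K.L2),
      ∫⁻ x, ‖η x * u x - v x‖ₑ ^ 2 ∂K.vol ≤ C * cutoffError K c σ u v G ∧
      ∀ j, ∫⁻ x, ‖partialDeriv j (fun y => η y * u y) x - G j x‖ₑ ^ 2 ∂K.vol ≤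
        C * cutoffError K c σ u v G := by
  obtain ⟨C, hC⟩ := h.exists_layer_le
  have hr := h.pos
  -- B bounds the integral of |u∂η|² in units of the error E: 16/r² is σ²/δ² for δ = σr/4, the
  -- summand 1 stands for the edge terms and 4n for the gradients on the n layers. The total for a
  -- derivative is 2E + 16E + 4BE, hence the constant 18 + 4B.
  set B : ENNReal := ENNReal.ofReal (16 / r ^ 2) * (C * (1 + n * 4))
  have hB : B ≠ ⊤ := by
    simp [B, ENNReal.mul_eq_top]
  refine ⟨(18 + 4 * B).toNNReal, fun σ hσ0 hσ => ?_⟩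
  rw [ENNReal.coe_toNNReal (by simp [ENNReal.mul_eq_top, hB])]
  have hδ : 0 < σ * r / 4 := by positivity
  obtain ⟨η, hη, hη1, hη2, hη3⟩ := exists_cutoff K hδ
  refine ⟨η, hη, fun u hu v G => ?_⟩
  set E := cutoffError K c σ u v G with hE
  have hoff : ∀ x ∈ K.carrier, x ∉ K.strip c σ → η x = 1 ∧ ∀ i, partialDeriv i η x = 0 :=
    fun x hx hxs => hη3 x (not_le.1 fun hle => hxs (h.mem_strip hσ0 hσ hx hle))
  have hmul1 : ∀ x a, ‖η x * a‖ₑ ^ 2 ≤ ‖a‖ₑ ^ 2 := fun x a => by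
    rw [enorm_sq_eq, enorm_sq_eq]
    refine ENNReal.ofReal_le_ofReal ?_
    rw [mul_pow]
    exact mul_le_of_le_one_left (sq_nonneg _) ((sq_le_one_iff_abs_le_one _).2 (hη1 x))
  have hmul2 : ∀ x a, ‖(η x - 1) * a‖ₑ ^ 2 ≤ 4 * ‖a‖ₑ ^ 2 := fun x a => by
    rw [enorm_sq_eq, enorm_sq_eq, ← ENNReal.ofReal_ofNat 4, ← ENNReal.ofReal_mul (by norm_num)]
    refine ENNReal.ofReal_le_ofReal ?_
    rw [mul_pow]
    have := abs_le.1 (hη1 x)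
    exact mul_le_mul_of_nonneg_right (by nlinarith) (sq_nonneg _)
  have hmul3 : ∀ j x a, ‖partialDeriv j η x * a‖ₑ ^ 2 ≤
      ENNReal.ofReal ((σ * r / 4)⁻¹ ^ 2) * ‖a‖ₑ ^ 2 := fun j x a => by
    rw [enorm_sq_eq, enorm_sq_eq, ← ENNReal.ofReal_mul (by positivity)]
    refine ENNReal.ofReal_le_ofReal ?_
    rw [mul_pow]
    refine mul_le_mul_of_nonneg_right ?_ (sq_nonneg _)
    exact sq_le_sq.2 ((hη2 j x).trans (le_abs_self _))
  have hEv : ∫⁻ x, ‖u x - v x‖ₑ ^ 2 ∂K.vol ≤ E := by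
    rw [hE]
    unfold cutoffError
    rw [add_assoc, add_assoc]
    exact le_self_add
  have hEg : ∀ j, ∫⁻ x, ‖partialDeriv j u x - G j x‖ₑ ^ 2 ∂K.vol ≤ E := fun j => by
    refine (Finset.single_le_sum (f := fun j =>
      ∫⁻ x, ‖partialDeriv j u x - G j x‖ₑ ^ 2 ∂K.vol) (fun _ _ => zero_le)
      (Finset.mem_univ j)).trans ?_
    rw [hE]
    unfold cutoffError
    rw [add_assoc, add_assoc]
    exact le_add_of_nonneg_of_le zero_le le_self_add
  have hEb : ENNReal.ofReal σ⁻¹ * ∑ i, K.edgeSq i u ≤ E := by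
    rw [hE]
    unfold cutoffError
    exact le_add_of_le_of_nonneg le_add_self zero_le
  have hEsv : ∫⁻ x in K.strip c σ, ‖v x‖ₑ ^ 2 ∂K.vol ≤ E := by
    rw [hE]
    unfold cutoffError
    exact le_add_of_nonneg_of_le zero_le le_self_add
  have hEsg : ∀ j, ∫⁻ x in K.strip c σ, ‖G j x‖ₑ ^ 2 ∂K.vol ≤ E := fun j => by
    refine (Finset.single_le_sum (f := fun j =>
      ∫⁻ x in K.strip c σ, ‖G j x‖ₑ ^ 2 ∂K.vol) (fun _ _ => zero_le)
      (Finset.mem_univ j)).trans ?_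
    rw [hE]
    unfold cutoffError
    exact le_add_of_nonneg_of_le zero_le le_add_self
  constructor
  · refine (lintegral_le_of_strip (c := c) (σ := σ) (F₁ := fun x => 2 * ‖u x - v x‖ₑ ^ 2)
      (F₂ := fun x => 8 * ‖v x‖ₑ ^ 2)
      ((aemeasurable_sub_sq hu.continuous v).const_mul 2) ?_).trans ?_
    · filter_upwards [ae_restrict_mem K.isOpen.measurableSet] with x hx
      have e : η x * u x - v x = η x * (u x - v x) + (η x - 1) * v x := by ring
      by_cases hxs : x ∈ K.strip c σ
      · rw [indicator_of_mem hxs, e]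
        refine (enorm_add_sq_le _ _).trans ?_
        rw [show (8 : ENNReal) = 2 * 4 by norm_num, mul_assoc]
        exact add_le_add (mul_le_mul_right (hmul1 _ _) 2) (mul_le_mul_right (hmul2 _ _) 2)
      · rw [indicator_of_notMem hxs, add_zero, (hoff x hx hxs).1, one_mul]
        exact le_mul_of_one_le_left zero_le (by norm_num)
    · rw [lintegral_const_mul' _ _ (by simp), lintegral_const_mul' _ _ (by simp)]
      calc _ ≤ 2 * E + 8 * E := by gcongr
        _ ≤ (18 + 4 * B) * E := by
          rw [← add_mul]
          exact mul_le_mul_left (le_add_of_le_of_nonneg (by norm_num) zero_le) E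
  · intro j
    have hu2 : ∫⁻ x in K.strip c σ, ENNReal.ofReal ((σ * r / 4)⁻¹ ^ 2) * ‖u x‖ₑ ^ 2 ∂K.vol ≤
        B * E := by
      rw [lintegral_const_mul' _ _ ENNReal.ofReal_ne_top]
      have e1 : ∫⁻ x in K.strip c σ, ‖u x‖ₑ ^ 2 ∂K.vol ≤
          ∑ i, C * (ENNReal.ofReal σ * K.edgeSq i u + ENNReal.ofReal σ ^ 2 * (4 * E)) := by
        refine (lintegral_mono' (Measure.restrict_mono_measure Measure.restrict_le_self _)
          le_rfl).trans ((lintegral_strip_le c σ _).trans (Finset.sum_le_sum fun i _ => ?_))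
        refine (hC i u hu σ hσ0.le hσ).trans ?_
        gcongr
        exact h.lintegral_layer_gradSq_le hu v G i (by linarith)
      refine (mul_le_mul_right e1 _).trans ?_
      rw [← Finset.mul_sum, Finset.sum_add_distrib, ← Finset.mul_sum, Finset.sum_const,
        Finset.card_univ, Fintype.card_fin, nsmul_eq_mul]
      have c1 : ENNReal.ofReal ((σ * r / 4)⁻¹ ^ 2) * ENNReal.ofReal σ =
          ENNReal.ofReal (16 / r ^ 2) * ENNReal.ofReal σ⁻¹ := by
        rw [← ENNReal.ofReal_mul (by positivity), ← ENNReal.ofReal_mul (by positivity)]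
        congr 1
        field_simp
        norm_num
      have c2 : ENNReal.ofReal ((σ * r / 4)⁻¹ ^ 2) * ENNReal.ofReal σ ^ 2 =
          ENNReal.ofReal (16 / r ^ 2) := by
        rw [← ENNReal.ofReal_pow hσ0.le, ← ENNReal.ofReal_mul (by positivity)]
        congr 1
        field_simp
        norm_num
      calc _ = C * (ENNReal.ofReal ((σ * r / 4)⁻¹ ^ 2) * ENNReal.ofReal σ * ∑ i, K.edgeSq i u +
            ENNReal.ofReal ((σ * r / 4)⁻¹ ^ 2) * ENNReal.ofReal σ ^ 2 * (n * (4 * E))) := by ring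
        _ = ENNReal.ofReal (16 / r ^ 2) * (C * (ENNReal.ofReal σ⁻¹ * ∑ i, K.edgeSq i u +
            n * 4 * E)) := by
          rw [c1, c2]
          ring
        _ ≤ ENNReal.ofReal (16 / r ^ 2) * (C * (E + n * 4 * E)) := by gcongr
        _ = B * E := by
          simp only [B]
          ring
    refine (lintegral_le_of_strip (c := c) (σ := σ)
      (F₁ := fun x => 2 * ‖partialDeriv j u x - G j x‖ₑ ^ 2)
      (F₂ := fun x => 16 * ‖G j x‖ₑ ^ 2 +
        4 * (ENNReal.ofReal ((σ * r / 4)⁻¹ ^ 2) * ‖u x‖ₑ ^ 2))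
      ((aemeasurable_sub_sq (continuous_partialDeriv hu j) (G j)).const_mul 2) ?_).trans ?_
    · filter_upwards [ae_restrict_mem K.isOpen.measurableSet] with x hx
      have e0 : partialDeriv j (fun y => η y * u y) x =
          η x * partialDeriv j u x + partialDeriv j η x * u x := by
        unfold partialDeriv
        rw [fderiv_fun_mul (hη.contDiff.differentiable (by simp) x)
          (hu.differentiable (by simp) x)]
        simp only [add_apply, smul_apply, smul_eq_mul]
        ring
      rw [e0]
      have e : η x * partialDeriv j u x + partialDeriv j η x * u x - G j x =
          η x * (partialDeriv j u x - G j x) +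
            ((η x - 1) * G j x + partialDeriv j η x * u x) := by ring
      by_cases hxs : x ∈ K.strip c σ
      · rw [indicator_of_mem hxs, e]
        refine (enorm_add_sq_le _ _).trans ?_
        refine add_le_add (mul_le_mul_right (hmul1 _ _) 2) ?_
        · refine (mul_le_mul_right (enorm_add_sq_le _ _) 2).trans ?_
          rw [mul_add, ← mul_assoc, ← mul_assoc, show (16 : ENNReal) = 2 * 2 * 4 by norm_num,
            show (4 : ENNReal) = 2 * 2 by norm_num, mul_assoc (2 * 2) (2 * 2)]
          gcongr
          · rw [show (2 : ENNReal) * 2 = 4 by norm_num]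
            exact hmul2 _ _
          · exact hmul3 _ _ _
      · rw [indicator_of_notMem hxs, add_zero, (hoff x hx hxs).1, (hoff x hx hxs).2 j, zero_mul,
          add_zero, one_mul]
        exact le_mul_of_one_le_left zero_le (by norm_num)
    · rw [lintegral_const_mul' _ _ (by simp), lintegral_add_right _
        (((hu.continuous.measurable.enorm.pow_const 2).const_mul _).const_mul _),
        lintegral_const_mul' _ _ (by simp), lintegral_const_mul' _ _ (by simp)]
      calc _ ≤ 2 * E + (16 * E + 4 * (B * E)) := by
            gcongr
            · exact hEg j
            · exact hEsg j
        _ = (18 + 4 * B) * E := by ring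

end StarBall

end PolygonalElement

namespace PolygonalElement

variable {n : ℕ} {K : PolygonalElement n}

/-! ### Functions with vanishing trace -/

lemma lintegral_sq_ne_top (v : K.L2) : ∫⁻ x, ‖v x‖ₑ ^ 2 ∂K.vol ≠ ⊤ := by
  rw [← eLpNorm_two_sq]
  exact ENNReal.pow_ne_top (Lp.eLpNorm_ne_top v)

lemma tendsto_zero_of_le {f : ℕ → ENNReal} {g : ℕ → ENNReal} (hg : Tendsto g atTop (𝓝 0))
    (h : ∀ m, f m ≤ g m) : Tendsto f atTop (𝓝 0) :=
  tendsto_of_tendsto_of_tendsto_of_le_of_le tendsto_const_nhds hg (fun _ => zero_le) h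

lemma HasTrace.congr {v : K.L2} {G : Fin 2 → K.L2} {g g' : Plane → ℝ} (h : K.HasTrace v G g)
    (e : ∀ i, ∀ t ∈ Icc (0 : ℝ) 1,
      g (K.polygon.edgePath ℝ i t) = g' (K.polygon.edgePath ℝ i t)) : K.HasTrace v G g' := by
  obtain ⟨u, hu, h1, h2, h3⟩ := h
  refine ⟨u, hu, h1, h2, fun i => (h3 i).congr fun m => eLpNorm_congr_ae ?_⟩
  filter_upwards [ae_restrict_mem measurableSet_Icc] with t ht
  rw [e i t ht]

lemma hasTrace_zero_of_mem_H10 {v : K.L2} {G : Fin 2 → K.L2}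
    (hz : (v, WithLp.toLp 2 G) ∈ K.H10) : K.HasTrace v G 0 := by
  obtain ⟨z, hz1, hz2⟩ := mem_closure_iff_seq_limit.1 hz
  choose φ hφ e using hz1
  refine hasTrace_iff.2 ⟨φ, fun m => (hφ m).contDiff, ?_, fun i => ?_⟩
  · exact hz2.congr e
  · refine tendsto_const_nhds.congr fun m => Eq.symm ?_
    rw [eLpNorm_congr_ae (g := 0), eLpNorm_zero]
    filter_upwards [ae_restrict_mem measurableSet_Icc] with t ht
    have hfr := edgePath_mem_frontier (K := K) i ht
    rw [frontier, K.isOpen.interior_eq] at hfr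
    simp [(hφ m).eq_zero hfr.2]

lemma isH1_zero_of_mem_H10 {v : K.L2} {G : Fin 2 → K.L2}
    (hz : (v, WithLp.toLp 2 G) ∈ K.H10) : K.IsH1 v G 0 :=
  ⟨(hasTrace_zero_of_mem_H10 hz).hasWeakGradient, continuousOn_const, hasTrace_zero_of_mem_H10 hz⟩

namespace StarBall

variable {c : Plane} {r : ℝ} (h : K.StarBall c r)

include h

lemma tendsto_edge_of_tendsto_smoothPair {u : ℕ → Plane → ℝ} (hu : ∀ m, ContDiff ℝ ∞ (u m))
    (hl : Tendsto (fun m => K.smoothPair (hu m)) atTop (𝓝 0)) (i : Fin n) :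
    Tendsto (fun m => eLpNorm (fun t => u m (K.polygon.edgePath ℝ i t)) 2
      (volume.restrict (Icc (0 : ℝ) 1))) atTop (𝓝 0) := by
  obtain ⟨C, hC⟩ := h.exists_edgeSq_le
  rw [tendsto_eLpNorm_two_iff]
  have h0 : ∀ᵐ x ∂K.vol, (0 : K.L2) x = 0 := Lp.coeFn_zero ℝ 2 K.vol
  obtain ⟨h1, h2⟩ := (tendsto_smoothPair_iff hu 0 (fun _ => 0)).1 hl
  rw [tendsto_eLpNorm_two_iff] at h1
  simp only [tendsto_eLpNorm_two_iff] at h2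
  have e1 : ∀ m, ∫⁻ x, ‖u m x - (0 : K.L2) x‖ₑ ^ 2 ∂K.vol = ∫⁻ x, ‖u m x‖ₑ ^ 2 ∂K.vol :=
    fun m => lintegral_congr_ae (by filter_upwards [h0] with x hx; rw [hx, sub_zero])
  have e2 : ∀ m, ∑ j, ∫⁻ x, ‖partialDeriv j (u m) x - (0 : K.L2) x‖ₑ ^ 2 ∂K.vol =
      ∫⁻ x, gradSq (u m) x ∂K.vol := fun m => by
    unfold gradSq
    rw [lintegral_finsetSum _ fun j _ =>
      ((continuous_partialDeriv (hu m) j).measurable.enorm.pow_const 2)]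
    exact Finset.sum_congr rfl fun j _ =>
      lintegral_congr_ae (by filter_upwards [h0] with x hx; rw [hx, sub_zero])
  have h3 := ENNReal.Tendsto.const_mul (h1.add (tendsto_finsetSum Finset.univ fun j _ => h2 j))
    (Or.inr (ENNReal.coe_ne_top (r := C)))
  rw [Finset.sum_const_zero, add_zero, mul_zero] at h3
  refine tendsto_zero_of_le h3 fun m => ?_
  rw [e1, e2]
  exact hC i (u m) (hu m)

/-- The difference of the two approximating sequences tends to 0 in H¹, hence on the edges by the
trace inequality. Continuity turns equality almost everywhere on an edge into equality everywhere.
-/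
lemma trace_unique {v : K.L2} {G : Fin 2 → K.L2} {g g' : Plane → ℝ} (h1 : K.IsH1 v G g)
    (h2 : K.IsH1 v G g') (i : Fin n) {t : ℝ} (ht : t ∈ Icc (0 : ℝ) 1) :
    g (K.polygon.edgePath ℝ i t) = g' (K.polygon.edgePath ℝ i t) := by
  obtain ⟨u, hu, hl, hb⟩ := hasTrace_iff.1 h1.hasTrace
  obtain ⟨u', hu', hl', hb'⟩ := hasTrace_iff.1 h2.hasTrace
  have hd : Tendsto (fun m => K.smoothPair ((hu m).add ((hu' m).const_smul (-1 : ℝ)))) atTop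
      (𝓝 0) := by
    have := hl.add (hl'.const_smul (-1 : ℝ))
    rw [neg_one_smul, add_neg_cancel] at this
    refine this.congr fun m => ?_
    rw [smoothPair_add (hu m) ((hu' m).const_smul (-1 : ℝ)), smoothPair_smul]
  have hb'' := h.tendsto_edge_of_tendsto_smoothPair _ hd i
  have hmg := (continuousOn_edge h1.continuousOn i).aestronglyMeasurable
    (μ := volume) measurableSet_Icc
  have hmg' := (continuousOn_edge h2.continuousOn i).aestronglyMeasurable
    (μ := volume) measurableSet_Icc
  have hmu : ∀ (w : ℕ → Plane → ℝ), (∀ m, ContDiff ℝ ∞ (w m)) → ∀ m,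
      AEStronglyMeasurable (fun t => w m (K.polygon.edgePath ℝ i t))
        (volume.restrict (Icc (0 : ℝ) 1)) := fun w hw m =>
    ((hw m).continuous.comp (continuous_edgePath i)).aestronglyMeasurable
  have hs := tendsto_eLpNorm_smul (μ := volume.restrict (Icc (0 : ℝ) 1)) (-1)
    (h := fun m t => -(u m (K.polygon.edgePath ℝ i t) - g (K.polygon.edgePath ℝ i t)))
    (fun m => ae_of_all _ fun t => (neg_one_mul _).symm) (hb i)
  have hsum := tendsto_eLpNorm_add (fun m => ((hmu u hu m).sub hmg).neg)
    (fun m => (hmu u' hu' m).sub hmg') (fun m => EventuallyEq.rfl) hs (hb' i)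
  -- g - g' = -(u - g) + (u' - g') + (u - u'), a sum of three terms that tend to 0, while the
  -- left-hand side does not depend on m.
  have htot := tendsto_eLpNorm_add
    (h := fun _ t => g (K.polygon.edgePath ℝ i t) - g' (K.polygon.edgePath ℝ i t))
    (fun m => ((hmu u hu m).sub hmg).neg.add ((hmu u' hu' m).sub hmg'))
    (hmu _ fun m => (hu m).add ((hu' m).const_smul (-1 : ℝ)))
    (fun m => ae_of_all _ fun t => by
      simp only [Pi.add_apply, Pi.sub_apply, Pi.neg_apply, smul_eq_mul]
      ring) hsum hb''
  have hz := (eLpNorm_eq_zero_iff (hmg.sub hmg') (by norm_num)).1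
    (tendsto_nhds_unique tendsto_const_nhds htot)
  have hae : (fun t => g (K.polygon.edgePath ℝ i t)) =ᵐ[volume.restrict (Icc (0 : ℝ) 1)]
      fun t => g' (K.polygon.edgePath ℝ i t) := by
    filter_upwards [hz] with t ht
    exact sub_eq_zero.1 ht
  exact Measure.eqOn_Icc_of_ae_eq volume zero_ne_one hae (continuousOn_edge h1.continuousOn i)
    (continuousOn_edge h2.continuousOn i) ht

lemma tendsto_strip {F : Plane → ENNReal} (hF : ∫⁻ x, F x ∂K.vol ≠ ⊤) {σ : ℕ → ℝ}
    (hσ : ∀ m, σ m ≤ 1) (hl : Tendsto σ atTop (𝓝 0)) :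
    Tendsto (fun m => ∫⁻ x in K.strip c (σ m), F x ∂K.vol) atTop (𝓝 0) := by
  refine tendsto_setLIntegral_zero hF ?_
  have h1 := ENNReal.Tendsto.const_mul (a := ∑ i, ENNReal.ofReal |edgeDet K c i|)
    (ENNReal.tendsto_ofReal hl) (Or.inr (by simp))
  rw [ENNReal.ofReal_zero, mul_zero] at h1
  exact tendsto_zero_of_le h1 fun m =>
    (Measure.restrict_le_self _).trans (h.volume_strip_le (hσ m))

/-- Cutoffs of smooth approximations of v are test functions. Their error tends to 0 because v and G
have little mass on thin strips and the boundary values of the approximations tend to 0. -/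
lemma mem_H10_of_trace_zero {v : K.L2} {G : Fin 2 → K.L2} (ht : K.HasTrace v G 0) :
    (v, WithLp.toLp 2 G) ∈ K.H10 := by
  obtain ⟨C, hC⟩ := h.exists_cutoff_estimate
  obtain ⟨u, hu, h1, h2, h3⟩ := ht
  rw [tendsto_eLpNorm_two_iff] at h1
  simp only [tendsto_eLpNorm_two_iff, Pi.zero_apply, sub_zero] at h2 h3
  let σ : ℕ → ℝ := fun m => 1 / 2 * (1 / ((m : ℝ) + 1))
  have hσ0 : ∀ m, 0 < σ m := fun m => by positivity
  have hσ1 : ∀ m, σ m ≤ 1 / 2 := fun m => by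
    refine mul_le_of_le_one_right (by norm_num) ?_
    rw [div_le_one (by positivity)]
    linarith [(Nat.cast_nonneg m : (0 : ℝ) ≤ m)]
  have hσl : Tendsto σ atTop (𝓝 0) := by
    have := (tendsto_one_div_add_atTop_nhds_zero_nat (𝕜 := ℝ)).const_mul (1 / 2)
    rwa [mul_zero] at this
  -- The width σ_j is fixed before the approximation is chosen, since the boundary term carries the
  -- factor 1/σ_j.
  have herr : ∀ j, ∃ m, ∫⁻ x, ‖u m x - v x‖ₑ ^ 2 ∂K.vol +
      ∑ k, ∫⁻ x, ‖partialDeriv k (u m) x - G k x‖ₑ ^ 2 ∂K.vol +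
      ENNReal.ofReal (σ j)⁻¹ * ∑ i, K.edgeSq i (u m) ≤ ENNReal.ofReal (σ j) := by
    intro j
    have h4 := (h1.add (tendsto_finsetSum Finset.univ fun k _ => h2 k)).add
      (ENNReal.Tendsto.const_mul (a := ENNReal.ofReal (σ j)⁻¹)
        (tendsto_finsetSum Finset.univ fun i _ => h3 i) (Or.inr ENNReal.ofReal_ne_top))
    simp only [Finset.sum_const_zero, add_zero, mul_zero] at h4
    exact (h4.eventually_le_const (ENNReal.ofReal_pos.2 (hσ0 j))).exists
  choose m hm using herr
  choose η hη hest using fun j => hC (σ j) (hσ0 j) (hσ1 j)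
  let w : ℕ → Plane → ℝ := fun j y => η j y * u (m j) y
  have hw : ∀ j, K.IsTest (w j) := fun j =>
    ⟨(hη j).contDiff.mul (hu (m j)), (hη j).hasCompactSupport.mul_right,
      (tsupport_mul_subset_left).trans (hη j).tsupport_subset⟩
  have hE : Tendsto (fun j => C * cutoffError K c (σ j) (u (m j)) v G) atTop (𝓝 0) := by
    have hs : ∀ z : K.L2, Tendsto (fun j => ∫⁻ x in K.strip c (σ j), ‖z x‖ₑ ^ 2 ∂K.vol) atTop
        (𝓝 0) := fun z => h.tendsto_strip (lintegral_sq_ne_top z)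
          (fun j => (hσ1 j).trans (by norm_num)) hσl
    have h5 := ((ENNReal.tendsto_ofReal hσl).add ((hs v).add
      (tendsto_finsetSum Finset.univ fun k _ => hs (G k))))
    have h6 := ENNReal.Tendsto.const_mul h5 (Or.inr (ENNReal.coe_ne_top (r := C)))
    simp only [Finset.sum_const_zero, add_zero, ENNReal.ofReal_zero, mul_zero] at h6
    refine tendsto_zero_of_le h6 fun j => ?_
    unfold cutoffError
    gcongr
    exact hm j
  have hlim : Tendsto (fun j => K.smoothPair (hw j).contDiff) atTop
      (𝓝 (v, WithLp.toLp 2 G)) := by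
    rw [tendsto_smoothPair_iff]
    simp only [tendsto_eLpNorm_two_iff]
    exact ⟨tendsto_zero_of_le hE fun j => (hest j _ (hu _) v G).1,
      fun k => tendsto_zero_of_le hE fun j => (hest j _ (hu _) v G).2 k⟩
  exact (Submodule.isClosed_topologicalClosure _).mem_of_tendsto hlim
    (Eventually.of_forall fun j => (hw j).smoothPair_mem_H10)

end StarBall

end PolygonalElement

namespace PolygonalElement

variable {n : ℕ} {K : PolygonalElement n}

/-! ### Polynomials as square integrable functions and vector fields -/

/-- Pairs of square integrable functions. -/
abbrev Field (K : PolygonalElement n) : Type := PiLp 2 (fun _ : Fin 2 => K.L2)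

/-- A polynomial as an element of `L²`. -/
def polyL2 (K : PolygonalElement n) : MvPolynomial (Fin 2) ℝ →ₗ[ℝ] K.L2 where
  toFun p := K.toL2 (continuous_polyFun p)
  map_add' p q := by
    refine (toL2_congr _ _ fun x _ => ?_).trans
      (toL2_add (continuous_polyFun p) (continuous_polyFun q))
    simp [polyFun]
  map_smul' a p := by
    refine (toL2_congr _ _ fun x _ => ?_).trans (toL2_smul a (continuous_polyFun p))
    simp [polyFun]

/-- A pair of polynomials as a vector field. -/
def polyField (K : PolygonalElement n) : (Fin 2 → MvPolynomial (Fin 2) ℝ) →ₗ[ℝ] K.Field :=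
  (WithLp.linearEquiv 2 ℝ (Fin 2 → K.L2)).symm.toLinearMap ∘ₗ K.polyL2.compLeft (Fin 2)

/-- The gradient of a polynomial. -/
def polyGrad (K : PolygonalElement n) : MvPolynomial (Fin 2) ℝ →ₗ[ℝ] K.Field :=
  K.polyField ∘ₗ LinearMap.pi fun i => (MvPolynomial.pderiv i).toLinearMap

lemma inner_polyL2 (v : K.L2) (p : MvPolynomial (Fin 2) ℝ) :
    inner ℝ v (K.polyL2 p) = ∫ x, v x * polyFun p x ∂K.vol :=
  inner_toL2 v (continuous_polyFun p)

lemma polyL2_eq_zero {p : MvPolynomial (Fin 2) ℝ} (hp : K.polyL2 p = 0) : p = 0 := by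
  refine eq_zero_of_eqOn_open K.isOpen K.isConnected.nonempty fun x hx => ?_
  have h1 : polyFun p =ᵐ[K.vol] fun _ => 0 := by
    filter_upwards [coeFn_toL2 (K := K) (continuous_polyFun p),
      (Lp.eq_zero_iff_ae_eq_zero).1 hp] with y h2 h3
    exact h2.symm.trans h3
  exact Measure.eqOn_open_of_ae_eq h1 K.isOpen (continuous_polyFun p).continuousOn
    continuousOn_const hx

lemma inner_polyField {z : K.Pair} (hz : z ∈ K.H10) (P : Fin 2 → MvPolynomial (Fin 2) ℝ) :
    inner ℝ (K.polyField P) z.2 = -inner ℝ (K.polyL2 (∑ i, MvPolynomial.pderiv i (P i))) z.1 := by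
  refine H10_induction (p := fun z => inner ℝ (K.polyField P) z.2 =
    -inner ℝ (K.polyL2 (∑ i, MvPolynomial.pderiv i (P i))) z.1)
    (isClosed_eq (by fun_prop) (by fun_prop)) (fun φ hφ => ?_) hz
  rw [PiLp.inner_apply, map_sum, sum_inner, ← Finset.sum_neg_distrib]
  refine Finset.sum_congr rfl fun i _ => ?_
  change inner ℝ (K.toL2 (continuous_polyFun (P i)))
    (K.toL2 (continuous_partialDeriv hφ.contDiff i)) =
    -inner ℝ (K.toL2 (continuous_polyFun (MvPolynomial.pderiv i (P i))))
      (K.toL2 hφ.contDiff.continuous)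
  rw [inner_toL2_toL2, inner_toL2_toL2, hφ.integral_mul_partialDeriv (contDiff_polyFun _)]
  simp only [partialDeriv_polyFun]

lemma inner_polyGrad {z : K.Pair} (hz : z ∈ K.H10) (p : MvPolynomial (Fin 2) ℝ) :
    inner ℝ (K.polyGrad p) z.2 =
      -inner ℝ (K.polyL2 (∑ i, MvPolynomial.pderiv i (MvPolynomial.pderiv i p))) z.1 :=
  inner_polyField hz _

/-- By density the weak equation may be tested with all of `H10`, in particular with the solution
itself when its trace vanishes. -/
lemma hasWeakLaplacian_iff {G : Fin 2 → K.L2} {p : MvPolynomial (Fin 2) ℝ} :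
    K.HasWeakLaplacian G (polyFun p) ↔ ∀ z ∈ K.H10,
      inner ℝ (WithLp.toLp 2 G) z.2 = -inner ℝ (K.polyL2 p) z.1 := by
  have key : ∀ φ, ∀ hφ : K.IsTest φ, (∑ i, ∫ x, G i x * partialDeriv i φ x ∂K.vol =
      -∫ x, polyFun p x * φ x ∂K.vol) ↔ inner ℝ (WithLp.toLp 2 G) (K.smoothPair hφ.contDiff).2 =
        -inner ℝ (K.polyL2 p) (K.smoothPair hφ.contDiff).1 := by
    intro φ hφ
    have e1 : inner ℝ (WithLp.toLp 2 G) (K.smoothPair hφ.contDiff).2 =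
        ∑ i, ∫ x, G i x * partialDeriv i φ x ∂K.vol := by
      rw [PiLp.inner_apply]
      exact Finset.sum_congr rfl fun i _ =>
        inner_toL2 (G i) (continuous_partialDeriv hφ.contDiff i)
    have e2 : inner ℝ (K.polyL2 p) (K.smoothPair hφ.contDiff).1 =
        ∫ x, polyFun p x * φ x ∂K.vol :=
      inner_toL2_toL2 (continuous_polyFun p) hφ.contDiff.continuous
    rw [e1, e2]
  constructor
  · intro h z hz
    exact H10_induction (p := fun z => inner ℝ (WithLp.toLp 2 G) z.2 = -inner ℝ (K.polyL2 p) z.1)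
      (isClosed_eq (by fun_prop) (by fun_prop)) (fun φ hφ => (key φ hφ).1 (h φ hφ)) hz
  · intro h φ hφ
    exact (key φ hφ).2 (h _ hφ.smoothPair_mem_H10)

/-! ### The Dirichlet problem -/

/-- The gradients of the functions with vanishing trace. -/
def gradients (K : PolygonalElement n) : Submodule ℝ K.Field :=
  K.H10.map (LinearMap.snd ℝ K.L2 K.Field)

/-- The Poincaré inequality bounds an element of `H10` by its gradient, so the range of the gradient
map on the complete space `H10` is closed. Orthogonal projection onto it then solves Dirichlet
problems. -/
lemma isClosed_gradients (K : PolygonalElement n) : IsClosed (K.gradients : Set K.Field) := by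
  obtain ⟨C, hC0, hC⟩ := K.exists_poincare
  have hcomplete : CompleteSpace K.H10 :=
    (Submodule.isClosed_topologicalClosure K.testPairs).completeSpace_coe
  let f : K.H10 →L[ℝ] K.Field := (ContinuousLinearMap.snd ℝ K.L2 K.Field).comp K.H10.subtypeL
  -- A pair has the maximum norm: C handles the function and 1 the gradient.
  have hf : AntilipschitzWith (max C.toNNReal 1) f := by
    refine f.antilipschitz_of_bound fun z => ?_
    have h1 := hC z z.2
    have h2 : ‖z‖ = max ‖(z : K.Pair).1‖ ‖(z : K.Pair).2‖ := rfl
    change _ ≤ _ * ‖(z : K.Pair).2‖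
    rw [h2, NNReal.coe_max, Real.coe_toNNReal C hC0, NNReal.coe_one]
    refine max_le (h1.trans ?_) ?_
    · exact mul_le_mul_of_nonneg_right (le_max_left _ _) (norm_nonneg _)
    · exact le_mul_of_one_le_left (norm_nonneg _) (le_max_right _ _)
  have e : (K.gradients : Set K.Field) = range f := by
    ext y
    constructor
    · rintro ⟨z, hz, rfl⟩
      exact ⟨⟨z, hz⟩, rfl⟩
    · rintro ⟨z, rfl⟩
      exact ⟨z, z.2, rfl⟩
  rw [e]
  exact hf.isClosed_range f.uniformContinuous

instance completeSpace_gradients (K : PolygonalElement n) : CompleteSpace K.gradients :=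
  K.isClosed_gradients.completeSpace_coe

/-- Testing the equation with v itself gives ‖G‖² = -∫ p v = 0, and the Poincaré inequality
finishes. -/
lemma eq_zero_of_hasWeakLaplacian {v : K.L2} {G : Fin 2 → K.L2} {p : MvPolynomial (Fin 2) ℝ}
    (hz : (v, WithLp.toLp 2 G) ∈ K.H10) (hl : K.HasWeakLaplacian G (polyFun p))
    (hp : inner ℝ v (K.polyL2 p) = 0) : v = 0 := by
  have h1 := hasWeakLaplacian_iff.1 hl _ hz
  dsimp only at h1
  rw [real_inner_comm v (K.polyL2 p), hp, neg_zero, inner_self_eq_zero] at h1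
  obtain ⟨C, -, hC⟩ := K.exists_poincare
  have h2 := hC _ hz
  dsimp only at h2
  rw [h1, norm_zero, mul_zero] at h2
  exact norm_le_zero_iff.1 h2

/-- With P the orthogonal projection, ⟨P F p, F q⟩ = ⟨P F p, P F q⟩ is positive definite on V,
because P F is injective by hypothesis. -/
lemma exists_inner_starProjection_eq {Y V : Type*} [NormedAddCommGroup Y] [InnerProductSpace ℝ Y]
    [AddCommGroup V] [Module ℝ V] [FiniteDimensional ℝ V] (D : Submodule ℝ Y)
    [D.HasOrthogonalProjection] (F : V →ₗ[ℝ] Y) (hF : ∀ p, D.starProjection (F p) = 0 → p = 0)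
    (m : Module.Dual ℝ V) : ∃ p, ∀ q, inner ℝ (D.starProjection (F p)) (F q) = m q := by
  let T : V →ₗ[ℝ] Module.Dual ℝ V :=
    (innerₗ Y).compl₁₂ (D.starProjection.toLinearMap ∘ₗ F) F
  have hTa : ∀ p q, T p q = inner ℝ (D.starProjection (F p)) (F q) := fun _ _ => rfl
  have hT : Function.Injective T := by
    rw [← LinearMap.ker_eq_bot, LinearMap.ker_eq_bot']
    intro p hp
    have h1 : inner ℝ (D.starProjection (F p)) (F p) = 0 := by
      rw [← hTa, hp, LinearMap.zero_apply]
    refine hF p ?_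
    have h2 := D.starProjection_inner_eq_zero (F p) _ (D.starProjection_apply_mem (F p))
    rw [inner_sub_left, sub_eq_zero, real_inner_comm, h1] at h2
    exact inner_self_eq_zero.1 h2.symm
  obtain ⟨p, hp⟩ := (bijective_of_injective_dual T hT).2 m
  exact ⟨p, fun q => (hTa p q).symm.trans (LinearMap.congr_fun hp q)⟩

/-- F p = (A p, 0) has divergence p. Its projection onto `gradients` is the gradient of the
zero-trace solution of Δw = p. -/
lemma exists_field (K : PolygonalElement n) :
    ∃ F : MvPolynomial (Fin 2) ℝ →ₗ[ℝ] K.Field,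
      ∀ p, ∀ z ∈ K.H10, inner ℝ (F p) z.2 = -inner ℝ (K.polyL2 p) z.1 := by
  obtain ⟨A, hA⟩ := exists_linearMap_pderiv_eq
  refine ⟨K.polyField ∘ₗ LinearMap.single ℝ (fun _ : Fin 2 => MvPolynomial (Fin 2) ℝ) 0 ∘ₗ A,
    fun p z hz => ?_⟩
  refine (inner_polyField hz _).trans ?_
  rw [Fin.sum_univ_two]
  simp [hA]

lemma inner_starProjection_gradients (y : K.Field) {z : K.Pair} (hz : z ∈ K.H10) :
    inner ℝ (K.gradients.starProjection y) z.2 = inner ℝ y z.2 := by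
  have := K.gradients.starProjection_inner_eq_zero y z.2 ⟨z, hz, rfl⟩
  rw [inner_sub_left, sub_eq_zero] at this
  exact this.symm

lemma exists_mem_H10_starProjection (y : K.Field) :
    ∃ w, (w, K.gradients.starProjection y) ∈ K.H10 := by
  obtain ⟨z, hz, e⟩ := K.gradients.starProjection_apply_mem y
  exact ⟨z.1, by rwa [← e]⟩

/-- With P the projection onto `gradients`, put v = v₀ + w with ∇w = P(F p - G₀), so that Δv = p for
every p. As ⟨w, q⟩ = -⟨F q, ∇w⟩, the moment conditions become ⟨P F p, F q⟩ = ⟨v₀, q⟩ + ⟨P G₀, F q⟩ -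
m q, a definite system for p. -/
lemma exists_dirichlet (l : ℤ) (v₀ : K.L2) (G₀ : Fin 2 → K.L2)
    (m : Module.Dual ℝ (polyDeg l)) :
    ∃ (v : K.L2) (G : Fin 2 → K.L2), (v - v₀, WithLp.toLp 2 (G - G₀)) ∈ K.H10 ∧
      (∃ p ∈ polyDeg l, K.HasWeakLaplacian G (polyFun p)) ∧
      ∀ q : polyDeg l, inner ℝ v (K.polyL2 (q : MvPolynomial (Fin 2) ℝ)) = m q := by
  obtain ⟨F, hF⟩ := K.exists_field
  obtain ⟨y₀, hy₀⟩ : ∃ y₀ : K.Field, y₀ = WithLp.toLp 2 G₀ := ⟨_, rfl⟩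
  obtain ⟨p, hp⟩ := exists_inner_starProjection_eq K.gradients (F ∘ₗ (polyDeg l).subtype)
    -- If P F p = 0, then p is orthogonal to all test functions.
    (fun p hp => Subtype.ext (polyL2_eq_zero (K := K) (eq_zero_of_inner_test fun φ hφ => by
      have h2 := hF p _ hφ.smoothPair_mem_H10
      have h3 := inner_starProjection_gradients (F p) hφ.smoothPair_mem_H10
      have h4 : K.gradients.starProjection (F p) = 0 := hp
      rw [h4, inner_zero_left, h2] at h3
      exact neg_eq_zero.1 h3.symm)))
    ((innerₗ K.L2 v₀) ∘ₗ K.polyL2 ∘ₗ (polyDeg l).subtype +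
      (innerₗ K.Field (K.gradients.starProjection y₀)) ∘ₗ F ∘ₗ (polyDeg l).subtype - m)
  replace hp : ∀ q : polyDeg l, inner ℝ (K.gradients.starProjection (F p)) (F q) =
      inner ℝ v₀ (K.polyL2 q) + inner ℝ (K.gradients.starProjection y₀) (F q) - m q := hp
  obtain ⟨w, hw⟩ := exists_mem_H10_starProjection (F p - y₀)
  refine ⟨v₀ + w, G₀ + WithLp.ofLp (K.gradients.starProjection (F p - y₀)), ?_, ⟨p, p.2, ?_⟩,
    fun q => ?_⟩
  · rwa [add_sub_cancel_left, add_sub_cancel_left]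
  · rw [hasWeakLaplacian_iff]
    intro z hz
    rw [WithLp.toLp_add, WithLp.toLp_ofLp, inner_add_left, inner_starProjection_gradients _ hz,
      inner_sub_left, ← hy₀, add_sub_cancel, hF _ _ hz]
  · have h1 := hF q _ hw
    have h2 := hp q
    dsimp only at h1
    rw [map_sub, inner_sub_right, real_inner_comm (K.gradients.starProjection (F p)),
      real_inner_comm (K.gradients.starProjection y₀), real_inner_comm w] at h1
    rw [inner_add_left]
    linarith

lemma IsH1.of_sub_mem_H10 {v v₀ : K.L2} {G G₀ : Fin 2 → K.L2} {g : Plane → ℝ}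
    (h : K.IsH1 v₀ G₀ g) (hz : (v - v₀, WithLp.toLp 2 (G - G₀)) ∈ K.H10) : K.IsH1 v G g := by
  have := (isH1_zero_of_mem_H10 hz).add h
  rwa [sub_add_cancel, sub_add_cancel, zero_add] at this

/-! ### The elliptic projection -/

/-- The integral over the boundary. -/
def bdryIntegral (K : PolygonalElement n) (g : Plane → ℝ) : ℝ :=
  ∑ i, K.edgeIntegral i fun t => g (K.polygon.edgePath ℝ i t)

/-- The integral over the boundary of a polynomial. -/
def polyBdry (K : PolygonalElement n) : MvPolynomial (Fin 2) ℝ →ₗ[ℝ] ℝ where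
  toFun q := K.bdryIntegral (polyFun q)
  map_add' p q := by
    unfold bdryIntegral edgeIntegral
    rw [← Finset.sum_add_distrib]
    refine Finset.sum_congr rfl fun i _ => ?_
    rw [← mul_add, ← intervalIntegral.integral_add (intervalIntegrable_poly_edge p i)
      (intervalIntegrable_poly_edge q i)]
    simp [polyFun]
  map_smul' a p := by
    unfold bdryIntegral edgeIntegral
    rw [RingHom.id_apply, smul_eq_mul, Finset.mul_sum]
    refine Finset.sum_congr rfl fun i _ => ?_
    rw [mul_left_comm, ← intervalIntegral.integral_const_mul]
    simp [polyFun]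

lemma polyBdry_C (a : ℝ) :
    K.polyBdry (MvPolynomial.C a) = a * ∑ i, K.edgeLength i := by
  change K.bdryIntegral _ = _
  unfold bdryIntegral edgeIntegral
  rw [Finset.mul_sum]
  exact Finset.sum_congr rfl fun i _ => by simp [polyFun, mul_comm]

lemma perimeter_pos (K : PolygonalElement n) : 0 < ∑ i, K.edgeLength i :=
  Finset.sum_pos (fun i _ => edgeLength_pos i)
    ⟨⟨0, by have := K.three_le; omega⟩, Finset.mem_univ _⟩

lemma eq_zero_of_polyGrad {q : MvPolynomial (Fin 2) ℝ} (h : K.polyGrad q = 0)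
    (hb : K.polyBdry q = 0) : q = 0 := by
  have h1 := eq_C_of_pderiv_eq_zero (p := q) fun i =>
    polyL2_eq_zero (K := K) (congrArg (fun y : K.Field => y i) h)
  rw [h1, polyBdry_C] at hb
  rw [h1, (mul_eq_zero.1 hb).resolve_right K.perimeter_pos.ne', map_zero]

lemma isEllipticProjection_iff {k : ℕ} {G : Fin 2 → K.L2} {g : Plane → ℝ}
    (hg : ContinuousOn g (frontier K.carrier)) {q : MvPolynomial (Fin 2) ℝ} :
    K.IsEllipticProjection k G g q ↔ q ∈ polyDeg k ∧
      (∀ r ∈ polyDeg k, inner ℝ (WithLp.toLp 2 G - K.polyGrad q) (K.polyGrad r) = 0) ∧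
      K.bdryIntegral g = K.polyBdry q := by
  have e1 : ∀ r, ∑ i, ∫ x, (G i x - polyFun (MvPolynomial.pderiv i q) x) *
      polyFun (MvPolynomial.pderiv i r) x ∂K.vol =
        inner ℝ (WithLp.toLp 2 G - K.polyGrad q) (K.polyGrad r) := by
    intro r
    rw [PiLp.inner_apply]
    refine Finset.sum_congr rfl fun i _ => ?_
    rw [integral_sub_mul _ (continuous_polyFun _) (continuous_polyFun _), ← inner_polyL2,
      ← inner_toL2_toL2 (continuous_polyFun _) (continuous_polyFun _), PiLp.sub_apply,
      inner_sub_left]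
    rfl
  have e2 : ∑ i, K.edgeIntegral i (fun t => g (K.polygon.edgePath ℝ i t) -
      polyFun q (K.polygon.edgePath ℝ i t)) = K.bdryIntegral g - K.polyBdry q := by
    change _ = K.bdryIntegral g - K.bdryIntegral (polyFun q)
    unfold bdryIntegral edgeIntegral
    rw [← Finset.sum_sub_distrib]
    refine Finset.sum_congr rfl fun i _ => ?_
    rw [← mul_sub, ← intervalIntegral.integral_sub (intervalIntegrable_edge hg i)
      (intervalIntegrable_poly_edge q i)]
  constructor
  · rintro ⟨h1, h2, h3⟩
    exact ⟨h1, fun r hr => (e1 r).symm.trans (h2 r hr), sub_eq_zero.1 (e2.symm.trans h3)⟩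
  · rintro ⟨h1, h2, h3⟩
    exact ⟨h1, fun r hr => (e1 r).trans (h2 r hr), e2.trans (sub_eq_zero.2 h3)⟩

/-- The two conditions are merged into one system on P_k with the form ⟨∇q, ∇r⟩ + (∫_∂ q)(∫_∂ r). It
is definite, since a polynomial with zero gradient is constant and then has zero boundary integral
only if it is 0. -/
lemma exists_isEllipticProjection (k : ℕ) (G : Fin 2 → K.L2) {g : Plane → ℝ}
    (hg : ContinuousOn g (frontier K.carrier)) : ∃ q, K.IsEllipticProjection k G g q := by
  let B : polyDeg k →ₗ[ℝ] K.Field := K.polyGrad ∘ₗ (polyDeg k).subtype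
  let M : polyDeg k →ₗ[ℝ] ℝ := K.polyBdry ∘ₗ (polyDeg k).subtype
  let T : polyDeg k →ₗ[ℝ] Module.Dual ℝ (polyDeg k) :=
    (innerₗ K.Field).compl₁₂ B B + (LinearMap.mul ℝ ℝ).compl₁₂ M M
  have hTa : ∀ q r, T q r = inner ℝ (B q) (B r) + M q * M r := fun q r => rfl
  have hT : Function.Injective T := by
    rw [← LinearMap.ker_eq_bot, LinearMap.ker_eq_bot']
    intro q hq
    have h1 := LinearMap.congr_fun hq q
    rw [hTa, LinearMap.zero_apply, real_inner_self_eq_norm_sq] at h1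
    have h2 : ‖B q‖ = 0 := by nlinarith [sq_nonneg ‖B q‖, mul_self_nonneg (M q)]
    have h3 : M q = 0 := by
      rw [h2] at h1
      exact mul_self_eq_zero.1 (by linarith)
    exact Subtype.ext (eq_zero_of_polyGrad (norm_eq_zero.1 h2) h3)
  let S : Module.Dual ℝ (polyDeg k) := (innerₗ K.Field (WithLp.toLp 2 G)) ∘ₗ B +
    K.bdryIntegral g • M
  obtain ⟨q, hq⟩ := (bijective_of_injective_dual T hT).2 S
  have key : ∀ r, inner ℝ (B q) (B r) + M q * M r =
      inner ℝ (WithLp.toLp 2 G) (B r) + K.bdryIntegral g * M r := fun r =>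
    LinearMap.congr_fun hq r
  -- Testing with r = 1 isolates the boundary condition, since the perimeter is nonzero; what
  -- remains of the system is the gradient condition.
  have hone := key ⟨MvPolynomial.C 1, C_mem_polyDeg (by positivity) 1⟩
  have hB1 : B ⟨MvPolynomial.C 1, C_mem_polyDeg (by positivity) 1⟩ = 0 := by
    refine PiLp.ext fun i => ?_
    change K.polyL2 (MvPolynomial.pderiv i (MvPolynomial.C 1)) = 0
    rw [MvPolynomial.pderiv_C, map_zero]
  have hM1 : M ⟨MvPolynomial.C 1, C_mem_polyDeg (by positivity) 1⟩ = ∑ i, K.edgeLength i :=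
    (polyBdry_C 1).trans (one_mul _)
  rw [hB1, hM1, inner_zero_right, inner_zero_right, zero_add, zero_add] at hone
  have hM := mul_right_cancel₀ K.perimeter_pos.ne' hone
  refine ⟨q, (isEllipticProjection_iff hg).2 ⟨q.2, fun r hr => ?_, hM.symm⟩⟩
  have := key ⟨r, hr⟩
  rw [hM, add_left_inj] at this
  rw [inner_sub_left, sub_eq_zero]
  exact this.symm

end PolygonalElement

namespace PolygonalElement

variable {n : ℕ} {K : PolygonalElement n}

/-! ### The degrees of freedom of a function with given trace -/

lemma inv_mul_edgeIntegral (i : Fin n) (f : ℝ → ℝ) :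
    (K.edgeLength i)⁻¹ * K.edgeIntegral i f = ∫ t in (0 : ℝ)..1, f t :=
  inv_mul_cancel_left₀ (edgeLength_pos i).ne' _

lemma area_pos (K : PolygonalElement n) : 0 < volume.real K.carrier :=
  ENNReal.toReal_pos (K.isOpen.measure_pos volume K.isConnected.nonempty).ne'
    K.isBounded.measure_lt_top.ne

lemma intervalIntegrable_edge_mul {g : Plane → ℝ} (hg : ContinuousOn g (frontier K.carrier))
    (i : Fin n) (q : Polynomial ℝ) :
    IntervalIntegrable (fun t => g (K.polygon.edgePath ℝ i t) * q.eval t) volume 0 1 :=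
  (intervalIntegrable_edge hg i).mul_continuousOn q.continuous.continuousOn

/-- The edge moments of a continuous function on the boundary. -/
def traceMoments (K : PolygonalElement n) (k : ℕ) {g : Plane → ℝ}
    (hg : ContinuousOn g (frontier K.carrier)) (i : Fin n) :
    Module.Dual ℝ (Polynomial.degreeLT ℝ k) where
  toFun q := ∫ t in (0 : ℝ)..1, g (K.polygon.edgePath ℝ i t) * (q : Polynomial ℝ).eval t
  map_add' p q := by
    rw [← intervalIntegral.integral_add (intervalIntegrable_edge_mul hg i _)
      (intervalIntegrable_edge_mul hg i _)]
    simp only [Submodule.coe_add, Polynomial.eval_add, mul_add]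
  map_smul' c q := by
    rw [RingHom.id_apply, smul_eq_mul, ← intervalIntegral.integral_const_mul]
    simp only [Submodule.coe_smul, Polynomial.eval_smul, smul_eq_mul, mul_left_comm]

lemma traceMoments_apply (k : ℕ) {g : Plane → ℝ} (hg : ContinuousOn g (frontier K.carrier))
    (i : Fin n) (q : Polynomial.degreeLT ℝ k) : K.traceMoments k hg i q =
      ∫ t in (0 : ℝ)..1, g (K.polygon.edgePath ℝ i t) * (q : Polynomial ℝ).eval t := rfl

/-- The cell moments of a square integrable function. -/
def cellMoments (l : ℤ) (v : K.L2) : Module.Dual ℝ (polyDeg l) :=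
  (volume.real K.carrier)⁻¹ • (innerₗ K.L2 v ∘ₗ K.polyL2 ∘ₗ (polyDeg l).subtype)

lemma cellMoments_apply (l : ℤ) (v : K.L2) (q : polyDeg l) :
    cellMoments l v q = (volume.real K.carrier)⁻¹ * inner ℝ v (K.polyL2 q) := rfl

/-- The degrees of freedom of `v`, computed from a continuous trace `g` of `v`. -/
def dofs (k : ℕ) (v : K.L2) {g : Plane → ℝ} (hg : ContinuousOn g (frontier K.carrier)) :
    DofValues n k :=
  (fun i => g (K.polygon i), K.traceMoments k hg, cellMoments _ v)

lemma isDofs_iff {k : ℕ} {v : K.L2} {d : DofValues n k} :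
    K.IsDofs k v d ↔ ∃ G g, ∃ h : K.IsH1 v G g, d = dofs k v h.continuousOn := by
  constructor
  · rintro ⟨G, g, h, h1, h2, h3⟩
    refine ⟨G, g, h, Prod.ext (funext h1) (Prod.ext (funext fun i => LinearMap.ext fun q => ?_)
      (LinearMap.ext fun q => ?_))⟩
    · rw [h2, inv_mul_edgeIntegral]
      rfl
    · rw [h3, ← inner_polyL2]
      rfl
  · rintro ⟨G, g, h, rfl⟩
    refine ⟨G, g, h, fun i => rfl, fun i q => ?_, fun q => ?_⟩
    · rw [inv_mul_edgeIntegral]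
      rfl
    · rw [← inner_polyL2]
      rfl

lemma IsH1.isDofs {v : K.L2} {G : Fin 2 → K.L2} {g : Plane → ℝ} (h : K.IsH1 v G g) (k : ℕ) :
    K.IsDofs k v (dofs k v h.continuousOn) :=
  isDofs_iff.2 ⟨G, g, h, rfl⟩

lemma dofs_congr {k : ℕ} (v : K.L2) {g g' : Plane → ℝ} (hg : ContinuousOn g (frontier K.carrier))
    (hg' : ContinuousOn g' (frontier K.carrier))
    (e : ∀ i, ∀ t ∈ Icc (0 : ℝ) 1,
      g (K.polygon.edgePath ℝ i t) = g' (K.polygon.edgePath ℝ i t)) :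
    dofs k v hg = dofs k v hg' := by
  refine Prod.ext (funext fun i => ?_) (Prod.ext (funext fun i => LinearMap.ext fun q => ?_) rfl)
  · have := e i 0 ⟨le_rfl, zero_le_one⟩
    rwa [edgePath_zero] at this
  · refine intervalIntegral.integral_congr fun t ht => ?_
    rw [uIcc_of_le zero_le_one] at ht
    rw [e i t ht]

/-- `IsDofs` allows any gradient and any continuous trace of v; both are unique where they enter. -/
lemma StarBall.eq_dofs {c : Plane} {r : ℝ} (hs : K.StarBall c r) {k : ℕ} {v : K.L2}
    {G : Fin 2 → K.L2} {g : Plane → ℝ} (h : K.IsH1 v G g) {d : DofValues n k}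
    (hd : K.IsDofs k v d) : d = dofs k v h.continuousOn := by
  obtain ⟨G', g', h', rfl⟩ := isDofs_iff.1 hd
  obtain rfl := h.hasWeakGradient.unique h'.hasWeakGradient
  exact dofs_congr v _ _ fun i t ht => hs.trace_unique h' h i ht

lemma IsDofs.add {k : ℕ} {v v' : K.L2} {d d' : DofValues n k} (hd : K.IsDofs k v d)
    (hd' : K.IsDofs k v' d') : K.IsDofs k (v + v') (d + d') := by
  obtain ⟨G, g, h, rfl⟩ := isDofs_iff.1 hd
  obtain ⟨G', g', h', rfl⟩ := isDofs_iff.1 hd'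
  refine isDofs_iff.2 ⟨_, _, h.add h', Prod.ext rfl (Prod.ext (funext fun i =>
    LinearMap.ext fun q => ?_) (LinearMap.ext fun q => ?_))⟩
  · change K.traceMoments k h.continuousOn i q + K.traceMoments k h'.continuousOn i q =
      K.traceMoments k (h.add h').continuousOn i q
    simp only [traceMoments_apply, Pi.add_apply, add_mul]
    exact (intervalIntegral.integral_add (intervalIntegrable_edge_mul h.continuousOn i _)
      (intervalIntegrable_edge_mul h'.continuousOn i _)).symm
  · change cellMoments _ v q + cellMoments _ v' q = cellMoments _ (v + v') q
    simp only [cellMoments_apply, inner_add_left, mul_add]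

lemma IsDofs.smul {k : ℕ} {v : K.L2} {d : DofValues n k} (a : ℝ) (hd : K.IsDofs k v d) :
    K.IsDofs k (a • v) (a • d) := by
  obtain ⟨G, g, h, rfl⟩ := isDofs_iff.1 hd
  refine isDofs_iff.2 ⟨_, _, h.smul a, Prod.ext rfl (Prod.ext (funext fun i =>
    LinearMap.ext fun q => ?_) (LinearMap.ext fun q => ?_))⟩
  · change a • K.traceMoments k h.continuousOn i q = K.traceMoments k (h.smul a).continuousOn i q
    simp only [traceMoments_apply, Pi.smul_apply, smul_eq_mul, mul_assoc,
      intervalIntegral.integral_const_mul]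
  · change a • cellMoments _ v q = cellMoments _ (a • v) q
    simp only [cellMoments_apply, real_inner_smul_left, smul_eq_mul, mul_left_comm]

/-- Existence and uniqueness turn the relation `IsDofs` into a map, and its compatibility with sums
and multiples makes this map linear. -/
lemma StarBall.unisolvent {c : Plane} {r : ℝ} (hs : K.StarBall c r) {k : ℕ}
    {V : Submodule ℝ K.L2} (hV : ∀ v ∈ V, ∃ G g, K.IsH1 v G g)
    (hinj : ∀ v ∈ V, K.IsDofs k v 0 → v = 0) (hsurj : ∀ d, ∃ v ∈ V, K.IsDofs k v d) :
    K.Unisolvent k V := by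
  have hex : ∀ v : V, ∃ d, K.IsDofs k v d := fun v => by
    obtain ⟨G, g, h⟩ := hV v v.2
    exact ⟨_, h.isDofs k⟩
  have huniq : ∀ {v : V} {d d' : DofValues n k}, K.IsDofs k v d → K.IsDofs k v d' → d = d' := by
    intro v d d' hd hd'
    obtain ⟨G, g, h⟩ := hV v v.2
    rw [hs.eq_dofs h hd, hs.eq_dofs h hd']
  choose D hD using hex
  let Φ : V →ₗ[ℝ] DofValues n k :=
    { toFun := D
      map_add' := fun v w => huniq (hD (v + w)) ((hD v).add (hD w))
      map_smul' := fun a v => huniq (hD (a • v)) ((hD v).smul a) }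
  have hΦ : ∀ (v : V) (d : DofValues n k), K.IsDofs k v d ↔ Φ v = d := fun v d =>
    ⟨fun h => huniq (hD v) h, fun h => h ▸ hD v⟩
  refine ⟨LinearEquiv.ofBijective Φ ⟨?_, fun d => ?_⟩, hΦ⟩
  · rw [← LinearMap.ker_eq_bot, LinearMap.ker_eq_bot']
    exact fun v hv => Subtype.ext (hinj v v.2 ((hΦ v 0).2 hv))
  · obtain ⟨v, hv, h⟩ := hsurj d
    exact ⟨⟨v, hv⟩, (hΦ ⟨v, hv⟩ d).1 h⟩

/-! ### Unisolvence -/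

/-- The part of injectivity that both spaces share: it does not involve the degree l of the
Laplacian. -/
lemma StarBall.mem_H10_of_isDofs_zero {c : Plane} {r : ℝ} (hs : K.StarBall c r) {k : ℕ} {l : ℤ}
    {v : K.L2} {G : Fin 2 → K.L2} {g : Plane → ℝ} (h : K.IsVirtual k l v G g)
    (hd : K.IsDofs k v 0) : (∀ i, ∀ t ∈ Icc (0 : ℝ) 1, g (K.polygon.edgePath ℝ i t) = 0) ∧
      (v, WithLp.toLp 2 G) ∈ K.H10 ∧
      ∀ q ∈ polyDeg ((k : ℤ) - 2), inner ℝ v (K.polyL2 q) = 0 := by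
  have e := hs.eq_dofs h.isH1 hd
  have e1 : ∀ i, g (K.polygon i) = 0 := fun i => (congrFun (congrArg Prod.fst e) i).symm
  have e2 : ∀ i q, K.traceMoments k h.isH1.continuousOn i q = 0 := fun i q =>
    (LinearMap.congr_fun (congrFun (congrArg (fun z => z.2.1) e) i) q).symm
  have hg : ∀ i, ∀ t ∈ Icc (0 : ℝ) 1, g (K.polygon.edgePath ℝ i t) = 0 := by
    intro i
    obtain ⟨p, hp, hpg⟩ := h.edges i
    have h0 := hpg 0 ⟨le_rfl, zero_le_one⟩
    have h1 := hpg 1 ⟨zero_le_one, le_rfl⟩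
    rw [edgePath_zero, e1] at h0
    rw [edgePath_one, e1] at h1
    have hp0 : p = 0 := eq_zero_of_edge_moments hp h0.symm h1.symm fun q hq => by
      refine Eq.trans ?_ (e2 i ⟨q, hq⟩)
      refine intervalIntegral.integral_congr fun t ht => ?_
      rw [uIcc_of_le zero_le_one] at ht
      dsimp only
      rw [hpg t ht]
    intro t ht
    rw [hpg t ht, hp0, Polynomial.eval_zero]
  refine ⟨hg, hs.mem_H10_of_trace_zero (h.isH1.hasTrace.congr hg), fun q hq => ?_⟩
  have e3 := (LinearMap.congr_fun (congrArg (fun z => z.2.2) e) ⟨q, hq⟩).symm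
  exact (mul_eq_zero.1 e3).resolve_left (inv_ne_zero K.area_pos.ne')

lemma exists_space_of_dofs (k : ℕ) (d : DofValues n k) :
    ∃ v G g, ∃ h : K.IsVirtual k ((k : ℤ) - 2) v G g, d = dofs k v h.isH1.continuousOn := by
  choose p hp hp0 hp1 hpm using fun i =>
    exists_poly_of_edge_moments k (d.1 i) (d.1 (finRotate n i)) (d.2.1 i)
  obtain ⟨L, g, hL, hg⟩ := exists_lipschitz_of_polys (K := K) p fun i => by rw [hp0, hp1]
  obtain ⟨v₀, G₀, h₀⟩ := exists_isH1_of_lipschitz (K := K) hL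
  obtain ⟨v, G, hz, hl, hm⟩ :=
    -- The factor is the area, because the cell moments are averages.
    exists_dirichlet ((k : ℤ) - 2) v₀ G₀ (volume.real K.carrier • d.2.2)
  have h := h₀.of_sub_mem_H10 hz
  refine ⟨v, G, g, ⟨h, fun i => ⟨p i, hp i, hg i⟩, hl⟩, ?_⟩
  refine Prod.ext (funext fun i => ?_) (Prod.ext (funext fun i => LinearMap.ext fun q => ?_)
    (LinearMap.ext fun q => ?_))
  · have := hg i 0 ⟨le_rfl, zero_le_one⟩
    rw [edgePath_zero, hp0] at this
    exact this.symm
  · refine (hpm i q).symm.trans (intervalIntegral.integral_congr fun t ht => ?_)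
    rw [uIcc_of_le zero_le_one] at ht
    rw [hg i t ht]
  · change _ = cellMoments _ v q
    rw [cellMoments_apply, hm, LinearMap.smul_apply, smul_eq_mul,
      inv_mul_cancel_left₀ K.area_pos.ne']

lemma StarBall.unisolvent_space {c : Plane} {r : ℝ} (hs : K.StarBall c r) (k : ℕ) :
    K.Unisolvent k (K.space k) := by
  refine hs.unisolvent ?_ ?_ fun d => ?_
  · rintro v ⟨G, g, h⟩
    exact ⟨G, g, h.isH1⟩
  · rintro v ⟨G, g, h⟩ hd
    obtain ⟨-, h1, h2⟩ := hs.mem_H10_of_isDofs_zero h hd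
    obtain ⟨p, hp, hl⟩ := h.laplacian
    exact eq_zero_of_hasWeakLaplacian h1 hl (h2 p hp)
  · obtain ⟨v, G, g, h, rfl⟩ := exists_space_of_dofs (K := K) k d
    exact ⟨v, ⟨G, g, h⟩, h.isH1.isDofs k⟩

/-! ### The enhanced space -/

lemma laplacian_mem_polyDeg {k : ℕ} {q : MvPolynomial (Fin 2) ℝ} (hq : q ∈ polyDeg k) :
    ∑ i, MvPolynomial.pderiv i (MvPolynomial.pderiv i q) ∈ polyDeg ((k : ℤ) - 2) :=
  sum_mem fun i _ => by
    have := pderiv_mem_polyDeg (pderiv_mem_polyDeg hq i) i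
    rwa [sub_sub, one_add_one_eq_two] at this

/-- Integration by parts moves the gradient to Δr, which lies in P_{k-2}. Hence the elliptic
projection depends only on the trace and the moments against P_{k-2}. -/
lemma inner_polyGrad_eq_zero {k : ℕ} {z : K.Pair} (hz : z ∈ K.H10)
    (h : ∀ q ∈ polyDeg ((k : ℤ) - 2), inner ℝ z.1 (K.polyL2 q) = 0)
    {r : MvPolynomial (Fin 2) ℝ} (hr : r ∈ polyDeg k) : inner ℝ z.2 (K.polyGrad r) = 0 := by
  rw [real_inner_comm, inner_polyGrad hz, real_inner_comm, h _ (laplacian_mem_polyDeg hr),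
    neg_zero]

lemma integral_sub_polyFun_mul (v : K.L2) (q w : MvPolynomial (Fin 2) ℝ) :
    ∫ x, (v x - polyFun q x) * polyFun w x ∂K.vol = inner ℝ (v - K.polyL2 q) (K.polyL2 w) := by
  rw [integral_sub_mul _ (continuous_polyFun _) (continuous_polyFun _), inner_sub_left,
    inner_polyL2]
  congr 1
  exact (inner_toL2_toL2 (continuous_polyFun q) (continuous_polyFun w)).symm

/-- The elliptic projection of v vanishes, so the enhancement condition says that v is orthogonal to
W. Together with the cell moments this gives orthogonality to P_k, which contains Δv. -/
lemma StarBall.eq_zero_of_mem_enhancedSpace {c : Plane} {r : ℝ} (hs : K.StarBall c r) {k : ℕ}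
    {W : Submodule ℝ (MvPolynomial (Fin 2) ℝ)} (hW : IsTopDegreeSpace k W) {v : K.L2}
    (hv : v ∈ K.enhancedSpace k W) (hd : K.IsDofs k v 0) : v = 0 := by
  obtain ⟨G, g, h, q, hq, hqW⟩ := hv
  obtain ⟨hg, h1, h2⟩ := hs.mem_H10_of_isDofs_zero h hd
  obtain ⟨hqk, hqr, hqb⟩ := (isEllipticProjection_iff h.isH1.continuousOn).1 hq
  have hgrad : K.polyGrad q = 0 := by
    have := hqr q hqk
    rw [inner_sub_left, inner_polyGrad_eq_zero (z := (v, WithLp.toLp 2 G)) h1 h2 hqk, zero_sub,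
      neg_eq_zero, inner_self_eq_zero] at this
    exact this
  have hb : K.bdryIntegral g = 0 := by
    unfold bdryIntegral edgeIntegral
    refine Finset.sum_eq_zero fun i _ => ?_
    rw [intervalIntegral.integral_congr (g := fun _ => 0), intervalIntegral.integral_zero,
      mul_zero]
    intro t ht
    rw [uIcc_of_le zero_le_one] at ht
    exact hg i t ht
  obtain rfl : q = 0 := eq_zero_of_polyGrad hgrad (hqb.symm.trans hb)
  obtain ⟨p, hp, hl⟩ := h.laplacian
  refine eq_zero_of_hasWeakLaplacian h1 hl ?_
  rw [← hW.1] at hp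
  obtain ⟨p₁, hp₁, w, hw, rfl⟩ := Submodule.mem_sup.1 hp
  have h3 := hqW w hw
  rw [integral_sub_polyFun_mul, map_zero, sub_zero] at h3
  rw [map_add, inner_add_right, h2 p₁ hp₁, h3, add_zero]

/-- W embeds into the quotient by U; a left inverse of this embedding extends ν from W by zero on U.
It serves to prescribe moments on P_{k-2} and W independently. -/
lemma exists_linearMap_of_inf_eq_bot {V : Type*} [AddCommGroup V] [Module ℝ V]
    {U W : Submodule ℝ V} (h : U ⊓ W = ⊥) (ν : V →ₗ[ℝ] ℝ) :
    ∃ μ : V →ₗ[ℝ] ℝ, (∀ u ∈ U, μ u = 0) ∧ ∀ w ∈ W, μ w = ν w := by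
  have hk : LinearMap.ker (U.mkQ ∘ₗ W.subtype) = ⊥ := by
    rw [LinearMap.ker_eq_bot']
    intro w hw
    have h1 : (w : V) ∈ U := (Submodule.Quotient.mk_eq_zero U).1 hw
    have h2 : (w : V) ∈ U ⊓ W := ⟨h1, w.2⟩
    rw [h, Submodule.mem_bot] at h2
    exact Subtype.ext h2
  obtain ⟨s, hs⟩ := LinearMap.exists_leftInverse_of_injective _ hk
  refine ⟨ν ∘ₗ W.subtype ∘ₗ s ∘ₗ U.mkQ, fun u hu => ?_, fun w hw => ?_⟩
  · have : U.mkQ u = 0 := (Submodule.Quotient.mk_eq_zero U).2 hu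
    simp only [LinearMap.comp_apply, this, map_zero]
  · have : s (U.mkQ w) = ⟨w, hw⟩ := LinearMap.congr_fun hs ⟨w, hw⟩
    simp only [LinearMap.comp_apply, this, Submodule.subtype_apply]

lemma exists_mem_enhancedSpace_of_dofs {k : ℕ} {W : Submodule ℝ (MvPolynomial (Fin 2) ℝ)}
    (hW : IsTopDegreeSpace k W) (d : DofValues n k) :
    ∃ v ∈ K.enhancedSpace k W, K.IsDofs k v d := by
  obtain ⟨v₀, G₀, g, h₀, rfl⟩ := exists_space_of_dofs (K := K) k d
  obtain ⟨q, hq⟩ := exists_isEllipticProjection k G₀ h₀.isH1.continuousOn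
  -- The correction μ leaves the moments of v₀ against P_{k-2} unchanged and replaces those against
  -- W by the moments of q.
  obtain ⟨μ, hμ, hμW⟩ := exists_linearMap_of_inf_eq_bot hW.2
    (innerₗ K.L2 (K.polyL2 q - v₀) ∘ₗ K.polyL2)
  obtain ⟨v, G, hz, hl, hm⟩ := exists_dirichlet (k : ℤ) v₀ G₀
    ((innerₗ K.L2 v₀ ∘ₗ K.polyL2 + μ) ∘ₗ (polyDeg (k : ℤ)).subtype)
  replace hm : ∀ p ∈ polyDeg (k : ℤ), inner ℝ v (K.polyL2 p) =
      inner ℝ v₀ (K.polyL2 p) + μ p := fun p hp => hm ⟨p, hp⟩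
  have h := h₀.isH1.of_sub_mem_H10 hz
  have horth : ∀ p ∈ polyDeg ((k : ℤ) - 2), inner ℝ v (K.polyL2 p) =
      inner ℝ v₀ (K.polyL2 p) := fun p hp => by
    rw [hm p (polyDeg_mono (by omega) hp), hμ p hp, add_zero]
  obtain ⟨hqk, hqr, hqb⟩ := (isEllipticProjection_iff h₀.isH1.continuousOn).1 hq
  -- The difference v - v₀ has zero trace and is orthogonal to P_{k-2}, so q is the elliptic
  -- projection of v too.
  have hq' : K.IsEllipticProjection k G g q := by
    refine (isEllipticProjection_iff h.continuousOn).2 ⟨hqk, fun r hr => ?_, hqb⟩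
    have h1 := inner_polyGrad_eq_zero hz (fun p hp => by
      rw [inner_sub_left, horth p hp, sub_self]) hr
    have h2 := hqr r hr
    rw [WithLp.toLp_sub, inner_sub_left] at h1
    rw [inner_sub_left] at h2 ⊢
    linarith
  refine ⟨v, ⟨G, g, ⟨h, h₀.edges, hl⟩, q, hq', fun w hw => ?_⟩, isDofs_iff.2 ⟨G, g, h, ?_⟩⟩
  · have hwk : w ∈ polyDeg (k : ℤ) := hW.1 ▸ Submodule.mem_sup_right hw
    have h1 : μ w = inner ℝ (K.polyL2 q - v₀) (K.polyL2 w) := hμW w hw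
    rw [integral_sub_polyFun_mul, inner_sub_left, hm w hwk, h1, inner_sub_left]
    ring
  · refine Prod.ext rfl (Prod.ext rfl (LinearMap.ext fun p => ?_))
    change cellMoments _ v₀ p = cellMoments _ v p
    rw [cellMoments_apply, cellMoments_apply, horth p p.2]

lemma StarBall.unisolvent_enhancedSpace {c : Plane} {r : ℝ} (hs : K.StarBall c r) {k : ℕ}
    {W : Submodule ℝ (MvPolynomial (Fin 2) ℝ)} (hW : IsTopDegreeSpace k W) :
    K.Unisolvent k (K.enhancedSpace k W) := by
  refine hs.unisolvent ?_ (fun v hv => hs.eq_zero_of_mem_enhancedSpace hW hv) 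
    (exists_mem_enhancedSpace_of_dofs hW)
  rintro v ⟨G, g, h, -⟩
  exact ⟨G, g, h.isH1⟩

end PolygonalElement

end

end VEM

theorem mainTheorem5 {n : ℕ} (K : VEM.PolygonalElement n) {ρ : ℝ} (hρ : 0 < ρ)
    (hK : K.IsRegular ρ) (k : ℕ) (hk : 1 ≤ k) :
    K.Unisolvent k (K.space k) ∧
    ∀ W : Submodule ℝ (MvPolynomial (Fin 2) ℝ), VEM.IsTopDegreeSpace k W →
      K.Unisolvent k (K.enhancedSpace k W) := by
  obtain ⟨c, r, hs⟩ := hK.exists_starBall hρ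
  exact ⟨hs.unisolvent_space k, fun W hW => hs.unisolvent_enhancedSpace hW⟩
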